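/- Let $(M^{2n},J,g)$ be a Hermitian manifold, not necessarily compact: $M$ is a smooth manifold of real dimension $2n$, $J$ is an integrable (i.e. with vanishing Nijenhuis tensor) almost complex structure and $g$ is a $J$-invariant Riemannian metric. A connection on $TM$ is called Hermitian if $g$ and $J$ are parallel. Let $\nabla^c$ be the Chern connection (the Hermitian connection whose torsion has vanishing $(1,1)$-part), let $\nabla^b$ be the Bismut connection (the Hermitian connection with totally skew-symmetric torsion), and for $s\in\mathbb{R}$ let $$\nabla^s=\left(1-\tfrac s2\right)\nabla^c+\tfrac s2\,\nabla^b$$ be the Gauduchon connection with parameter $s$, with curvature $R^s(X,Y)=[\nabla^s_X,\nabla^s_Y]-\nabla^s_{[X,Y]}$. Suppose that $s\notin\{0,\tfrac23,\tfrac45,2\}$. If $\nabla^s$ is flat, that is, $R^s=0$, then $(M,J,g)$ is Kähler, that is, its fundamental form $\omega=g(J\cdot,\cdot)$ satisfies $d\omega=0$. More generally, $(M,J,g)$ is Kähler whenever $\nabla^s$ is Kähler-like, that is, whenever $$R^s(X,Y)Z+R^s(Y,Z)X+R^s(Z,X)Y=0\quad\text{and}\quad R^s(JX,JY)=R^s(X,Y)$$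 for all vector fields $X,Y,Z$. -/

import Mathlib

open scoped Manifold ContDiff
open Bundle VectorField

noncomputable section

section GauduchonDefs

/-- Smoothness near `x` of a vector field on a manifold modelled on the vector space `E`. -/
def SmoothFieldAt {E : Type*} [NormedAddCommGroup E] [NormedSpace ℝ E]
    {M : Type*} [TopologicalSpace M] [ChartedSpace E M] [IsManifold 𝓘(ℝ, E) ∞ M]
    (X : Π x : M, TangentSpace 𝓘(ℝ, E) x) (x : M) : Prop :=
  ContMDiffAt 𝓘(ℝ, E) 𝓘(ℝ, E).tangent ∞ (fun y ↦ (⟨y, X y⟩ : TangentBundle 𝓘(ℝ, E) M)) x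

/-- A complex structure `J` on a smooth manifold: a smooth field of endomorphisms of the tangent
spaces with `J² = -1` and vanishing Nijenhuis tensor. -/
structure ComplexStructure (E : Type*) [NormedAddCommGroup E] [NormedSpace ℝ E]
    (M : Type*) [TopologicalSpace M] [ChartedSpace E M] [IsManifold 𝓘(ℝ, E) ∞ M] where
  /-- The endomorphism of each tangent space. -/
  toFun : Π x : M, TangentSpace 𝓘(ℝ, E) x →L[ℝ] TangentSpace 𝓘(ℝ, E) x
  smooth : ContMDiff 𝓘(ℝ, E) (𝓘(ℝ, E).prod 𝓘(ℝ, E →L[ℝ] E)) ∞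
    (fun x : M ↦ TotalSpace.mk' (E →L[ℝ] E)
      (E := fun x : M ↦ TangentSpace 𝓘(ℝ, E) x →L[ℝ] TangentSpace 𝓘(ℝ, E) x) x (toFun x))
  sq_eq_neg : ∀ (x : M) (v : TangentSpace 𝓘(ℝ, E) x), toFun x (toFun x v) = -v
  integrable : ∀ (x : M) (X Y : Π x : M, TangentSpace 𝓘(ℝ, E) x),
    SmoothFieldAt X x → SmoothFieldAt Y x →
      mlieBracket 𝓘(ℝ, E) (fun y ↦ toFun y (X y)) (fun y ↦ toFun y (Y y)) x
        - toFun x (mlieBracket 𝓘(ℝ, E) (fun y ↦ toFun y (X y)) Y x)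
        - toFun x (mlieBracket 𝓘(ℝ, E) X (fun y ↦ toFun y (Y y)) x)
        - mlieBracket 𝓘(ℝ, E) X Y x = 0

variable {E : Type*} [NormedAddCommGroup E] [NormedSpace ℝ E]
  {M : Type*} [TopologicalSpace M] [ChartedSpace E M] [IsManifold 𝓘(ℝ, E) ∞ M]

/-- The vector field `JX`. -/
def ComplexStructure.onField (J : ComplexStructure E M) (X : Π x : M, TangentSpace 𝓘(ℝ, E) x) :
    Π x : M, TangentSpace 𝓘(ℝ, E) x :=
  fun x ↦ J.toFun x (X x)

/-- The curvature `R(X, Y) Z = ∇_X ∇_Y Z - ∇_Y ∇_X Z - ∇_[X, Y] Z` of a connection on the tangent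
bundle, at the point `x`. (In Mathlib, `D Z x v` is `∇_v Z`.) -/
def connCurvature (D : CovariantDerivative 𝓘(ℝ, E) E (fun x : M ↦ TangentSpace 𝓘(ℝ, E) x))
    (X Y Z : Π x : M, TangentSpace 𝓘(ℝ, E) x) (x : M) : TangentSpace 𝓘(ℝ, E) x :=
  D (fun y ↦ D Z y (Y y)) x (X x) - D (fun y ↦ D Z y (X y)) x (Y x)
    - D Z x (mlieBracket 𝓘(ℝ, E) X Y x)

/-- The connection is flat: `R = 0`. -/
def IsFlatConnection
    (D : CovariantDerivative 𝓘(ℝ, E) E (fun x : M ↦ TangentSpace 𝓘(ℝ, E) x)) : Prop :=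
  ∀ (x : M) (X Y Z : Π x : M, TangentSpace 𝓘(ℝ, E) x),
    SmoothFieldAt X x → SmoothFieldAt Y x → SmoothFieldAt Z x → connCurvature D X Y Z x = 0

/-- The connection is Kähler-like: its curvature satisfies the torsion-less first Bianchi identity
`R(X, Y) Z + R(Y, Z) X + R(Z, X) Y = 0` and the type condition `R(JX, JY) = R(X, Y)`. -/
def IsKahlerLike (J : ComplexStructure E M)
    (D : CovariantDerivative 𝓘(ℝ, E) E (fun x : M ↦ TangentSpace 𝓘(ℝ, E) x)) : Prop :=
  ∀ (x : M) (X Y Z : Π x : M, TangentSpace 𝓘(ℝ, E) x),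
    SmoothFieldAt X x → SmoothFieldAt Y x → SmoothFieldAt Z x →
      connCurvature D X Y Z x + connCurvature D Y Z X x + connCurvature D Z X Y x = 0 ∧
      connCurvature D (J.onField X) (J.onField Y) Z x = connCurvature D X Y Z x

/-- The Riemannian metric `g` is `J`-invariant, that is, Hermitian. -/
def IsHermitianMetric (J : ComplexStructure E M)
    (g : ContMDiffRiemannianMetric 𝓘(ℝ, E) ∞ E (fun x : M ↦ TangentSpace 𝓘(ℝ, E) x)) : Prop :=
  ∀ (x : M) (v w : TangentSpace 𝓘(ℝ, E) x),
    g.inner x (J.toFun x v) (J.toFun x w) = g.inner x v w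

/-- The fundamental form `ω = g(J·, ·)`, evaluated on vector fields. -/
def fundamentalForm (J : ComplexStructure E M)
    (g : ContMDiffRiemannianMetric 𝓘(ℝ, E) ∞ E (fun x : M ↦ TangentSpace 𝓘(ℝ, E) x))
    (X Y : Π x : M, TangentSpace 𝓘(ℝ, E) x) :
    M → ℝ :=
  fun x ↦ g.inner x (J.toFun x (X x)) (Y x)

/-- The exterior derivative `dω` of the fundamental form, evaluated on three vector fields. -/
def dFundamentalForm (J : ComplexStructure E M)
    (g : ContMDiffRiemannianMetric 𝓘(ℝ, E) ∞ E (fun x : M ↦ TangentSpace 𝓘(ℝ, E) x))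
    (X Y Z : Π x : M, TangentSpace 𝓘(ℝ, E) x)
    (x : M) : ℝ :=
  d% (fundamentalForm J g Y Z) x (X x) + d% (fundamentalForm J g Z X) x (Y x)
    + d% (fundamentalForm J g X Y) x (Z x)
    - fundamentalForm J g (mlieBracket 𝓘(ℝ, E) X Y) Z x
    - fundamentalForm J g (mlieBracket 𝓘(ℝ, E) Y Z) X x
    - fundamentalForm J g (mlieBracket 𝓘(ℝ, E) Z X) Y x

/-- The Kähler condition `dω = 0` on a Hermitian manifold. -/
def IsKahler (J : ComplexStructure E M)
    (g : ContMDiffRiemannianMetric 𝓘(ℝ, E) ∞ E (fun x : M ↦ TangentSpace 𝓘(ℝ, E) x)) : Prop :=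
  ∀ (x : M) (X Y Z : Π x : M, TangentSpace 𝓘(ℝ, E) x),
    SmoothFieldAt X x → SmoothFieldAt Y x → SmoothFieldAt Z x → dFundamentalForm J g X Y Z x = 0

variable [FiniteDimensional ℝ E] [CompleteSpace E]

/-- Hermitian connections: those for which `g` and `J` are parallel. -/
structure IsHermitianConnection (J : ComplexStructure E M)
    (g : ContMDiffRiemannianMetric 𝓘(ℝ, E) ∞ E (fun x : M ↦ TangentSpace 𝓘(ℝ, E) x))
    (D : CovariantDerivative 𝓘(ℝ, E) E (fun x : M ↦ TangentSpace 𝓘(ℝ, E) x)) : Prop where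
  metric : ∀ (x : M) (X Y : Π x : M, TangentSpace 𝓘(ℝ, E) x) (v : TangentSpace 𝓘(ℝ, E) x),
    MDiffAt (T% X) x → MDiffAt (T% Y) x →
      d% (fun y ↦ g.inner y (X y) (Y y)) x v
        = g.inner x (D X x v) (Y x) + g.inner x (X x) (D Y x v)
  parallel : ∀ (x : M) (X : Π x : M, TangentSpace 𝓘(ℝ, E) x) (v : TangentSpace 𝓘(ℝ, E) x),
    MDiffAt (T% X) x → D (J.onField X) x v = J.toFun x (D X x v)

/-- The Chern connection: the Hermitian connection whose torsion has vanishing `(1,1)`-part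
`T^{1,1}(v, w) = (T(v, w) + T(Jv, Jw)) / 2`. -/
structure IsChernConnection (J : ComplexStructure E M)
    (g : ContMDiffRiemannianMetric 𝓘(ℝ, E) ∞ E (fun x : M ↦ TangentSpace 𝓘(ℝ, E) x))
    (D : CovariantDerivative 𝓘(ℝ, E) E (fun x : M ↦ TangentSpace 𝓘(ℝ, E) x)) : Prop where
  hermitian : IsHermitianConnection J g D
  torsion_one_one : ∀ (x : M) (v w : TangentSpace 𝓘(ℝ, E) x),
    D.torsion x v w + D.torsion x (J.toFun x v) (J.toFun x w) = 0

/-- The Bismut connection: the Hermitian connection with totally skew-symmetric torsion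
(the torsion of any connection is already skew-symmetric in its two arguments). -/
structure IsBismutConnection (J : ComplexStructure E M)
    (g : ContMDiffRiemannianMetric 𝓘(ℝ, E) ∞ E (fun x : M ↦ TangentSpace 𝓘(ℝ, E) x))
    (D : CovariantDerivative 𝓘(ℝ, E) E (fun x : M ↦ TangentSpace 𝓘(ℝ, E) x)) : Prop where
  hermitian : IsHermitianConnection J g D
  torsion_skew : ∀ (x : M) (u v w : TangentSpace 𝓘(ℝ, E) x),
    g.inner x (D.torsion x u v) w = -g.inner x (D.torsion x u w) v

/-- `D` is the Gauduchon connection `∇^s = (1 - s/2) ∇^c + (s/2) ∇^b`, where `∇^c` is the Chern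
connection and `∇^b` the Bismut connection. -/
def IsGauduchonConnection (J : ComplexStructure E M)
    (g : ContMDiffRiemannianMetric 𝓘(ℝ, E) ∞ E (fun x : M ↦ TangentSpace 𝓘(ℝ, E) x))
    (s : ℝ)
    (D : CovariantDerivative 𝓘(ℝ, E) E (fun x : M ↦ TangentSpace 𝓘(ℝ, E) x)) : Prop :=
  ∃ Dc Db : CovariantDerivative 𝓘(ℝ, E) E (fun x : M ↦ TangentSpace 𝓘(ℝ, E) x),
    IsChernConnection J g Dc ∧ IsBismutConnection J g Db ∧
      ∀ (x : M) (X : Π x : M, TangentSpace 𝓘(ℝ, E) x), MDiffAt (T% X) x →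
        D X x = (1 - s / 2) • Dc X x + (s / 2) • Db X x

end GauduchonDefs

end

noncomputable section

/-! Put a = s/2. At a point, let μ be the Chern torsion, a complex bilinear skew product on the
tangent space because J is integrable and the (1,1)-part vanishes. The torsion of ∇^s is a
combination of μ and its metric adjoint `ad μ`. Since the curvature has vanishing cyclic sum, the
first Bianchi identity involves only ∇^s μ and quadratic terms in μ, and it splits into three
components by complex type (`bianchi_components`).

Contracting one component gives `divergence_identity`: a divergence equals a²|μ|² + a(1-3a)|κ|²,
where κ is dual, up to sign, to the trace of μ. For a = 1/4 the real part of the left side is zero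
and μ = 0 at once. Otherwise, if tr μ vanishes on an open set, so does the trace of its covariant
derivative, and a²|μ|² = 0. It remains to show tr μ = 0. For a = 1/2 the Bianchi identity contains a
purely algebraic identity that suffices (`trace_eq_zero_of_symmetric_identity`).

For the other values of a, the Bianchi identity makes μ a Lie bracket and determines ∇^s μ as a
quadratic expression in μ (`linPart_eq_and_jacobi`, `antiPart_eq`). Differentiating once more, the
Ricci identity, with curvature of type (1,1), makes this Lie algebra metabelian and gives a mixed
identity (`ricci_components`); differentiating the Jacobi identity gives `jacobi_deriv`. If tr μ ≠
0, there are orthogonal nonzero vectors ℓ and v such that ⟪v, ·⟫ is a weight vector of weight ⟪ℓ, ·⟫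
(`IsReduced.exists_isWeight`), and `IsWeight.mul_eq_smul` shows μ(ℓ, v) = |ℓ|² v. Evaluating the
mixed identity on ℓ and v, where the curvature cancels by its Kähler symmetry, leaves
a³(1-a)(1-3a)(2-5a) = 0: exactly the excluded parameters.

The passage to the manifold is made in charts. Smoothness of the Chern and Bismut connections is not
a hypothesis; it follows from formulas for them in terms of g and J. Finally, a torsion-free
Hermitian connection forces dω = 0. -/

namespace HermitianTorsion

set_option linter.unusedSectionVars false

/-! ### The first Bianchi identity at a point, split by complex type. -/

section FirstOrder

open scoped ComplexConjugate InnerProductSpace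

variable {V : Type*} [NormedAddCommGroup V] [InnerProductSpace ℂ V] [FiniteDimensional ℂ V]

/-- The adjoint of the left multiplication by the first argument of a bilinear product. -/
def ad (μ : V →ₗ[ℂ] V →ₗ[ℂ] V) : V →ₗ⋆[ℂ] V →ₗ[ℂ] V :=
  (LinearMap.adjoint (𝕜 := ℂ) (E := V) (F := V)).toLinearMap.comp μ

theorem ad_inner_left (μ : V →ₗ[ℂ] V →ₗ[ℂ] V) (x y z : V) :
    ⟪ad μ x y, z⟫_ℂ = ⟪y, μ x z⟫_ℂ :=
  LinearMap.adjoint_inner_left _ _ _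

theorem ad_inner_right (μ : V →ₗ[ℂ] V →ₗ[ℂ] V) (x y z : V) :
    ⟪z, ad μ x y⟫_ℂ = ⟪μ x z, y⟫_ℂ :=
  LinearMap.adjoint_inner_right _ _ _

/-- The torsion of the Gauduchon connection with parameter `s = 2a`, in terms of the Chern
torsion. -/
def gTorsion (a : ℂ) (μ : V →ₗ[ℂ] V →ₗ[ℂ] V) (x y : V) : V :=
  (1 - 2 * a) • μ x y + a • (ad μ x y - ad μ y x)

/-- The covariant derivative of the torsion of the Gauduchon connection, in terms of the
derivative `ν` of the Chern torsion. -/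
def gTorsionDeriv (a : ℂ) (ν : V →ₗ[ℂ] V →ₗ[ℂ] V) (x y : V) : V :=
  (1 - 2 * a) • ν x y + a • (ad ν x y - ad ν y x)

theorem ad_add (μ ν : V →ₗ[ℂ] V →ₗ[ℂ] V) (x y : V) : ad (μ + ν) x y = ad μ x y + ad ν x y := by
  simp [ad]

theorem ad_smul (c : ℂ) (μ : V →ₗ[ℂ] V →ₗ[ℂ] V) (x y : V) :
    ad (c • μ) x y = conj c • ad μ x y := by
  simp [ad, map_smulₛₗ]

/-- The first Bianchi identity of a Kähler-like connection, for the torsion. -/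
def TorsionBianchi (a : ℝ) (μ : V →ₗ[ℂ] V →ₗ[ℂ] V) (N : V → V →ₗ[ℂ] V →ₗ[ℂ] V) : Prop :=
  ∀ x y z : V,
    (gTorsionDeriv a (N x) y z + gTorsion a μ (gTorsion a μ x y) z)
    + (gTorsionDeriv a (N y) z x + gTorsion a μ (gTorsion a μ y z) x)
    + (gTorsionDeriv a (N z) x y + gTorsion a μ (gTorsion a μ z x) y) = 0

/-- The complex linear part of a real linear map. -/
def linPart (N : V → V →ₗ[ℂ] V →ₗ[ℂ] V) (z : V) : V →ₗ[ℂ] V →ₗ[ℂ] V :=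
  (1 / 2 : ℂ) • (N z - Complex.I • N (Complex.I • z))

/-- The complex antilinear part of a real linear map. -/
def antiPart (N : V → V →ₗ[ℂ] V →ₗ[ℂ] V) (z : V) : V →ₗ[ℂ] V →ₗ[ℂ] V :=
  (1 / 2 : ℂ) • (N z + Complex.I • N (Complex.I • z))

theorem linPart_add_antiPart (N : V → V →ₗ[ℂ] V →ₗ[ℂ] V) (z : V) :
    N z = linPart N z + antiPart N z := by
  unfold linPart antiPart; module

theorem linPart_I (N : V → V →ₗ[ℂ] V →ₗ[ℂ] V) (hN : ∀ z, N (-z) = -N z) (z : V) :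
    linPart N (Complex.I • z) = Complex.I • linPart N z := by
  have h : Complex.I • Complex.I • z = -z := by rw [smul_smul, Complex.I_mul_I, neg_one_smul]
  unfold linPart
  rw [h, hN, smul_neg, sub_neg_eq_add]
  have h2 : ∀ w : V →ₗ[ℂ] V →ₗ[ℂ] V, w = -(Complex.I • Complex.I • w) := by
    intro w; rw [smul_smul, Complex.I_mul_I, neg_one_smul, neg_neg]
  rw [h2 (N (Complex.I • z))]
  rw [← h2]
  have h3 := h2 (N (Complex.I • z))
  linear_combination (norm := module) (1 / 2 : ℂ) • h3

theorem antiPart_I (N : V → V →ₗ[ℂ] V →ₗ[ℂ] V) (hN : ∀ z, N (-z) = -N z) (z : V) :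
    antiPart N (Complex.I • z) = -Complex.I • antiPart N z := by
  have h : Complex.I • Complex.I • z = -z := by rw [smul_smul, Complex.I_mul_I, neg_one_smul]
  unfold antiPart
  rw [h, hN, smul_neg]
  have h2 : ∀ w : V →ₗ[ℂ] V →ₗ[ℂ] V, w = -(Complex.I • Complex.I • w) := by
    intro w; rw [smul_smul, Complex.I_mul_I, neg_one_smul, neg_neg]
  have h3 := h2 (N (Complex.I • z))
  linear_combination (norm := module) (1 / 2 : ℂ) • h3

variable {a : ℝ} {μ : V →ₗ[ℂ] V →ₗ[ℂ] V} {N : V → V →ₗ[ℂ] V →ₗ[ℂ] V}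

/-- The device for separating types: multiplying an argument by i multiplies a linear term by i and
an antilinear term by -i, so a vanishing sum of the two that persists under this substitution
vanishes term by term. -/
theorem eq_zero_of_add_of_I_smul {p q : V} (h : p + q = 0)
    (hI : Complex.I • p + -Complex.I • q = 0) : p = 0 ∧ q = 0 := by
  have hq : q = -p := by rw [← sub_eq_zero, sub_neg_eq_add, add_comm]; exact h
  rw [hq, neg_smul, smul_neg, neg_neg, ← two_smul ℂ, smul_smul] at hI
  have hp : p = 0 := (smul_eq_zero.mp hI).resolve_left (by simp)
  exact ⟨hp, by rw [hq, hp, neg_zero]⟩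

/-- Separation of a vanishing sum of maps of three arguments according to their types, where at
most two arguments are of antilinear type. -/
theorem separate_types {f₀ f₁ f₂ f₃ g₁ g₂ g₃ : V → V → V → V}
    (h : ∀ x y z, f₀ x y z + f₁ x y z + f₂ x y z + f₃ x y z + g₁ x y z + g₂ x y z + g₃ x y z = 0)
    (h₀x : ∀ x y z, f₀ (Complex.I • x) y z = Complex.I • f₀ x y z)
    (h₀y : ∀ x y z, f₀ x (Complex.I • y) z = Complex.I • f₀ x y z)
    (h₀z : ∀ x y z, f₀ x y (Complex.I • z) = Complex.I • f₀ x y z)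
    (h₁x : ∀ x y z, f₁ (Complex.I • x) y z = -Complex.I • f₁ x y z)
    (h₁y : ∀ x y z, f₁ x (Complex.I • y) z = Complex.I • f₁ x y z)
    (h₂x : ∀ x y z, f₂ (Complex.I • x) y z = Complex.I • f₂ x y z)
    (h₂y : ∀ x y z, f₂ x (Complex.I • y) z = -Complex.I • f₂ x y z)
    (h₃x : ∀ x y z, f₃ (Complex.I • x) y z = Complex.I • f₃ x y z)
    (h₃y : ∀ x y z, f₃ x (Complex.I • y) z = Complex.I • f₃ x y z)
    (h₃z : ∀ x y z, f₃ x y (Complex.I • z) = -Complex.I • f₃ x y z)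
    (k₁x : ∀ x y z, g₁ (Complex.I • x) y z = Complex.I • g₁ x y z)
    (k₁y : ∀ x y z, g₁ x (Complex.I • y) z = -Complex.I • g₁ x y z)
    (k₂x : ∀ x y z, g₂ (Complex.I • x) y z = -Complex.I • g₂ x y z)
    (k₂y : ∀ x y z, g₂ x (Complex.I • y) z = Complex.I • g₂ x y z)
    (k₃x : ∀ x y z, g₃ (Complex.I • x) y z = -Complex.I • g₃ x y z)
    (k₃y : ∀ x y z, g₃ x (Complex.I • y) z = -Complex.I • g₃ x y z) (x y z : V) :
    f₀ x y z = 0 ∧ f₃ x y z = 0 ∧ g₃ x y z = 0 := by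
  have hx : ∀ x y z, f₀ x y z + f₂ x y z + f₃ x y z + g₁ x y z = 0 ∧
      f₁ x y z + g₂ x y z + g₃ x y z = 0 := fun x y z ↦ by
    apply eq_zero_of_add_of_I_smul
    · linear_combination (norm := module) h x y z
    · have := h (Complex.I • x) y z
      rw [h₀x, h₁x, h₂x, h₃x, k₁x, k₂x, k₃x] at this
      linear_combination (norm := module) this
  have hy : ∀ x y z, f₀ x y z + f₃ x y z = 0 := fun x y z ↦ by
    refine (eq_zero_of_add_of_I_smul (q := f₂ x y z + g₁ x y z) ?_ ?_).1
    · linear_combination (norm := module) (hx x y z).1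
    · have := (hx x (Complex.I • y) z).1
      rw [h₀y, h₂y, h₃y, k₁y] at this
      linear_combination (norm := module) this
  have hz := eq_zero_of_add_of_I_smul (hy x y z) (by
    have := hy x y (Complex.I • z)
    rwa [h₀z, h₃z] at this)
  refine ⟨hz.1, hz.2, (eq_zero_of_add_of_I_smul (p := f₁ x y z + g₂ x y z) ?_ ?_).2⟩
  · exact (hx x y z).2
  · have := (hx x (Complex.I • y) z).2
    rw [h₁y, k₂y, k₃y] at this
    linear_combination (norm := module) this

/-- The three independent components of the first Bianchi identity. -/
theorem bianchi_components (hN : ∀ z, N (-z) = -N z)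
    (h : TorsionBianchi a μ N) (x y z : V) :
    (1 - 2 * a : ℂ) • (linPart N x y z + linPart N y z x + linPart N z x y
      + (1 - 2 * a : ℂ) • (μ (μ x y) z + μ (μ y z) x + μ (μ z x) y)) = 0 ∧
    (1 - 2 * a : ℂ) • antiPart N z x y
      - (a : ℂ) • (ad (antiPart N x) z y - ad (antiPart N y) z x)
      - (a * (1 - 2 * a) : ℂ) • ad μ z (μ x y)
      - (a * (1 - 2 * a) : ℂ) • (μ (ad μ z y) x - μ (ad μ z x) y)
      + (a ^ 2 : ℂ) • (ad μ (ad μ y z) x - ad μ (ad μ x z) y) = 0 ∧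
    (a : ℂ) • (ad (linPart N x) y z - ad (linPart N y) x z + (1 - 2 * a : ℂ) • ad μ (μ x y) z
      - (a : ℂ) • (ad μ x (ad μ y z) - ad μ y (ad μ x z))) = 0 := by
  let P := linPart N
  let Q := antiPart N
  have hP : ∀ z, P (Complex.I • z) = Complex.I • P z := linPart_I N hN
  have hQ : ∀ z, Q (Complex.I • z) = -Complex.I • Q z := antiPart_I N hN
  let f₀ : V → V → V → V := fun x y z ↦ (1 - 2 * a : ℂ) • (P x y z + P y z x + P z x y
      + (1 - 2 * a : ℂ) • (μ (μ x y) z + μ (μ y z) x + μ (μ z x) y))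
  let f : V → V → V → V := fun x y z ↦ (1 - 2 * a : ℂ) • Q z x y
      - (a : ℂ) • (ad (Q x) z y - ad (Q y) z x)
      - (a * (1 - 2 * a) : ℂ) • ad μ z (μ x y)
      - (a * (1 - 2 * a) : ℂ) • (μ (ad μ z y) x - μ (ad μ z x) y)
      + (a ^ 2 : ℂ) • (ad μ (ad μ y z) x - ad μ (ad μ x z) y)
  let g : V → V → V → V := fun x y z ↦
    (a : ℂ) • (ad (P x) y z - ad (P y) x z + (1 - 2 * a : ℂ) • ad μ (μ x y) z
      - (a : ℂ) • (ad μ x (ad μ y z) - ad μ y (ad μ x z)))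
  -- The Bianchi sum is cyclic, so the types with one antilinear argument are rotations of `f` and
  -- those with two are rotations of `g`. No term is antilinear in all three arguments.
  have key := separate_types (f₀ := f₀) (f₁ := fun x y z ↦ f y z x) (f₂ := fun x y z ↦ f z x y)
    (f₃ := f) (g₁ := fun x y z ↦ g y z x) (g₂ := fun x y z ↦ g z x y) (g₃ := g)
    ?_ ?_ ?_ ?_ ?_ ?_ ?_ ?_ ?_ ?_ ?_ ?_ ?_ ?_ ?_ ?_ ?_ x y z
  · exact key
  · intro x y z
    rw [← h x y z]
    simp only [linPart_add_antiPart N, gTorsion, gTorsionDeriv,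
      map_smul, map_smulₛₗ, map_add, map_sub, LinearMap.add_apply, LinearMap.smul_apply,
      LinearMap.sub_apply, ad_add, map_mul, map_one, map_ofNat,
      Complex.conj_ofReal, f₀, f, g, P, Q]
    module
  all_goals
    intro x y z
    simp only [hP, hQ, map_smul, map_smulₛₗ, map_neg, LinearMap.smul_apply,
      ad_smul, Complex.conj_I, neg_neg, f₀, f, g]
    module
end FirstOrder

/-! ### Jacobi identity, divergence identity and the formula for the derivative of the torsion. -/

section FirstOrderConsequences

open scoped ComplexConjugate InnerProductSpace

variable {V : Type*} [NormedAddCommGroup V] [InnerProductSpace ℂ V] [FiniteDimensional ℂ V]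
  {a : ℝ} {μ : V →ₗ[ℂ] V →ₗ[ℂ] V} {N : V → V →ₗ[ℂ] V →ₗ[ℂ] V}

/-- The Bianchi component with two antilinear arguments, with all adjoints moved across the inner
product. In this form it is complex linear in x, y, w and can be compared with the fully linear
component. -/
theorem linPart_sub_linPart (ha : a ≠ 0) (hN : ∀ z, N (-z) = -N z)
    (h : TorsionBianchi a μ N) (x y w : V) :
    linPart N x y w - linPart N y x w + (1 - 2 * a : ℂ) • μ (μ x y) w
      - (a : ℂ) • (μ y (μ x w) - μ x (μ y w)) = 0 := by
  apply ext_inner_left ℂ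
  intro z
  have := (bianchi_components hN h x y z).2.2
  rw [smul_eq_zero_iff_right (by exact_mod_cast ha)] at this
  have h2 := congrArg (fun t ↦ ⟪t, w⟫_ℂ) this
  simp only [inner_add_left, inner_sub_left, inner_smul_left, ad_inner_left, inner_zero_left,
    map_sub, map_one, map_mul, map_ofNat, Complex.conj_ofReal] at h2
  simp only [inner_add_right, inner_sub_right, inner_smul_right, inner_zero_right]
  linear_combination h2

/-- The cyclic sum of `linPart_sub_linPart` and twice the fully linear component contain the same
derivative terms with different multiples of the Jacobiator, so the Jacobiator vanishes. The
derivative is then recovered from its skew-symmetrizations, as a Levi-Civita connection is from its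
torsion. -/
theorem linPart_eq_and_jacobi (ha : a ≠ 0) (ha' : a ≠ 1 / 2) (hμ : ∀ x y, μ x y = -μ y x)
    (hN : ∀ z, N (-z) = -N z) (hNs : ∀ z x y, N z x y = -N z y x)
    (h : TorsionBianchi a μ N) (x y z : V) :
    linPart N z x y = (1 - a : ℂ) • μ (μ x y) z ∧
      μ (μ x y) z + μ (μ y z) x + μ (μ z x) y = 0 := by
  have ha2 : (1 - 2 * a : ℂ) ≠ 0 := by
    intro h0
    apply ha'
    have : (1 - 2 * a : ℝ) = 0 := by exact_mod_cast h0
    linarith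
  have hPs : ∀ z x y, linPart N z x y = -linPart N z y x := fun z x y ↦ by
    simp only [linPart, LinearMap.smul_apply, LinearMap.sub_apply]
    rw [hNs z x y, hNs _ x y]; module
  have h1 := linPart_sub_linPart ha hN h x y z
  have h2 := linPart_sub_linPart ha hN h y z x
  have h3 := linPart_sub_linPart ha hN h z x y
  have h4 := (bianchi_components hN h x y z).1
  rw [smul_eq_zero_iff_right ha2] at h4
  rw [hPs y x z, hμ y (μ x z), hμ x z, hμ x (μ y z), map_neg, LinearMap.neg_apply] at h1
  rw [hPs z y x, hμ z (μ y x), hμ y x, hμ y (μ z x), map_neg, LinearMap.neg_apply] at h2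
  rw [hPs x z y, hμ x (μ z y), hμ z y, hμ z (μ x y), map_neg, LinearMap.neg_apply] at h3
  have hJ : μ (μ x y) z + μ (μ y z) x + μ (μ z x) y = 0 := by
    linear_combination (norm := module) (2 : ℂ) • h4 - h1 - h2 - h3
  refine ⟨?_, hJ⟩
  linear_combination (norm := module) (1 / 2 : ℂ) • (h2 + h3 - h1) - (1 / 2 - a : ℂ) • hJ

theorem trace_eq_sum (T : V →ₗ[ℂ] V) :
    LinearMap.trace ℂ V T = ∑ i, ⟪stdOrthonormalBasis ℂ V i, T (stdOrthonormalBasis ℂ V i)⟫_ℂ :=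
  T.trace_eq_sum_inner _

theorem trace_adjoint (T : V →ₗ[ℂ] V) :
    LinearMap.trace ℂ V T.adjoint = conj (LinearMap.trace ℂ V T) := by
  rw [trace_eq_sum, trace_eq_sum, map_sum]
  refine Finset.sum_congr rfl fun i _ ↦ ?_
  rw [LinearMap.adjoint_inner_right, inner_conj_symm]

theorem trace_ad (ν : V →ₗ[ℂ] V →ₗ[ℂ] V) (x : V) :
    LinearMap.trace ℂ V (ad ν x) = conj (LinearMap.trace ℂ V (ν x)) :=
  trace_adjoint _

/-- The squared norm of the torsion. -/
def sqNorm (μ : V →ₗ[ℂ] V →ₗ[ℂ] V) : ℝ :=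
  ∑ i, ∑ j, ‖μ (stdOrthonormalBasis ℂ V i) (stdOrthonormalBasis ℂ V j)‖ ^ 2

theorem eq_zero_of_sqNorm_eq_zero (h : sqNorm μ = 0) : μ = 0 := by
  unfold sqNorm at h
  refine (stdOrthonormalBasis ℂ V).toBasis.ext fun i ↦
    (stdOrthonormalBasis ℂ V).toBasis.ext fun j ↦ ?_
  have h1 := (Finset.sum_eq_zero_iff_of_nonneg
    (fun i _ ↦ Finset.sum_nonneg fun j _ ↦ by positivity)).1 h i (Finset.mem_univ _)
  have h2 := (Finset.sum_eq_zero_iff_of_nonneg (fun j _ ↦ by positivity)).1 h1 j (Finset.mem_univ _)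
  simpa using h2

/-- The vector dual to the trace of the torsion, up to sign. -/
def leeVector (μ : V →ₗ[ℂ] V →ₗ[ℂ] V) : V :=
  ∑ i, ad μ (stdOrthonormalBasis ℂ V i) (stdOrthonormalBasis ℂ V i)

theorem inner_leeVector (hμ : ∀ x y, μ x y = -μ y x) (x : V) :
    ⟪leeVector μ, x⟫_ℂ = -LinearMap.trace ℂ V (μ x) := by
  rw [leeVector, sum_inner, trace_eq_sum, ← Finset.sum_neg_distrib]
  refine Finset.sum_congr rfl fun i _ ↦ ?_
  rw [ad_inner_left, hμ, inner_neg_right]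

/-- The Bianchi component with one antilinear argument, at (e_i, e_j, e_i), paired with e_j and
summed over an orthonormal basis. It turns the pointwise identities into positivity: every quadratic
term becomes a multiple of |μ|² or of the squared norm of `leeVector μ`. -/
theorem divergence_identity (hμ : ∀ x y, μ x y = -μ y x) (hN : ∀ z, N (-z) = -N z)
    (hNs : ∀ z x y, N z x y = -N z y x) (h : TorsionBianchi a μ N) :
    (1 - 2 * a : ℂ) * (∑ i, LinearMap.trace ℂ V
        (antiPart N (stdOrthonormalBasis ℂ V i) (stdOrthonormalBasis ℂ V i)))
      - 2 * a * conj (∑ i, LinearMap.trace ℂ V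
        (antiPart N (stdOrthonormalBasis ℂ V i) (stdOrthonormalBasis ℂ V i)))
      = a ^ 2 * (sqNorm μ : ℂ) + a * (1 - 3 * a) * (‖leeVector μ‖ ^ 2 : ℝ) := by
  set e := stdOrthonormalBasis ℂ V
  set Q := antiPart N
  have hQs : ∀ z x y, Q z x y = -Q z y x := fun z x y ↦ by
    simp only [Q, antiPart, LinearMap.smul_apply, LinearMap.add_apply]
    rw [hNs z x y, hNs _ x y]; module
  have hm : ((sqNorm μ : ℝ) : ℂ) = ∑ i, ∑ j, ⟪μ (e i) (e j), μ (e i) (e j)⟫_ℂ := by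
    simp only [sqNorm, Complex.ofReal_sum, inner_self_eq_norm_sq_to_K, e]
    norm_cast
  -- An operator and its adjoint have equal Hilbert–Schmidt norm, by the commutativity of the trace.
  have hm' : ∑ i, ∑ j, ⟪ad μ (e i) (e j), ad μ (e i) (e j)⟫_ℂ = (sqNorm μ : ℂ) := by
    rw [hm]
    refine Finset.sum_congr rfl fun i _ ↦ ?_
    have := LinearMap.trace_mul_comm ℂ (μ (e i)) (ad μ (e i))
    rw [trace_eq_sum, trace_eq_sum] at this
    simpa only [Module.End.mul_apply, ad_inner_right, ← ad_inner_left] using this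
  have hm'' : ∑ i, ∑ j, ⟪ad μ (e j) (e i), ad μ (e j) (e i)⟫_ℂ = (sqNorm μ : ℂ) := by
    rw [Finset.sum_comm, hm']
  have hκ : ∑ i, ∑ j, ⟪e j, μ (ad μ (e i) (e i)) (e j)⟫_ℂ = -((‖leeVector μ‖ ^ 2 : ℝ) : ℂ) := by
    rw [Finset.sum_comm]
    simp only [← inner_sum]
    simp only [← LinearMap.sum_apply, ← map_sum]
    change ∑ j, ⟪e j, μ (leeVector μ) (e j)⟫_ℂ = _
    rw [← trace_eq_sum, ← neg_eq_iff_eq_neg, ← inner_leeVector hμ, inner_self_eq_norm_sq_to_K]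
    norm_cast
  have hκ' : ∑ i, ∑ j, ⟪e j, ad μ (ad μ (e i) (e i)) (e j)⟫_ℂ = -((‖leeVector μ‖ ^ 2 : ℝ) : ℂ) := by
    rw [← Complex.conj_ofReal, ← map_neg, ← hκ, map_sum]
    refine Finset.sum_congr rfl fun i _ ↦ ?_
    rw [map_sum]
    refine Finset.sum_congr rfl fun j _ ↦ ?_
    rw [ad_inner_right, inner_conj_symm]
  set δ := ∑ i, LinearMap.trace ℂ V (Q (e i) (e i)) with hδ
  have hδ1 : ∑ i, ∑ j, ⟪e j, Q (e i) (e i) (e j)⟫_ℂ = δ := by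
    rw [hδ]; exact Finset.sum_congr rfl fun i _ ↦ (trace_eq_sum _).symm
  have hδ2 : ∑ i, ∑ j, ⟪e j, ad (Q (e i)) (e i) (e j)⟫_ℂ = conj δ := by
    rw [hδ, map_sum]
    exact Finset.sum_congr rfl fun i _ ↦ by rw [← trace_ad, trace_eq_sum]
  have hδ3 : ∑ i, ∑ j, ⟪e j, ad (Q (e j)) (e i) (e i)⟫_ℂ = -conj δ := by
    rw [← hδ2, Finset.sum_comm, ← Finset.sum_neg_distrib]
    refine Finset.sum_congr rfl fun i _ ↦ ?_
    rw [← Finset.sum_neg_distrib]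
    refine Finset.sum_congr rfl fun j _ ↦ ?_
    rw [ad_inner_right, ad_inner_right, hQs, inner_neg_left]
  have key : ∑ i, ∑ j, ((1 - 2 * a : ℂ) * ⟪e j, Q (e i) (e i) (e j)⟫_ℂ
      - a * (⟪e j, ad (Q (e i)) (e i) (e j)⟫_ℂ - ⟪e j, ad (Q (e j)) (e i) (e i)⟫_ℂ)
      - (a * (1 - 2 * a)) * ⟪μ (e i) (e j), μ (e i) (e j)⟫_ℂ
      - (a * (1 - 2 * a)) * (-⟪ad μ (e i) (e j), ad μ (e i) (e j)⟫_ℂ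
          - ⟪e j, μ (ad μ (e i) (e i)) (e j)⟫_ℂ)
      + a ^ 2 * (-⟪ad μ (e j) (e i), ad μ (e j) (e i)⟫_ℂ
          - ⟪e j, ad μ (ad μ (e i) (e i)) (e j)⟫_ℂ)) = 0 := by
    refine Finset.sum_eq_zero fun i _ ↦ Finset.sum_eq_zero fun j _ ↦ ?_
    have := congrArg (fun t ↦ ⟪e j, t⟫_ℂ) (bianchi_components hN h (e i) (e j) (e i)).2.1
    simp only [inner_add_right, inner_sub_right, inner_smul_right, inner_zero_right] at this
    have h1 : ⟪e j, ad μ (e i) (μ (e i) (e j))⟫_ℂ = ⟪μ (e i) (e j), μ (e i) (e j)⟫_ℂ :=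
      ad_inner_right _ _ _ _
    have h2 : ⟪e j, μ (ad μ (e i) (e j)) (e i)⟫_ℂ = -⟪ad μ (e i) (e j), ad μ (e i) (e j)⟫_ℂ := by
      rw [hμ, inner_neg_right, ← ad_inner_left]
    have h3 : ⟪e j, ad μ (ad μ (e j) (e i)) (e i)⟫_ℂ
        = -⟪ad μ (e j) (e i), ad μ (e j) (e i)⟫_ℂ := by
      rw [ad_inner_right, hμ, inner_neg_left, ← ad_inner_right]
    rw [h1, h2, h3] at this
    exact this
  simp only [Finset.sum_add_distrib, Finset.sum_sub_distrib, ← Finset.mul_sum,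
    Finset.sum_neg_distrib] at key
  rw [hδ1, hδ2, hδ3, ← hm, hm', hm'', hκ, hκ'] at key
  linear_combination key

/-- Here 1 - 2a = 2a, so the left side of `divergence_identity` is purely imaginary, while the right
side is a sum of squares because 1 - 3a > 0. -/
theorem torsion_eq_zero_of_quarter (ha : a = 1 / 4) (hμ : ∀ x y, μ x y = -μ y x)
    (hN : ∀ z, N (-z) = -N z) (hNs : ∀ z x y, N z x y = -N z y x)
    (h : TorsionBianchi a μ N) : μ = 0 := by
  have := congrArg Complex.re (divergence_identity hμ hN hNs h)
  set δ := ∑ i, LinearMap.trace ℂ V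
        (antiPart N (stdOrthonormalBasis ℂ V i) (stdOrthonormalBasis ℂ V i))
  subst ha
  have h1 : ((1 - 2 * ((1 / 4 : ℝ) : ℂ)) * δ - 2 * ((1 / 4 : ℝ) : ℂ) * conj δ).re = 0 := by
    push_cast
    simp
    ring
  have h2 : ((((1 / 4 : ℝ) : ℂ)) ^ 2 * (sqNorm μ : ℂ) + ((1 / 4 : ℝ) : ℂ)
      * (1 - 3 * ((1 / 4 : ℝ) : ℂ)) * (‖leeVector μ‖ ^ 2 : ℝ)).re
      = 1 / 16 * (sqNorm μ) + 1 / 16 * ‖leeVector μ‖ ^ 2 := by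
    rw [← Complex.ofReal_re (1 / 16 * (sqNorm μ) + 1 / 16 * ‖leeVector μ‖ ^ 2)]
    push_cast
    congr 1
    ring
  rw [h1, h2] at this
  have h3 : 0 ≤ sqNorm μ := Finset.sum_nonneg fun i _ ↦ Finset.sum_nonneg fun j _ ↦ by positivity
  exact eq_zero_of_sqNorm_eq_zero (by nlinarith [sq_nonneg ‖leeVector μ‖])

theorem torsion_eq_zero_of_trace_eq_zero (ha : a ≠ 0) (hμ : ∀ x y, μ x y = -μ y x)
    (hN : ∀ z, N (-z) = -N z) (hNs : ∀ z x y, N z x y = -N z y x)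
    (h : TorsionBianchi a μ N) (ht : ∀ x, LinearMap.trace ℂ V (μ x) = 0)
    (hNt : ∀ z x, LinearMap.trace ℂ V (N z x) = 0) : μ = 0 := by
  have key := divergence_identity hμ hN hNs h
  have hQ : ∀ z x, LinearMap.trace ℂ V (antiPart N z x) = 0 := fun z x ↦ by
    simp [antiPart, hNt]
  have hl : leeVector μ = 0 := by
    rw [← inner_self_eq_zero (𝕜 := ℂ), inner_leeVector hμ, ht, neg_zero]
  simp only [hQ, Finset.sum_const_zero, map_zero, mul_zero, sub_zero, hl, norm_zero] at key
  apply eq_zero_of_sqNorm_eq_zero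
  have : (a : ℂ) ^ 2 * (sqNorm μ : ℂ) = 0 := by rw [key]; simp
  have ha' : (a : ℂ) ^ 2 ≠ 0 := pow_ne_zero _ (by exact_mod_cast ha)
  exact_mod_cast (mul_eq_zero.1 this).resolve_left ha'

/-- The antilinear part of the first Bianchi identity, in scalar form. -/
theorem bianchi_inner (hμ : ∀ x y, μ x y = -μ y x) (hN : ∀ z, N (-z) = -N z)
    (h : TorsionBianchi a μ N) (i j k l : V) :
    (1 - 2 * a : ℂ) * ⟪k, antiPart N l i j⟫_ℂ
      - a * (conj ⟪j, antiPart N i l k⟫_ℂ - conj ⟪i, antiPart N j l k⟫_ℂ)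
      + a * (1 - 2 * a) * ⟪μ k l, μ i j⟫_ℂ
      - a * (1 - 2 * a) * (⟪ad μ j k, ad μ l i⟫_ℂ - ⟪ad μ i k, ad μ l j⟫_ℂ)
      - a ^ 2 * (⟪ad μ j l, ad μ k i⟫_ℂ - ⟪ad μ i l, ad μ k j⟫_ℂ) = 0 := by
  have := congrArg (fun t ↦ ⟪k, t⟫_ℂ) (bianchi_components hN h i j l).2.1
  simp only [inner_add_right, inner_sub_right, inner_smul_right, inner_zero_right] at this
  rw [ad_inner_right _ l j k, ad_inner_right _ l i k, ad_inner_right μ l (μ i j) k, hμ l k, inner_neg_left,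
    hμ (ad μ l j) i, hμ (ad μ l i) j, inner_neg_right, inner_neg_right, ← ad_inner_left μ i k,
    ← ad_inner_left μ j k, ad_inner_right μ (ad μ j l) i k, ad_inner_right μ (ad μ i l) j k,
    hμ (ad μ j l) k, hμ (ad μ i l) k, inner_neg_left, inner_neg_left, ← ad_inner_right μ k i,
    ← ad_inner_right μ k j] at this
  rw [inner_conj_symm, inner_conj_symm]
  linear_combination this

/-- Coefficients of the antilinear part of the covariant derivative of the Chern torsion. -/
def coeffA (a : ℝ) : ℝ := -a ^ 3 / ((1 - 2 * a) * (1 - 4 * a))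

/-- Coefficients of the antilinear part of the covariant derivative of the Chern torsion. -/
def coeffB (a : ℝ) : ℝ := a * (1 - 5 * a + 5 * a ^ 2) / ((1 - 2 * a) * (1 - 4 * a))

/-- Coefficients of the antilinear part of the covariant derivative of the Chern torsion. -/
def coeffC (a : ℝ) : ℝ := -a * (1 - 2 * a) ^ 2 / ((1 - 2 * a) * (1 - 4 * a))

/-- The antilinear part of the covariant derivative of the Chern torsion of a Kähler-like Gauduchon
connection, as a quadratic expression in the torsion. -/
def antiDeriv (a : ℝ) (μ : V →ₗ[ℂ] V →ₗ[ℂ] V) (z x y : V) : V :=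
  -(coeffA a : ℂ) • (ad μ (ad μ y z) x - ad μ (ad μ x z) y)
    + (coeffB a : ℂ) • (μ y (ad μ z x) - μ x (ad μ z y)) - (coeffC a : ℂ) • ad μ z (μ x y)

theorem inner_antiDeriv (hμ : ∀ x y, μ x y = -μ y x) (i j k l : V) :
    ⟪k, antiDeriv a μ l i j⟫_ℂ =
      coeffA a * (⟪ad μ j l, ad μ k i⟫_ℂ - ⟪ad μ i l, ad μ k j⟫_ℂ)
      + coeffB a * (⟪ad μ j k, ad μ l i⟫_ℂ - ⟪ad μ i k, ad μ l j⟫_ℂ)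
      + coeffC a * ⟪μ k l, μ i j⟫_ℂ := by
  simp only [antiDeriv, inner_add_right, inner_sub_right, inner_smul_right]
  rw [ad_inner_right μ l (μ i j) k, hμ l k, inner_neg_left, ← ad_inner_left,
    ← ad_inner_left, ad_inner_right μ (ad μ j l) i k, ad_inner_right μ (ad μ i l) j k,
    hμ (ad μ j l) k, hμ (ad μ i l) k, inner_neg_left, inner_neg_left, ← ad_inner_right μ k i,
    ← ad_inner_right μ k j]
  ring

/-- `bianchi_inner` is a linear system for ⟪k, Q_l(i, j)⟫. The part symmetric in k, l is decoupled,
with coefficient 1 - 2a. The skew part is coupled to the conjugate skew part with (i, j) and (k, l)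
exchanged; that 2 × 2 system has determinant (1 - 2a)² - (2a)² = 1 - 4a. -/
theorem antiPart_eq (ha : a ≠ 1 / 2) (ha' : a ≠ 1 / 4) (hμ : ∀ x y, μ x y = -μ y x)
    (hN : ∀ z, N (-z) = -N z) (hNs : ∀ z x y, N z x y = -N z y x)
    (h : TorsionBianchi a μ N) (l i j : V) : antiPart N l i j = antiDeriv a μ l i j := by
  have hQs : ∀ z x y, antiPart N z x y = -antiPart N z y x := fun z x y ↦ by
    simp only [antiPart, LinearMap.smul_apply, LinearMap.add_apply]
    rw [hNs z x y, hNs _ x y]; module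
  have h2 : (1 - 2 * a : ℝ) ≠ 0 := fun h0 ↦ ha (by linarith)
  have h4 : (1 - 4 * a : ℝ) ≠ 0 := fun h0 ↦ ha' (by linarith)
  have hA : ((1 - 2 * a) * (1 - 4 * a) : ℂ) * coeffA a = -a ^ 3 := by
    norm_cast
    rw [coeffA, ← mul_div_assoc, mul_div_cancel_left₀ _ (mul_ne_zero h2 h4)]
  have hB : ((1 - 2 * a) * (1 - 4 * a) : ℂ) * coeffB a = a * (1 - 5 * a + 5 * a ^ 2) := by
    norm_cast
    rw [coeffB, ← mul_div_assoc, mul_div_cancel_left₀ _ (mul_ne_zero h2 h4)]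
  have hC : ((1 - 2 * a) * (1 - 4 * a) : ℂ) * coeffC a = -a * (1 - 2 * a) ^ 2 := by
    norm_cast
    rw [coeffC, ← mul_div_assoc, mul_div_cancel_left₀ _ (mul_ne_zero h2 h4)]
  have hD : ((1 - 2 * a) * (1 - 4 * a) : ℂ) ≠ 0 := by
    norm_cast
    exact mul_ne_zero h2 h4
  apply ext_inner_left ℂ
  intro k
  rw [inner_antiDeriv hμ]
  have e1 := bianchi_inner hμ hN h i j k l
  have e2 := bianchi_inner hμ hN h i j l k
  have e3 := congrArg conj (bianchi_inner hμ hN h k l i j)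
  have e4 := congrArg conj (bianchi_inner hμ hN h k l j i)
  rw [hQs i l k, hQs j l k, inner_neg_right, inner_neg_right] at e1
  rw [hQs k j i, hQs l j i, inner_neg_right, inner_neg_right] at e3
  rw [hμ l k, inner_neg_left] at e2
  rw [hμ j i, inner_neg_left] at e4
  simp only [map_add, map_sub, map_mul, map_neg, map_pow, Complex.conj_ofReal, map_one, map_ofNat,
    inner_conj_symm, map_zero] at e1 e2 e3 e4
  apply mul_left_cancel₀ hD
  linear_combination (1 / 2 : ℂ) * ((1 - 4 * a) * (e1 + e2)
    + (1 - 2 * a) * ((1 - 2 * a) * (e1 - e2) + 2 * a * (e3 - e4)))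
    - (⟪ad μ j l, ad μ k i⟫_ℂ - ⟪ad μ i l, ad μ k j⟫_ℂ) * hA
    - (⟪ad μ j k, ad μ l i⟫_ℂ - ⟪ad μ i k, ad μ l j⟫_ℂ) * hB - ⟪μ k l, μ i j⟫_ℂ * hC
end FirstOrderConsequences

/-! ### The parameter a = 1/2, where the torsion is traceless by linear algebra. -/

section HalfParameter

open scoped ComplexConjugate InnerProductSpace

variable {V : Type*} [NormedAddCommGroup V] [InnerProductSpace ℂ V] [FiniteDimensional ℂ V]
  {a : ℝ} {μ : V →ₗ[ℂ] V →ₗ[ℂ] V} {N : V → V →ₗ[ℂ] V →ₗ[ℂ] V}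

theorem self_mul_eq_zero (hμ : ∀ x y, μ x y = -μ y x) (x : V) : μ x x = 0 := by
  have h := eq_neg_iff_add_eq_zero.1 (hμ x x)
  rw [← two_smul ℂ] at h
  exact (smul_eq_zero.1 h).resolve_left two_ne_zero

/-- Write r_j as the sum over i of w_ij / r_j. On the support of w one has r_i = -r_j, so w_ij / r_j
is skew in i, j and the double sum cancels. -/
theorem sum_eq_zero_of_weights {ι : Type*} [Fintype ι] (r : ι → ℝ) (w : ι → ι → ℝ)
    (hsym : ∀ i j, w i j = w j i) (hsupp : ∀ i j, (r i + r j) * w i j = 0)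
    (hsum : ∀ j, ∑ i, w i j = r j ^ 2) : ∑ j, r j = 0 := by
  -- For r_j = 0 this relies on the convention that division by zero gives zero.
  have h1 : ∀ j, r j = ∑ i, w i j / r j := fun j ↦ by
    rw [← Finset.sum_div, hsum]
    by_cases h : r j = 0
    · simp [h]
    · field_simp
  have h2 : ∀ i j, w i j / r j = -(w j i / r i) := fun i j ↦ by
    rw [← hsym i j]
    rcases mul_eq_zero.1 (hsupp i j) with h | h
    · rw [show r i = -r j by linarith, div_neg, neg_neg]
    · simp [h]
  have h3 : ∑ j, r j = -∑ j, r j := by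
    calc ∑ j, r j = ∑ j, ∑ i, w i j / r j := Finset.sum_congr rfl fun j _ ↦ h1 j
      _ = ∑ j, ∑ i, -(w j i / r i) := by simp only [← h2]
      _ = -∑ j, r j := by
        rw [Finset.sum_comm, ← Finset.sum_neg_distrib]
        refine Finset.sum_congr rfl fun i _ ↦ ?_
        rw [Finset.sum_neg_distrib, ← h1]
  linarith

/-- Let κ be the Lee vector; since ⟪κ, κ⟫ = -tr μ(κ, ·), it suffices that μ(κ, ·) be traceless. The
contracted identity makes it self-adjoint. In an eigenbasis b_i with eigenvalues r_i, the squared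
moduli of ⟪ad μ b_j κ, b_i⟫ are weights as in `sum_eq_zero_of_weights`, so the eigenvalues sum to
zero. -/
theorem trace_eq_zero_of_symmetric_identity (hμ : ∀ x y, μ x y = -μ y x)
    (hS : ∀ i j k l : V, ⟪ad μ j l, ad μ k i⟫_ℂ - ⟪ad μ i l, ad μ k j⟫_ℂ
      + ⟪ad μ j k, ad μ l i⟫_ℂ - ⟪ad μ i k, ad μ l j⟫_ℂ = 0) (x : V) :
    LinearMap.trace ℂ V (μ x) = 0 := by
  set κ := leeVector μ with hκ
  set e := stdOrthonormalBasis ℂ V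
  -- The identity `hS` contracted over j = l. The two remaining sums are Hermitian in i and k, so
  -- comparison with the conjugate identity isolates the skew-adjoint part of μ κ.
  have htr : ∀ i k, -⟪μ κ k, i⟫_ℂ - ∑ j, ⟪ad μ i (e j), ad μ k (e j)⟫_ℂ
      + ∑ j, ⟪ad μ (e j) k, ad μ (e j) i⟫_ℂ + ⟪k, μ κ i⟫_ℂ = 0 := fun i k ↦ by
    have h1 : -⟪μ κ k, i⟫_ℂ = ∑ j, ⟪ad μ (e j) (e j), ad μ k i⟫_ℂ := by
      rw [← sum_inner]
      change _ = ⟪κ, _⟫_ℂ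
      rw [ad_inner_right, hμ k κ, inner_neg_left]
    have h2 : ⟪k, μ κ i⟫_ℂ = -∑ j, ⟪ad μ i k, ad μ (e j) (e j)⟫_ℂ := by
      rw [← inner_sum]
      change _ = -⟪_, κ⟫_ℂ
      rw [ad_inner_left, hμ i κ, inner_neg_right, neg_neg]
    rw [h1, h2, ← sub_eq_add_neg, ← Finset.sum_sub_distrib, ← Finset.sum_add_distrib,
      ← Finset.sum_sub_distrib]
    exact Finset.sum_eq_zero fun j _ ↦ hS i (e j) k (e j)
  have hsymm : (μ κ).IsSymmetric := fun k i ↦ by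
    have h1 := htr i k
    have h2 := congrArg conj (htr k i)
    simp only [map_add, map_sub, map_neg, map_sum, inner_conj_symm, map_zero] at h2
    linear_combination (h2 - h1) / 2
  have hH : ∀ z, ad μ κ z = μ κ z := fun z ↦ by
    apply ext_inner_right ℂ
    intro w
    rw [ad_inner_left, hsymm]
  have hκκ : μ κ κ = 0 := self_mul_eq_zero hμ κ
  have hnorm : ∀ j, ⟪μ κ j, μ κ j⟫_ℂ = ⟪ad μ j κ, ad μ j κ⟫_ℂ := fun j ↦ by
    have := hS κ j κ j
    rw [hH, hH, hκκ, inner_zero_right, inner_zero_left] at this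
    linear_combination -this
  set b := hsymm.eigenvectorBasis rfl with hb
  set r := hsymm.eigenvalues rfl with hr
  have hbr : ∀ i, μ κ (b i) = (r i : ℂ) • b i := hsymm.apply_eigenvectorBasis rfl
  let s : Fin (Module.finrank ℂ V) → Fin (Module.finrank ℂ V) → ℂ := fun i j ↦ ⟪ad μ (b j) κ, b i⟫_ℂ
  have hs : ∀ i j, s i j = -s j i := fun i j ↦ by
    simp only [s]
    rw [ad_inner_left, hμ, inner_neg_right, ← ad_inner_left]
  have hsr : ∀ i j, ((r i : ℂ) + r j) * s i j = 0 := fun i j ↦ by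
    have := hS (b i) (b j) κ κ
    rw [hH, hH, hbr, hbr, inner_smul_right, inner_smul_right] at this
    change _ * s i j - _ * s j i + _ * s i j - _ * s j i = 0 at this
    rw [hs j i] at this
    linear_combination this / 2
  have hzero : ∑ j, r j = 0 := by
    refine sum_eq_zero_of_weights r (fun i j ↦ ‖s i j‖ ^ 2) (fun i j ↦ ?_) (fun i j ↦ ?_)
      fun j ↦ ?_
    · rw [hs i j, norm_neg]
    · rcases mul_eq_zero.1 (hsr i j) with h | h
      · have : r i + r j = 0 := by exact_mod_cast h
        simp [this]
      · simp [h]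
    · have h1 := b.sum_sq_norm_inner_left (ad μ (b j) κ)
      simp only [s]
      rw [h1]
      have h2 := hnorm (b j)
      rw [hbr, inner_smul_left, inner_smul_right, inner_self_eq_norm_sq_to_K,
        inner_self_eq_norm_sq_to_K, b.norm_eq_one, Complex.conj_ofReal] at h2
      have h3 : ((r j * (r j * 1 ^ 2) : ℝ) : ℂ) = ((‖ad μ (b j) κ‖ ^ 2 : ℝ) : ℂ) := by
        push_cast
        simpa using h2
      have h4 := Complex.ofReal_injective h3
      rw [← h4]; ring
  have hκ0 : κ = 0 := by
    rw [← inner_self_eq_zero (𝕜 := ℂ)]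
    nth_rewrite 1 [hκ]
    rw [inner_leeVector hμ, hsymm.trace_eq_sum_eigenvalues rfl, ← hr, hzero]
    simp
  have := inner_leeVector hμ x
  rw [← hκ, hκ0, inner_zero_left] at this
  simpa using this.symm

/-- With 1 - 2a = 0 the derivative enters `bianchi_inner` only through terms skew in k, l;
symmetrizing removes it and leaves an identity in μ alone. -/
theorem trace_eq_zero_of_half (ha : a = 1 / 2) (hμ : ∀ x y, μ x y = -μ y x)
    (hN : ∀ z, N (-z) = -N z) (hNs : ∀ z x y, N z x y = -N z y x)
    (h : TorsionBianchi a μ N) (x : V) :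
    LinearMap.trace ℂ V (μ x) = 0 := by
  refine trace_eq_zero_of_symmetric_identity hμ (fun i j k l ↦ ?_) x
  have h1 := bianchi_inner hμ hN h i j k l
  have h2 := bianchi_inner hμ hN h i j l k
  have hQs : ∀ z x y, antiPart N z x y = -antiPart N z y x := fun z x y ↦ by
    simp only [antiPart, LinearMap.smul_apply, LinearMap.add_apply]
    rw [hNs z x y, hNs _ x y]; module
  rw [hQs i k l, hQs j k l, inner_neg_right, inner_neg_right, hμ l k, inner_neg_left] at h2
  simp only [map_neg] at h2
  subst ha
  push_cast at h1 h2
  linear_combination (-4) * (h1 + h2)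

end HalfParameter

/-! ### Second-order identities: the Ricci identity and the derivative of the Jacobi identity. -/

section SecondOrder

open scoped ComplexConjugate InnerProductSpace

variable {V : Type*} [NormedAddCommGroup V] [InnerProductSpace ℂ V] [FiniteDimensional ℂ V]
  {a : ℝ} {μ : V →ₗ[ℂ] V →ₗ[ℂ] V} {N : V → V →ₗ[ℂ] V →ₗ[ℂ] V}

theorem antiDeriv_I_smul (z x y : V) :
    antiDeriv a μ (Complex.I • z) x y = -Complex.I • antiDeriv a μ z x y := by
  simp only [antiDeriv, map_smul, map_smulₛₗ, LinearMap.smul_apply, Complex.conj_I]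
  module

/-- The covariant derivative of the Chern torsion of a Kähler-like Gauduchon connection, as a
quadratic expression in the torsion. -/
def torsionDeriv (a : ℝ) (μ : V →ₗ[ℂ] V →ₗ[ℂ] V) (z x y : V) : V :=
  (1 - a : ℂ) • μ (μ x y) z + antiDeriv a μ z x y

/-- The derivative of `torsionDeriv a μ z x y` when the derivative of `μ` is `ν`. -/
def torsionDerivDeriv (a : ℝ) (μ ν : V →ₗ[ℂ] V →ₗ[ℂ] V) (z x y : V) : V :=
  (1 - a : ℂ) • (ν (μ x y) z + μ (ν x y) z)
    + (-(coeffA a : ℂ) • ((ad ν (ad μ y z) x + ad μ (ad ν y z) x)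
        - (ad ν (ad μ x z) y + ad μ (ad ν x z) y))
      + (coeffB a : ℂ) • ((ν y (ad μ z x) + μ y (ad ν z x)) - (ν x (ad μ z y) + μ x (ad ν z y)))
      - (coeffC a : ℂ) • (ad ν z (μ x y) + ad μ z (ν x y)))

/-- The mixed component of the second covariant derivative of the torsion. -/
def mixedDeriv (a : ℝ) (μ p q : V →ₗ[ℂ] V →ₗ[ℂ] V) (z x y : V) : V :=
  -(coeffA a : ℂ) • ((ad q (ad μ y z) x + ad μ (ad p y z) x)
      - (ad q (ad μ x z) y + ad μ (ad p x z) y))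
    + (coeffB a : ℂ) • ((p y (ad μ z x) + μ y (ad q z x)) - (p x (ad μ z y) + μ x (ad q z y)))
    - (coeffC a : ℂ) • (ad q z (μ x y) + ad μ z (p x y))

/-- Invariance under simultaneous multiplication by i says that F is of type (1,1), so the (2,0) and
(0,2) terms vanish and each mixed term is a projection of F. It is applied with F the action of the
curvature on the torsion. -/
theorem separate_types₂ {f₀ f₁ f₂ f₃ F : V → V → V}
    (h : ∀ x y, f₀ x y + f₁ x y + f₂ x y + f₃ x y = F x y)
    (h₀x : ∀ x y, f₀ (Complex.I • x) y = Complex.I • f₀ x y)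
    (h₀y : ∀ x y, f₀ x (Complex.I • y) = Complex.I • f₀ x y)
    (h₁x : ∀ x y, f₁ (Complex.I • x) y = Complex.I • f₁ x y)
    (h₁y : ∀ x y, f₁ x (Complex.I • y) = -Complex.I • f₁ x y)
    (h₂x : ∀ x y, f₂ (Complex.I • x) y = -Complex.I • f₂ x y)
    (h₂y : ∀ x y, f₂ x (Complex.I • y) = Complex.I • f₂ x y)
    (h₃x : ∀ x y, f₃ (Complex.I • x) y = -Complex.I • f₃ x y)
    (h₃y : ∀ x y, f₃ x (Complex.I • y) = -Complex.I • f₃ x y)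
    (hF : ∀ x y, F (Complex.I • x) (Complex.I • y) = F x y) (x y : V) :
    f₀ x y = 0 ∧ f₁ x y = (1 / 2 : ℂ) • (F x y - Complex.I • F (Complex.I • x) y) := by
  have hI : ∀ v : V, Complex.I • Complex.I • v = -v := fun v ↦ by
    rw [smul_smul, Complex.I_mul_I, neg_one_smul]
  have hsum : ∀ x y, f₀ x y + f₃ x y = 0 := fun x y ↦ by
    have e1 := h x y
    have e2 := h (Complex.I • x) (Complex.I • y)
    rw [h₀x, h₀y, h₁x, h₁y, h₂x, h₂y, h₃x, h₃y, hF] at e2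
    simp only [neg_smul, smul_neg, hI, neg_neg] at e2
    linear_combination (norm := module) (1 / 2 : ℂ) • e1 - (1 / 2 : ℂ) • e2
  have hz := eq_zero_of_add_of_I_smul (hsum x y) (by
    have := hsum (Complex.I • x) y
    rwa [h₀x, h₃x] at this)
  refine ⟨hz.1, ?_⟩
  have e1 := h x y
  have e2 := congrArg (fun t ↦ Complex.I • t) (h (Complex.I • x) y)
  rw [h₀x, h₁x, h₂x, h₃x, hz.1, hz.2] at e2
  rw [hz.1, hz.2] at e1
  simp only [neg_smul, smul_neg, hI, smul_add, smul_zero] at e2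
  linear_combination (norm := module) (1 / 2 : ℂ) • e1 - (1 / 2 : ℂ) • e2

/-- The components of the Ricci identity for the Chern torsion. -/
theorem ricci_components {R : V → V → V →ₗ[ℂ] V} (hN : ∀ z, N (-z) = -N z)
    (hP : ∀ z x y, linPart N z x y = (1 - a : ℂ) • μ (μ x y) z)
    (hR : ∀ x y, R (Complex.I • x) (Complex.I • y) = R x y)
    (h : ∀ w z x y, torsionDerivDeriv a μ (N w) z x y - torsionDerivDeriv a μ (N z) w x y
      + torsionDeriv a μ (gTorsion a μ w z) x y
      = R w z (μ x y) - μ (R w z x) y - μ x (R w z y)) (w z x y : V) :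
    (1 - a : ℂ) • (1 - 2 * a : ℂ) • μ (μ x y) (μ w z) = 0 ∧
    mixedDeriv a μ (linPart N w) (antiPart N w) z x y
      - (1 - a : ℂ) • (antiPart N z (μ x y) w + μ (antiPart N z x y) w)
      - (a : ℂ) • (1 - a : ℂ) • μ (μ x y) (ad μ z w) + (a : ℂ) • antiDeriv a μ (ad μ w z) x y
      = (1 / 2 : ℂ) • ((R w z (μ x y) - μ (R w z x) y - μ x (R w z y)) -
        Complex.I • (R (Complex.I • w) z (μ x y) - μ (R (Complex.I • w) z x) y
          - μ x (R (Complex.I • w) z y))) := by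
  let P := linPart N
  let Q := antiPart N
  have hPI : ∀ z, P (Complex.I • z) = Complex.I • P z := linPart_I N hN
  have hQI : ∀ z, Q (Complex.I • z) = -Complex.I • Q z := antiPart_I N hN
  let f₁ : V → V → V := fun w z ↦ mixedDeriv a μ (P w) (Q w) z x y
      - (1 - a : ℂ) • (Q z (μ x y) w + μ (Q z x y) w)
      - (a : ℂ) • (1 - a : ℂ) • μ (μ x y) (ad μ z w) + (a : ℂ) • antiDeriv a μ (ad μ w z) x y
  let f₃ : V → V → V := fun w z ↦ mixedDeriv a μ (Q w) (P w) z x y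
      - mixedDeriv a μ (Q z) (P z) w x y
      + (1 - 2 * a : ℂ) • antiDeriv a μ (μ w z) x y
  -- In the type linear in both w and z, the two terms produced by the product rule are exchanged
  -- when w and z are, hence cancel in the commutator. Only the derivative along the torsion
  -- survives, which gives `f₀`.
  have key := separate_types₂ (f₀ := fun w z ↦ (1 - a : ℂ) • (1 - 2 * a : ℂ) • μ (μ x y) (μ w z))
    (f₁ := f₁) (f₂ := fun w z ↦ -f₁ z w)
    (f₃ := f₃) (F := fun w z ↦ R w z (μ x y) - μ (R w z x) y - μ x (R w z y))
    ?_ ?_ ?_ ?_ ?_ ?_ ?_ ?_ ?_ ?_ w z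
  · exact key
  · intro w z
    rw [← h w z x y]
    have e1 := linPart_add_antiPart N w
    have e2 := linPart_add_antiPart N z
    simp only [torsionDerivDeriv, e1, e2, torsionDeriv, gTorsion, antiDeriv, mixedDeriv, ad_add,
      LinearMap.add_apply, map_add, map_sub, LinearMap.sub_apply, map_smul, map_smulₛₗ,
      LinearMap.smul_apply, Complex.conj_ofReal, map_mul, map_one, map_ofNat, hP, f₁, f₃, P, Q]
    module
  all_goals
    intros
    simp only [hPI, hQI, mixedDeriv, antiDeriv, map_smul, map_smulₛₗ, map_neg, LinearMap.smul_apply,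
      ad_smul, Complex.conj_I, neg_neg, f₁, f₃, hR]
    try module

/-- The antilinear component of the covariant derivative of the Jacobi identity. -/
theorem jacobi_deriv (ha : a ≠ 0) (ha2 : a ≠ 1 / 2) (ha4 : a ≠ 1 / 4)
    (hμ : ∀ x y, μ x y = -μ y x)
    (hJ : ∀ x y z, μ (μ x y) z + μ (μ y z) x + μ (μ z x) y = 0)
    (h : ∀ z x y t, (torsionDeriv a μ z (μ x y) t + μ (torsionDeriv a μ z x y) t)
      + (torsionDeriv a μ z (μ y t) x + μ (torsionDeriv a μ z y t) x)
      + (torsionDeriv a μ z (μ t x) y + μ (torsionDeriv a μ z t x) y) = 0) (z x y t : V) :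
    (a : ℂ) • ((ad μ (ad μ (μ x y) z) t - ad μ (ad μ t z) (μ x y)
          + μ t (ad μ (ad μ y z) x - ad μ (ad μ x z) y))
        + (ad μ (ad μ (μ y t) z) x - ad μ (ad μ x z) (μ y t)
          + μ x (ad μ (ad μ t z) y - ad μ (ad μ y z) t))
        + (ad μ (ad μ (μ t x) z) y - ad μ (ad μ y z) (μ t x)
          + μ y (ad μ (ad μ x z) t - ad μ (ad μ t z) x)))
      + (1 - a : ℂ) • (μ t (ad μ z (μ x y)) + μ x (ad μ z (μ y t)) + μ y (ad μ z (μ t x))) = 0 := by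
  have hD := (mul_ne_zero (sub_ne_zero.2 (fun e : (1 : ℝ) = 2 * a ↦ ha2 (by linarith)))
    (sub_ne_zero.2 (fun e : (1 : ℝ) = 4 * a ↦ ha4 (by linarith))))
  -- Only `coeffA` and `coeffB + coeffC` matter below. Over the common denominator they share the
  -- factor -a², and removing it leaves the weights a and 1 - a of the conclusion.
  have hA : (coeffA a : ℂ) * ((1 - 2 * a) * (1 - 4 * a)) = -a ^ 3 := by
    have : coeffA a * ((1 - 2 * a) * (1 - 4 * a)) = -a ^ 3 := by
      rw [coeffA, div_mul_cancel₀ _ hD]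
    exact_mod_cast this
  have hBC : ((coeffB a : ℂ) + coeffC a) * ((1 - 2 * a) * (1 - 4 * a)) = -a ^ 2 * (1 - a) := by
    have : (coeffB a + coeffC a) * ((1 - 2 * a) * (1 - 4 * a)) = -a ^ 2 * (1 - a) := by
      rw [coeffB, coeffC, ← add_div, div_mul_cancel₀ _ hD]
      ring
    exact_mod_cast this
  let L : V → V := fun z ↦ (1 - a : ℂ) • ((μ (μ (μ x y) t) z + μ (μ (μ x y) z) t)
    + (μ (μ (μ y t) x) z + μ (μ (μ y t) z) x) + (μ (μ (μ t x) y) z + μ (μ (μ t x) z) y))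
  let Q : V → V := fun z ↦ (antiDeriv a μ z (μ x y) t + μ (antiDeriv a μ z x y) t)
      + (antiDeriv a μ z (μ y t) x + μ (antiDeriv a μ z y t) x)
      + (antiDeriv a μ z (μ t x) y + μ (antiDeriv a μ z t x) y)
  have hLQ : ∀ z, L z + Q z = 0 := fun z ↦ by
    rw [← h z x y t]
    simp only [L, Q, torsionDeriv, map_add, LinearMap.add_apply, map_smul, LinearMap.smul_apply]
    module
  have hQ : Q z = 0 := (eq_zero_of_add_of_I_smul (hLQ z) (by
    have e := hLQ (Complex.I • z)
    have e1 : L (Complex.I • z) = Complex.I • L z := by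
      simp only [L, map_smul, LinearMap.smul_apply]
      module
    have e2 : Q (Complex.I • z) = -Complex.I • Q z := by
      simp only [Q, antiDeriv_I_smul, map_smul, LinearMap.smul_apply]
      module
    rwa [e1, e2] at e)).2
  have hc : ∀ x y w, μ (μ x y) w = μ x (μ y w) - μ y (μ x w) := fun x y w ↦ by
    have e := hJ x y w
    rw [hμ (μ y w) x, hμ (μ w x) y, hμ w x, map_neg] at e
    linear_combination (norm := module) (1 : ℂ) • e
  have hs : ad μ z (μ (μ x y) t) + ad μ z (μ (μ y t) x) + ad μ z (μ (μ t x) y) = 0 := by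
    rw [← map_add, ← map_add, hJ, map_zero]
  have hQ' : -(coeffA a : ℂ) • ((ad μ (ad μ t z) (μ x y) - ad μ (ad μ (μ x y) z) t
          - μ t (ad μ (ad μ y z) x - ad μ (ad μ x z) y))
        + (ad μ (ad μ x z) (μ y t) - ad μ (ad μ (μ y t) z) x
          - μ x (ad μ (ad μ t z) y - ad μ (ad μ y z) t))
        + (ad μ (ad μ y z) (μ t x) - ad μ (ad μ (μ t x) z) y
          - μ y (ad μ (ad μ x z) t - ad μ (ad μ t z) x)))
      + ((coeffB a : ℂ) + coeffC a) •
        (μ t (ad μ z (μ x y)) + μ x (ad μ z (μ y t)) + μ y (ad μ z (μ t x))) = 0 := by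
    dsimp only [Q] at hQ
    rw [hμ (antiDeriv a μ z x y) t, hμ (antiDeriv a μ z y t) x, hμ (antiDeriv a μ z t x) y] at hQ
    simp only [antiDeriv, map_add, map_sub, map_smul] at hQ ⊢
    linear_combination (norm := module) (1 : ℂ) • hQ + (coeffB a : ℂ) • (hc x y (ad μ z t)
      + hc y t (ad μ z x) + hc t x (ad μ z y)) + (coeffC a : ℂ) • hs
  have e := congrArg (fun v ↦ ((1 - 2 * a) * (1 - 4 * a) : ℂ) • v) hQ'
  simp only [smul_add, smul_smul, smul_zero, mul_comm ((1 - 2 * a) * (1 - 4 * a) : ℂ),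
    neg_mul, hA, hBC] at e
  have ha' : (-a ^ 2 : ℂ) ≠ 0 := by exact_mod_cast neg_ne_zero.2 (pow_ne_zero 2 ha)
  refine (smul_eq_zero.1 ?_).resolve_left ha'
  linear_combination (norm := module) (1 : ℂ) • e
end SecondOrder

/-! ### Weight vectors of the metabelian Lie algebra defined by the torsion. -/

section Weights

open scoped ComplexConjugate InnerProductSpace

variable {V : Type*} [NormedAddCommGroup V] [InnerProductSpace ℂ V] [FiniteDimensional ℂ V]
  {a : ℝ} {μ : V →ₗ[ℂ] V →ₗ[ℂ] V}

/-- The quadratic and cubic identities satisfied by the Chern torsion `μ` at a point when the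
Gauduchon connection of parameter `2 * a` is Kähler-like and `a` is generic. -/
structure IsReduced (a : ℝ) (μ : V →ₗ[ℂ] V →ₗ[ℂ] V) : Prop where
  skew : ∀ x y, μ x y = -μ y x
  jacobi : ∀ x y z, μ (μ x y) z + μ (μ y z) x + μ (μ z x) y = 0
  metabelian : ∀ x y z w, μ (μ x y) (μ z w) = 0
  deriv : ∀ z x y t, (a : ℂ) • ((ad μ (ad μ (μ x y) z) t - ad μ (ad μ t z) (μ x y)
          + μ t (ad μ (ad μ y z) x - ad μ (ad μ x z) y))
        + (ad μ (ad μ (μ y t) z) x - ad μ (ad μ x z) (μ y t)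
          + μ x (ad μ (ad μ t z) y - ad μ (ad μ y z) t))
        + (ad μ (ad μ (μ t x) z) y - ad μ (ad μ y z) (μ t x)
          + μ y (ad μ (ad μ x z) t - ad μ (ad μ t z) x)))
      + (1 - a : ℂ) • (μ t (ad μ z (μ x y)) + μ x (ad μ z (μ y t)) + μ y (ad μ z (μ t x))) = 0

/-- The functional `⟪v, ·⟫` is a weight vector, of weight `c` times `⟪ℓ, ·⟫`, for the coadjoint
action of the Lie algebra `(V, μ)`. -/
structure IsWeight (μ : V →ₗ[ℂ] V →ₗ[ℂ] V) (ℓ : V) (c : ℝ) (v : V) : Prop where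
  perp : ∀ x y, ⟪ℓ, μ x y⟫_ℂ = 0
  eigen : ∀ x y, ⟪v, μ x y⟫_ℂ = c * (⟪ℓ, x⟫_ℂ * ⟪v, y⟫_ℂ - ⟪ℓ, y⟫_ℂ * ⟪v, x⟫_ℂ)
  orth : ⟪ℓ, v⟫_ℂ = 0

namespace IsWeight

variable {ℓ v v₁ v₂ : V} {c c₁ c₂ : ℝ}

theorem ad_base (h : IsWeight μ ℓ c v) (x : V) : ad μ x ℓ = 0 :=
  ext_inner_left ℂ fun w ↦ by
    rw [ad_inner_right, ← inner_conj_symm, h.perp, map_zero, inner_zero_right]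

theorem ad_vector (h : IsWeight μ ℓ c v) (x : V) :
    ad μ x v = (c * ⟪x, ℓ⟫_ℂ) • v - (c * ⟪x, v⟫_ℂ) • ℓ :=
  ext_inner_left ℂ fun w ↦ by
    rw [ad_inner_right, ← inner_conj_symm, h.eigen, inner_sub_right, inner_smul_right,
      inner_smul_right]
    simp only [map_mul, map_sub, inner_conj_symm, Complex.conj_ofReal]
    ring

theorem orth' (h : IsWeight μ ℓ c v) : ⟪v, ℓ⟫_ℂ = 0 := by
  rw [← inner_conj_symm, h.orth, map_zero]

/-- One cyclic summand of `deriv`, paired with a weight vector. -/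
def summand (a : ℝ) (μ : V →ₗ[ℂ] V →ₗ[ℂ] V) (ℓ : V) (c₁ c₂ : ℝ) (v₁ v₂ x y t : V) : ℂ :=
  a * (c₂ * ⟪ℓ, t⟫_ℂ * ⟪μ v₁ v₂, μ x y⟫_ℂ + c₂ * ⟪v₂, t⟫_ℂ * ⟪μ ℓ v₁, μ x y⟫_ℂ
      - c₂ * ⟪v₂, μ x y⟫_ℂ * ⟪μ ℓ v₁, t⟫_ℂ
      + c₁ * c₂ * (⟪ℓ, y⟫_ℂ * ⟪v₁, t⟫_ℂ * ⟪μ ℓ v₂, x⟫_ℂ - ⟪ℓ, y⟫_ℂ * ⟪ℓ, t⟫_ℂ * ⟪μ v₁ v₂, x⟫_ℂ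
        - ⟪v₂, y⟫_ℂ * ⟪ℓ, t⟫_ℂ * ⟪μ ℓ v₁, x⟫_ℂ)
      - c₁ * c₂ * (⟪ℓ, x⟫_ℂ * ⟪v₁, t⟫_ℂ * ⟪μ ℓ v₂, y⟫_ℂ - ⟪ℓ, x⟫_ℂ * ⟪ℓ, t⟫_ℂ * ⟪μ v₁ v₂, y⟫_ℂ
        - ⟪v₂, x⟫_ℂ * ⟪ℓ, t⟫_ℂ * ⟪μ ℓ v₁, y⟫_ℂ))
    + (1 - a) * c₁ * (⟪v₁, t⟫_ℂ * ⟪μ ℓ v₂, μ x y⟫_ℂ - ⟪ℓ, t⟫_ℂ * ⟪μ v₁ v₂, μ x y⟫_ℂ)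

/-- This is `deriv` with z = v₂, paired with v₁. By `ad_vector` each adjoint applied to v₂ lies in
the span of v₂ and ℓ, so the only unknowns left are the functionals ⟪μ ℓ v_i, ·⟫ and ⟪μ v₁ v₂, ·⟫.
-/
theorem pair_identity (H : IsReduced a μ) (h₁ : IsWeight μ ℓ c₁ v₁) (h₂ : IsWeight μ ℓ c₂ v₂)
    (x y t : V) : summand a μ ℓ c₁ c₂ v₁ v₂ x y t + summand a μ ℓ c₁ c₂ v₁ v₂ y t x
      + summand a μ ℓ c₁ c₂ v₁ v₂ t x y = 0 := by
  have e := congrArg (fun w ↦ ⟪v₁, w⟫_ℂ) (H.deriv v₂ x y t)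
  have hω : μ v₂ v₁ = -μ v₁ v₂ := H.skew _ _
  have hℓ : μ v₂ ℓ = -μ ℓ v₂ := H.skew _ _
  have hll : μ ℓ ℓ = 0 := self_mul_eq_zero H.skew ℓ
  simp only [inner_add_right, inner_sub_right, inner_smul_right, inner_zero_right, map_sub,
    map_smulₛₗ, h₂.ad_vector, LinearMap.sub_apply, LinearMap.smul_apply, h₁.eigen, ad_inner_right,
    h₁.perp, map_mul, inner_conj_symm, Complex.conj_ofReal, hω, hℓ, hll, inner_neg_left,
    RingHom.id_apply, inner_zero_left] at e
  simp only [summand]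
  linear_combination e

theorem square_identity (H : IsReduced a μ) (h : IsWeight μ ℓ 1 v) (x y t : V) :
    (⟪v, t⟫_ℂ * ⟪μ ℓ v, μ x y⟫_ℂ + ⟪v, x⟫_ℂ * ⟪μ ℓ v, μ y t⟫_ℂ + ⟪v, y⟫_ℂ * ⟪μ ℓ v, μ t x⟫_ℂ)
      + a * (⟪v, μ x y⟫_ℂ * ⟪μ ℓ v, t⟫_ℂ + ⟪v, μ y t⟫_ℂ * ⟪μ ℓ v, x⟫_ℂ
        + ⟪v, μ t x⟫_ℂ * ⟪μ ℓ v, y⟫_ℂ) = 0 := by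
  have e := pair_identity H h h x y t
  simp only [summand, self_mul_eq_zero H.skew v, inner_zero_left, Complex.ofReal_one, h.eigen] at e ⊢
  linear_combination e

theorem inner_mul_base (h : IsWeight μ ℓ c v) (y : V) :
    ⟪v, μ ℓ y⟫_ℂ = c * ⟪ℓ, ℓ⟫_ℂ * ⟪v, y⟫_ℂ := by
  rw [h.eigen, h.orth']
  ring

theorem inner_mul_of_perp (h : IsWeight μ ℓ c v) (x : V) {y : V} (hy : ⟪ℓ, y⟫_ℂ = 0) :
    ⟪v, μ x y⟫_ℂ = c * (⟪ℓ, x⟫_ℂ * ⟪v, y⟫_ℂ) := by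
  rw [h.eigen, hy]
  ring

/-- The commutator of two inner derivations is the inner derivation by a bracket, which kills the
derived algebra by metabelianity. -/
theorem _root_.HermitianTorsion.IsReduced.mul_comm_pure (H : IsReduced a μ) (x y p q : V) :
    μ x (μ y (μ p q)) = μ y (μ x (μ p q)) := by
  have e := H.jacobi x y (μ p q)
  rw [H.metabelian, zero_add, H.skew (μ y _) x, H.skew (μ (μ p q) x) y, H.skew (μ p q) x, map_neg,
    neg_neg] at e
  linear_combination (norm := module) (-1 : ℂ) • e

/-- On the derived algebra the functionals ⟪v, ·⟫ and ⟪μ ℓ v, ·⟫ are acted on triangularly, with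
diagonal weights ⟪ℓ, ·⟫ and a⟪ℓ, ·⟫. Because the inner derivations commute there and a ≠ 1, the
off-diagonal entry `τ` must also be a multiple of ⟪ℓ, ·⟫. -/
theorem exists_action (H : IsReduced a μ) (h : IsWeight μ ℓ 1 v) (hℓ : ℓ ≠ 0) (hv : v ≠ 0)
    (ha1 : a ≠ 1) : ∃ t₀ : ℂ, ∀ x p q, ⟪μ ℓ v, μ x (μ p q)⟫_ℂ
      = ⟪ℓ, x⟫_ℂ * (a * ⟪μ ℓ v, μ p q⟫_ℂ + t₀ * ⟪v, μ p q⟫_ℂ) := by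
  have hr : ⟪ℓ, ℓ⟫_ℂ ≠ 0 := inner_self_ne_zero.2 hℓ
  have hξ : ⟪v, μ ℓ v⟫_ℂ ≠ 0 := by
    rw [h.inner_mul_base, Complex.ofReal_one, one_mul]
    exact mul_ne_zero hr (inner_self_ne_zero.2 hv)
  have hξm : ∀ x p q, ⟪v, μ x (μ p q)⟫_ℂ = ⟪ℓ, x⟫_ℂ * ⟪v, μ p q⟫_ℂ := fun x p q ↦ by
    rw [h.inner_mul_of_perp x (h.perp p q), Complex.ofReal_one, one_mul]
  let τ : V → ℂ := fun x ↦
    (⟪μ ℓ v, μ x (μ ℓ v)⟫_ℂ - a * ⟪ℓ, x⟫_ℂ * ⟪μ ℓ v, μ ℓ v⟫_ℂ) / ⟪v, μ ℓ v⟫_ℂ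
  have hτ : ∀ x p q, ⟪μ ℓ v, μ x (μ p q)⟫_ℂ
      = a * ⟪ℓ, x⟫_ℂ * ⟪μ ℓ v, μ p q⟫_ℂ + τ x * ⟪v, μ p q⟫_ℂ := fun x p q ↦ by
    -- The third argument is a bracket on which ⟪v, ·⟫ does not vanish, so the identity can be
    -- solved for ⟪μ ℓ v, μ x (μ p q)⟫; the bracket of the last two arguments vanishes.
    have e := h.square_identity H x (μ p q) (μ ℓ v)
    rw [H.metabelian, H.skew (μ ℓ v) x, inner_zero_right, inner_zero_right, inner_neg_right,
      inner_neg_right, hξm, hξm] at e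
    simp only [τ]
    field_simp
    linear_combination e
  have hsym : ∀ x u, τ x * ⟪ℓ, u⟫_ℂ = τ u * ⟪ℓ, x⟫_ℂ := fun x u ↦ by
    have e : ⟪μ ℓ v, μ x (μ u (μ ℓ v))⟫_ℂ = ⟪μ ℓ v, μ u (μ x (μ ℓ v))⟫_ℂ := by
      rw [H.mul_comm_pure]
    rw [hτ, hτ, hτ, hτ, hξm, hξm] at e
    have h1 : (1 - a : ℂ) * ⟪v, μ ℓ v⟫_ℂ ≠ 0 :=
      mul_ne_zero (sub_ne_zero.2 (by exact_mod_cast ha1.symm)) hξ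
    apply mul_left_cancel₀ h1
    linear_combination e
  refine ⟨τ ℓ / ⟪ℓ, ℓ⟫_ℂ, fun x p q ↦ ?_⟩
  have e : τ x = ⟪ℓ, x⟫_ℂ * (τ ℓ / ⟪ℓ, ℓ⟫_ℂ) := by
    field_simp
    rw [hsym]
    ring
  rw [hτ, e]
  ring

/-- A weight vector of weight `a ⟪ℓ, ·⟫` derived from one of weight `⟪ℓ, ·⟫`. -/
theorem exists_second (H : IsReduced a μ) (h : IsWeight μ ℓ 1 v) (hℓ : ℓ ≠ 0) (hv : v ≠ 0)
    (ha0 : a ≠ 0) (ha1 : a ≠ 1) : ∃ (p : ℂ) (v₂ : V), IsWeight μ ℓ a v₂ ∧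
      (∀ x y, ⟪v₂, μ x y⟫_ℂ = ⟪μ ℓ v, μ x y⟫_ℂ - p * ⟪v, μ x y⟫_ℂ) ∧
      ∀ x y, ⟪μ ℓ v, μ ℓ (μ x y)⟫_ℂ
        = ⟪ℓ, ℓ⟫_ℂ * (a * ⟪μ ℓ v, μ x y⟫_ℂ + (1 - a) * p * ⟪v, μ x y⟫_ℂ) := by
  obtain ⟨t₀, ht₀⟩ := exists_action H h hℓ hv ha1
  have hr : ⟪ℓ, ℓ⟫_ℂ ≠ 0 := inner_self_ne_zero.2 hℓ
  have ha0' : (a : ℂ) ≠ 0 := by exact_mod_cast ha0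
  have ha1' : (1 - a : ℂ) ≠ 0 := sub_ne_zero.2 (by exact_mod_cast ha1.symm)
  have hξm : ∀ x p q, ⟪v, μ x (μ p q)⟫_ℂ = ⟪ℓ, x⟫_ℂ * ⟪v, μ p q⟫_ℂ := fun x p q ↦ by
    rw [h.inner_mul_of_perp x (h.perp p q), Complex.ofReal_one, one_mul]
  -- The eigenvalues 1 and a of the triangular action are distinct; subtracting p⟪v, ·⟫ diagonalizes
  -- it.
  obtain ⟨p, hp⟩ : ∃ p, p = t₀ / (1 - a : ℂ) := ⟨_, rfl⟩
  have hpt : t₀ = (1 - a) * p := by rw [hp]; field_simp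
  let e₀ : V := μ ℓ v - conj p • v
  have he₀ : ∀ y, ⟪e₀, y⟫_ℂ = ⟪μ ℓ v, y⟫_ℂ - p * ⟪v, y⟫_ℂ := fun y ↦ by
    simp only [e₀, inner_sub_left, inner_smul_left, Complex.conj_conj]
  have hκ : ∀ x y z, ⟪e₀, μ x (μ y z)⟫_ℂ = a * ⟪ℓ, x⟫_ℂ * ⟪e₀, μ y z⟫_ℂ := fun x y z ↦ by
    rw [he₀, he₀, ht₀, hξm, hpt]
    ring
  -- The functional of `e₀` is a weight vector only on the derived algebra. Precomposing with μ ℓ,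
  -- which acts there by a⟪ℓ, ℓ⟫, and rescaling gives a functional with the same values on brackets
  -- and the weight equation on the whole space.
  obtain ⟨c, hc⟩ : ∃ c, c = (a * ⟪ℓ, ℓ⟫_ℂ)⁻¹ := ⟨_, rfl⟩
  have hv₂ : ∀ y, ⟪conj c • ad μ ℓ e₀, y⟫_ℂ = c * ⟪e₀, μ ℓ y⟫_ℂ := fun y ↦ by
    rw [inner_smul_left, Complex.conj_conj, ad_inner_left]
  have hv₂' : ∀ x y, ⟪conj c • ad μ ℓ e₀, μ x y⟫_ℂ = ⟪e₀, μ x y⟫_ℂ := fun x y ↦ by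
    rw [hv₂, hκ, hc]
    field_simp
  refine ⟨p, conj c • ad μ ℓ e₀, ⟨h.perp, fun x y ↦ ?_, ?_⟩, fun x y ↦ by rw [hv₂', he₀],
    fun x y ↦ by rw [ht₀, hpt]⟩
  · have e : μ ℓ (μ x y) = μ x (μ ℓ y) - μ y (μ ℓ x) := by
      have e := H.jacobi ℓ x y
      rw [H.skew (μ x y) ℓ, H.skew (μ ℓ x) y, H.skew (μ y ℓ) x, H.skew y ℓ, map_neg, neg_neg] at e
      linear_combination (norm := module) (-1 : ℂ) • e
    rw [hv₂, hv₂, hv₂, e, inner_sub_right, hκ, hκ]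
    ring
  · rw [← inner_conj_symm, hv₂, self_mul_eq_zero H.skew, inner_zero_right, mul_zero, map_zero]

/-- `pair_identity` for the two orders of the weight vectors, at ℓ and two brackets; metabelianity
and `perp` remove most terms. What remains relates 2 × 2 minors of functionals on the derived
algebra: those of ⟪v, ·⟫ with ⟪μ ℓ v₂, ·⟫, and with ⟪μ ℓ v₂, μ ℓ ·⟫, to those of ⟪v, ·⟫ with ⟪v₂,
·⟫. -/
theorem pure_equations (H : IsReduced a μ) (h : IsWeight μ ℓ 1 v) (h₂ : IsWeight μ ℓ a v₂)
    (ha0 : a ≠ 0) (hℓ : ℓ ≠ 0) {p : ℂ} (hZ : ∀ x y, ⟪v₂, μ x y⟫_ℂ = ⟪μ ℓ v, μ x y⟫_ℂ - p * ⟪v, μ x y⟫_ℂ)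
    (hZm : ∀ x y, ⟪μ ℓ v, μ ℓ (μ x y)⟫_ℂ
        = ⟪ℓ, ℓ⟫_ℂ * (a * ⟪μ ℓ v, μ x y⟫_ℂ + (1 - a) * p * ⟪v, μ x y⟫_ℂ)) (x₁ z₁ x₂ z₂ : V) :
    (a ^ 2 + (1 - a) ^ 2) * (⟪v, μ x₁ z₁⟫_ℂ * ⟪μ ℓ v₂, μ x₂ z₂⟫_ℂ
        - ⟪v, μ x₂ z₂⟫_ℂ * ⟪μ ℓ v₂, μ x₁ z₁⟫_ℂ)
      = ((1 - a) * (1 - 2 * a) - a ^ 3) * p * (⟪v, μ x₁ z₁⟫_ℂ * ⟪v₂, μ x₂ z₂⟫_ℂ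
        - ⟪v, μ x₂ z₂⟫_ℂ * ⟪v₂, μ x₁ z₁⟫_ℂ) ∧
    -(⟪v, μ x₁ z₁⟫_ℂ * ⟪μ ℓ v₂, μ ℓ (μ x₂ z₂)⟫_ℂ - ⟪v, μ x₂ z₂⟫_ℂ * ⟪μ ℓ v₂, μ ℓ (μ x₁ z₁)⟫_ℂ)
      - (1 - a) * ⟪ℓ, ℓ⟫_ℂ * (⟪v, μ x₁ z₁⟫_ℂ * ⟪μ ℓ v₂, μ x₂ z₂⟫_ℂ
        - ⟪v, μ x₂ z₂⟫_ℂ * ⟪μ ℓ v₂, μ x₁ z₁⟫_ℂ)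
      + (1 - 2 * a) * p * ⟪ℓ, ℓ⟫_ℂ * (⟪v, μ x₁ z₁⟫_ℂ * ⟪v₂, μ x₂ z₂⟫_ℂ
        - ⟪v, μ x₂ z₂⟫_ℂ * ⟪v₂, μ x₁ z₁⟫_ℂ) = 0 := by
  have ha0' : (a : ℂ) ≠ 0 := by exact_mod_cast ha0
  have hr : ⟪ℓ, ℓ⟫_ℂ ≠ 0 := inner_self_ne_zero.2 hℓ
  have e1 := pair_identity H h h₂ ℓ (μ x₁ z₁) (μ x₂ z₂)
  have e2 := pair_identity H h₂ h ℓ (μ x₁ z₁) (μ x₂ z₂)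
  simp only [summand, H.skew (μ x₂ z₂) ℓ, H.metabelian, inner_neg_right, h.perp, h.orth', h₂.orth',
    inner_zero_right, h.inner_mul_base, h₂.inner_mul_base, Complex.ofReal_one, hZm] at e1 e2
  have f1 := hZ x₁ z₁
  have f2 := hZ x₂ z₂
  generalize ⟪ℓ, ℓ⟫_ℂ = r at *
  generalize ⟪v₂, μ x₁ z₁⟫_ℂ = t₁ at *
  generalize ⟪v₂, μ x₂ z₂⟫_ℂ = t₂ at *
  generalize ⟪μ ℓ v, μ x₁ z₁⟫_ℂ = s₁ at *
  generalize ⟪μ ℓ v, μ x₂ z₂⟫_ℂ = s₂ at *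
  obtain rfl : s₁ = t₁ + p * ⟪v, μ x₁ z₁⟫_ℂ := by rw [f1]; ring
  obtain rfl : s₂ = t₂ + p * ⟪v, μ x₂ z₂⟫_ℂ := by rw [f2]; ring
  constructor
  · apply mul_left_cancel₀ (mul_ne_zero hr ha0')
    linear_combination a * e1 - (1 - a) * e2
  · apply mul_left_cancel₀ ha0'
    linear_combination e2

/-- If ⟪v₂, ·⟫ were not proportional to ⟪v, ·⟫ on the derived algebra, the minors would force p = 0,
and then the equality case of Cauchy–Schwarz would make v₂ a multiple of v after all. Proportional
functionals of the different weights a and 1 force the factor of proportionality to vanish. -/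
theorem second_eq_zero (H : IsReduced a μ) (h : IsWeight μ ℓ 1 v) (h₂ : IsWeight μ ℓ a v₂)
    (ha0 : a ≠ 0) (ha1 : a ≠ 1) (ha3 : a ≠ 1 / 3) (hℓ : ℓ ≠ 0) (hv : v ≠ 0) {p : ℂ}
    (hZ : ∀ x y, ⟪v₂, μ x y⟫_ℂ = ⟪μ ℓ v, μ x y⟫_ℂ - p * ⟪v, μ x y⟫_ℂ)
    (hZm : ∀ x y, ⟪μ ℓ v, μ ℓ (μ x y)⟫_ℂ
        = ⟪ℓ, ℓ⟫_ℂ * (a * ⟪μ ℓ v, μ x y⟫_ℂ + (1 - a) * p * ⟪v, μ x y⟫_ℂ)) (x y : V) :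
    ⟪v₂, μ x y⟫_ℂ = 0 := by
  have hr : ⟪ℓ, ℓ⟫_ℂ ≠ 0 := inner_self_ne_zero.2 hℓ
  have hvv : ⟪v, v⟫_ℂ ≠ 0 := inner_self_ne_zero.2 hv
  have ha0' : (a : ℂ) ≠ 0 := by exact_mod_cast ha0
  have ha1' : (1 - a : ℂ) ≠ 0 := sub_ne_zero.2 (by exact_mod_cast ha1.symm)
  have ha3' : (3 * a - 1 : ℂ) ≠ 0 := by
    have : (3 * a - 1 : ℝ) ≠ 0 := fun e ↦ ha3 (by linarith)
    exact_mod_cast this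
  have hab : (a ^ 2 + (1 - a) ^ 2 : ℂ) ≠ 0 := by
    have : (a ^ 2 + (1 - a) ^ 2 : ℝ) ≠ 0 := by nlinarith [sq_nonneg (2 * a - 1)]
    exact_mod_cast this
  have hξq : ⟪v, μ ℓ v⟫_ℂ = ⟪ℓ, ℓ⟫_ℂ * ⟪v, v⟫_ℂ := by
    rw [h.inner_mul_base, Complex.ofReal_one, one_mul]
  have hq : ⟪v, μ ℓ v⟫_ℂ ≠ 0 := hξq ▸ mul_ne_zero hr hvv
  -- the two functionals are proportional on the image of the bracket
  have hX : ∀ x₁ z₁ x₂ z₂,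
      ⟪v, μ x₁ z₁⟫_ℂ * ⟪v₂, μ x₂ z₂⟫_ℂ - ⟪v, μ x₂ z₂⟫_ℂ * ⟪v₂, μ x₁ z₁⟫_ℂ = 0 := by
    intro x₁ z₁ x₂ z₂
    by_contra hX
    have hp : p = 0 := by
      obtain ⟨e1, e2⟩ := pure_equations H h h₂ ha0 hℓ hZ hZm x₁ z₁ x₂ z₂
      -- Applying μ ℓ to both brackets multiplies the minor of v and v₂ by a⟪ℓ, ℓ⟫². With this the
      -- unknown minors can be eliminated, leaving (3a - 1)(1 - a)a⟪ℓ, ℓ⟫ times p times a nonzero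
      -- minor; this is where a ≠ 1/3 enters.
      obtain ⟨e3, -⟩ := pure_equations H h h₂ ha0 hℓ hZ hZm ℓ (μ x₁ z₁) ℓ (μ x₂ z₂)
      simp only [h.inner_mul_base, h₂.inner_mul_base, Complex.ofReal_one] at e3
      have e4 : ⟪ℓ, ℓ⟫_ℂ * ((a ^ 2 + (1 - a) ^ 2) * (⟪v, μ x₁ z₁⟫_ℂ * ⟪μ ℓ v₂, μ ℓ (μ x₂ z₂)⟫_ℂ
          - ⟪v, μ x₂ z₂⟫_ℂ * ⟪μ ℓ v₂, μ ℓ (μ x₁ z₁)⟫_ℂ))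
          = ⟪ℓ, ℓ⟫_ℂ * (((1 - a) * (1 - 2 * a) - a ^ 3) * p * (a * ⟪ℓ, ℓ⟫_ℂ
            * (⟪v, μ x₁ z₁⟫_ℂ * ⟪v₂, μ x₂ z₂⟫_ℂ - ⟪v, μ x₂ z₂⟫_ℂ * ⟪v₂, μ x₁ z₁⟫_ℂ))) := by
        linear_combination e3
      have e5 := mul_left_cancel₀ hr e4
      have : ((3 * a - 1) * (1 - a) * a * ⟪ℓ, ℓ⟫_ℂ
          * (⟪v, μ x₁ z₁⟫_ℂ * ⟪v₂, μ x₂ z₂⟫_ℂ - ⟪v, μ x₂ z₂⟫_ℂ * ⟪v₂, μ x₁ z₁⟫_ℂ)) * p = 0 := by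
        linear_combination (a ^ 2 + (1 - a) ^ 2) * e2 + e5 + (1 - a) * ⟪ℓ, ℓ⟫_ℂ * e1
      exact (mul_eq_zero.1 this).resolve_left (mul_ne_zero (mul_ne_zero (mul_ne_zero
        (mul_ne_zero ha3' ha1') ha0') hr) hX)
    subst hp
    have hF : ∀ x z, ⟪v, μ ℓ v⟫_ℂ * ⟪μ ℓ v₂, μ x z⟫_ℂ = ⟪v, μ x z⟫_ℂ * ⟪μ ℓ v₂, μ ℓ v⟫_ℂ := by
      intro x z
      obtain ⟨e1, -⟩ := pure_equations H h h₂ ha0 hℓ hZ hZm ℓ v x z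
      rw [mul_zero, zero_mul, mul_eq_zero] at e1
      exact sub_eq_zero.1 (e1.resolve_left hab)
    obtain ⟨ν, hν⟩ : ∃ ν, ν = ⟪μ ℓ v₂, μ ℓ v⟫_ℂ / ⟪v, μ ℓ v⟫_ℂ := ⟨_, rfl⟩
    have hw₂ : ∀ x z, ⟪μ ℓ v₂, μ x z⟫_ℂ = ν * ⟪v, μ x z⟫_ℂ := fun x z ↦ by
      rw [hν]
      field_simp
      linear_combination hF x z
    have hw₁ : ∀ x z, ⟪μ ℓ v, μ x z⟫_ℂ = ⟪v₂, μ x z⟫_ℂ := fun x z ↦ by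
      rw [hZ]
      ring
    have h11 := hw₁ ℓ v
    have h12 := hw₁ ℓ v₂
    have h21 := hw₂ ℓ v
    have h22 := hw₂ ℓ v₂
    rw [h₂.inner_mul_base] at h11 h12
    rw [h.inner_mul_base, Complex.ofReal_one, one_mul] at h21 h22
    have hrn : ⟪ℓ, ℓ⟫_ℂ = ((‖ℓ‖ ^ 2 : ℝ) : ℂ) := by rw [inner_self_eq_norm_sq_to_K]; norm_cast
    have hvn : ⟪v, v⟫_ℂ = ((‖v‖ ^ 2 : ℝ) : ℂ) := by rw [inner_self_eq_norm_sq_to_K]; norm_cast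
    have hv₂n : ⟪v₂, v₂⟫_ℂ = ((‖v₂‖ ^ 2 : ℝ) : ℂ) := by
      rw [inner_self_eq_norm_sq_to_K]; norm_cast
    have hw₁n : ⟪μ ℓ v, μ ℓ v⟫_ℂ = ((‖μ ℓ v‖ ^ 2 : ℝ) : ℂ) := by
      rw [inner_self_eq_norm_sq_to_K]; norm_cast
    have hw₂n : ⟪μ ℓ v₂, μ ℓ v₂⟫_ℂ = ((‖μ ℓ v₂‖ ^ 2 : ℝ) : ℂ) := by
      rw [inner_self_eq_norm_sq_to_K]; norm_cast
    have hr' : 0 < ‖ℓ‖ ^ 2 := by positivity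
    have hv' : 0 < ‖v‖ ^ 2 := by positivity
    obtain ⟨S, hS⟩ : ∃ S : ℝ, ⟪v₂, v⟫_ℂ = S := by
      refine ⟨‖μ ℓ v‖ ^ 2 / (a * ‖ℓ‖ ^ 2), ?_⟩
      rw [hw₁n, hrn] at h11
      push_cast at h11 ⊢
      rw [hrn] at hr
      push_cast at hr
      rw [eq_div_iff (mul_ne_zero ha0' hr)]
      linear_combination -h11
    have hS' : ⟪v, v₂⟫_ℂ = S := by rw [← inner_conj_symm, hS, Complex.conj_ofReal]
    have hνV : ν * (‖v‖ ^ 2 : ℝ) = (a * ‖v₂‖ ^ 2 : ℝ) := by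
      rw [← inner_conj_symm, h12, hv₂n, hrn, hvn] at h21
      simp only [map_mul, Complex.conj_ofReal] at h21
      rw [hrn] at hr
      apply mul_left_cancel₀ hr
      push_cast at h21 ⊢
      linear_combination -h21
    have f1 : ‖μ ℓ v‖ ^ 2 = a * ‖ℓ‖ ^ 2 * S := by
      rw [hw₁n, hrn, hS] at h11
      exact_mod_cast h11
    have f2 : ‖μ ℓ v₂‖ ^ 2 * ‖v‖ ^ 2 = a * ‖v₂‖ ^ 2 * ‖ℓ‖ ^ 2 * S := by
      rw [hw₂n, hrn, hS'] at h22
      have : ((‖μ ℓ v₂‖ ^ 2 * ‖v‖ ^ 2 : ℝ) : ℂ) = ((a * ‖v₂‖ ^ 2 * ‖ℓ‖ ^ 2 * S : ℝ) : ℂ) := by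
        push_cast at h22 hνV ⊢
        linear_combination (‖v‖ ^ 2 : ℂ) * h22 + (‖ℓ‖ ^ 2 * S : ℂ) * hνV
      exact_mod_cast this
    -- Cauchy–Schwarz for μ ℓ v and μ ℓ v₂. Inserting `f1` and `f2` turns it into the reverse
    -- Cauchy–Schwarz inequality for v and v₂, with S their inner product.
    have f3 : (a * ‖ℓ‖ ^ 2 * ‖v₂‖ ^ 2) ^ 2 ≤ ‖μ ℓ v‖ ^ 2 * ‖μ ℓ v₂‖ ^ 2 := by
      have := norm_inner_le_norm (𝕜 := ℂ) (μ ℓ v) (μ ℓ v₂)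
      rw [h12, hrn, hv₂n, ← Complex.ofReal_mul, ← Complex.ofReal_mul, Complex.norm_real,
        Real.norm_eq_abs] at this
      rw [← mul_pow, ← sq_abs]
      exact pow_le_pow_left₀ (abs_nonneg _) this 2
    have hv₂0 : 0 < ‖v₂‖ ^ 2 := by
      rcases eq_or_ne v₂ 0 with e | e
      · exact absurd (by rw [e, inner_zero_left, inner_zero_left, mul_zero, mul_zero, sub_zero]) hX
      · positivity
    have f4 : ‖v‖ ^ 2 * ‖v₂‖ ^ 2 ≤ S ^ 2 := by
      have hpos : 0 < (a * ‖ℓ‖ ^ 2) ^ 2 * ‖v₂‖ ^ 2 := by positivity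
      refine le_of_mul_le_mul_left ?_ hpos
      have := mul_le_mul_of_nonneg_right f3 hv'.le
      rw [mul_assoc (‖μ ℓ v‖ ^ 2), f2, f1] at this
      linarith
    have f5 : ((‖v‖ ^ 2 : ℝ) : ℂ) • v₂ - (S : ℂ) • v = 0 := by
      rw [← inner_self_eq_zero (𝕜 := ℂ)]
      have e : ⟪((‖v‖ ^ 2 : ℝ) : ℂ) • v₂ - (S : ℂ) • v, ((‖v‖ ^ 2 : ℝ) : ℂ) • v₂ - (S : ℂ) • v⟫_ℂ
          = ((‖v‖ ^ 2 * (‖v‖ ^ 2 * ‖v₂‖ ^ 2 - S ^ 2) : ℝ) : ℂ) := by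
        simp only [inner_sub_left, inner_sub_right, inner_smul_left, inner_smul_right,
          Complex.conj_ofReal, hS, hS', hvn, hv₂n]
        push_cast
        ring
      have e' := inner_self_nonneg (𝕜 := ℂ)
        (x := ((‖v‖ ^ 2 : ℝ) : ℂ) • v₂ - (S : ℂ) • v)
      rw [e] at e' ⊢
      have e'' : 0 ≤ ‖v‖ ^ 2 * (‖v‖ ^ 2 * ‖v₂‖ ^ 2 - S ^ 2) := by
        rwa [RCLike.re_to_complex, Complex.ofReal_re] at e'
      rw [le_antisymm (mul_nonpos_of_nonneg_of_nonpos hv'.le (sub_nonpos.2 f4)) e'',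
        Complex.ofReal_zero]
    have f6 : ∀ y, ((‖v‖ ^ 2 : ℝ) : ℂ) * ⟪v₂, y⟫_ℂ = S * ⟪v, y⟫_ℂ := fun y ↦ by
      have := congrArg (fun w ↦ ⟪w, y⟫_ℂ) f5
      simp only [inner_sub_left, inner_smul_left, Complex.conj_ofReal, inner_zero_left] at this
      exact sub_eq_zero.1 this
    apply hX
    apply mul_left_cancel₀ (hvn ▸ hvv)
    linear_combination ⟪v, μ x₁ z₁⟫_ℂ * f6 (μ x₂ z₂) - ⟪v, μ x₂ z₂⟫_ℂ * f6 (μ x₁ z₁)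
  obtain ⟨σ, hσ⟩ : ∃ σ, σ = ⟪v₂, μ ℓ v⟫_ℂ / ⟪v, μ ℓ v⟫_ℂ := ⟨_, rfl⟩
  have hs : ∀ x y, ⟪v₂, μ x y⟫_ℂ = σ * ⟪v, μ x y⟫_ℂ := fun x y ↦ by
    rw [hσ]
    field_simp
    linear_combination hX ℓ v x y
  -- On brackets μ ℓ scales ⟪v₂, ·⟫ by a⟪ℓ, ℓ⟫ and ⟪v, ·⟫ by ⟪ℓ, ℓ⟫, so a ≠ 1 gives σ = 0.
  have e := hs ℓ (μ ℓ v)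
  rw [h₂.inner_mul_base, h.inner_mul_base, hs, Complex.ofReal_one] at e
  have hσ0 : σ = 0 := by
    refine (mul_eq_zero.1 (?_ : ((1 - a) * ⟪ℓ, ℓ⟫_ℂ * ⟪v, μ ℓ v⟫_ℂ) * σ = 0)).resolve_left
      (mul_ne_zero (mul_ne_zero ha1' hr) hq)
    linear_combination -e
  rw [hs, hσ0, zero_mul]

/-- Once the second weight vector vanishes on brackets, ⟪μ ℓ v, ·⟫ is a multiple of ⟪v, ·⟫ there.
The first cyclic sum in `square_identity` then vanishes by the weight equation, and the second, at
(x, v, ℓ), determines μ ℓ v. -/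
theorem mul_eq_smul (H : IsReduced a μ) (h : IsWeight μ ℓ 1 v) (ha0 : a ≠ 0) (ha1 : a ≠ 1)
    (ha3 : a ≠ 1 / 3) (hℓ : ℓ ≠ 0) (hv : v ≠ 0) : μ ℓ v = ⟪ℓ, ℓ⟫_ℂ • v := by
  obtain ⟨p, v₂, h₂, hZ, hZm⟩ := exists_second H h hℓ hv ha0 ha1
  have hpure : ∀ x y, ⟪μ ℓ v, μ x y⟫_ℂ = p * ⟪v, μ x y⟫_ℂ := fun x y ↦ by
    rw [← sub_eq_zero, ← hZ, second_eq_zero H h h₂ ha0 ha1 ha3 hℓ hv hZ hZm]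
  have hvv : ⟪v, v⟫_ℂ ≠ 0 := inner_self_ne_zero.2 hv
  have ha0' : (a : ℂ) ≠ 0 := by exact_mod_cast ha0
  have hr : ⟪ℓ, ℓ⟫_ℂ ≠ 0 := inner_self_ne_zero.2 hℓ
  refine ext_inner_right ℂ fun x ↦ ?_
  have e := h.square_identity H x v ℓ
  have hZv : ⟪μ ℓ v, v⟫_ℂ = ⟪ℓ, ℓ⟫_ℂ * ⟪v, v⟫_ℂ := by
    rw [← inner_conj_symm, h.inner_mul_base, Complex.ofReal_one, one_mul, map_mul, inner_conj_symm,
      inner_conj_symm]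
  have hZℓ : ⟪μ ℓ v, ℓ⟫_ℂ = 0 := by rw [← inner_conj_symm, h.perp, map_zero]
  simp only [hpure, H.skew v ℓ, inner_neg_right, h.orth', h.inner_mul_base, Complex.ofReal_one, hZv,
    hZℓ, mul_neg] at e
  rw [inner_smul_left, inner_conj_symm]
  apply mul_left_cancel₀ (mul_ne_zero ha0' (mul_ne_zero hr hvv))
  linear_combination -e

end IsWeight

end Weights

/-! ### Existence of a weight vector when the trace is nonzero, and the resulting contradiction. -/

section Existence

open scoped ComplexConjugate InnerProductSpace

/-- Induction on the dimension: if some member of the commuting family is not scalar on K, any of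
its eigenspaces in K is proper and invariant under the whole family. -/
theorem exists_common_eigenvector {ι W : Type*} [AddCommGroup W] [Module ℂ W]
    [FiniteDimensional ℂ W] (f : ι → Module.End ℂ W) (hc : ∀ i j w, f i (f j w) = f j (f i w))
    (n : ℕ) : ∀ K : Submodule ℂ W, Module.finrank ℂ K ≤ n → K ≠ ⊥ →
      (∀ i, ∀ w ∈ K, f i w ∈ K) → ∃ w ∈ K, w ≠ 0 ∧ ∀ i, ∃ c : ℂ, f i w = c • w := by
  induction n with
  | zero =>
    intro K hn hK
    exact absurd (Submodule.finrank_eq_zero.1 (Nat.le_zero.1 hn)) hK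
  | succ n ih =>
    intro K hn hK hf
    by_cases hs : ∀ i, ∃ c : ℂ, ∀ w ∈ K, f i w = c • w
    · obtain ⟨w, hw, hw0⟩ := (Submodule.ne_bot_iff K).1 hK
      exact ⟨w, hw, hw0, fun i ↦ (hs i).imp fun c hc ↦ hc w hw⟩
    · push Not at hs
      obtain ⟨i, hi⟩ := hs
      have : Nontrivial K := Submodule.nontrivial_iff_ne_bot.2 hK
      obtain ⟨c, hcv⟩ := Module.End.exists_eigenvalue ((f i).restrict (hf i))
      obtain ⟨w, hw⟩ := hcv.exists_hasEigenvector
      have hwc : f i w = c • (w : W) := congrArg Subtype.val hw.apply_eq_smul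
      obtain ⟨u, hu, huc⟩ := hi c
      let K' : Submodule ℂ W := K ⊓ Module.End.eigenspace (f i) c
      have hlt : K' < K := lt_of_le_of_ne inf_le_left fun e ↦ huc (by
        have : u ∈ K' := e ▸ hu
        exact Module.End.mem_eigenspace_iff.1 this.2)
      obtain ⟨x, hx, h⟩ := ih K' (Nat.lt_succ_iff.1 ((Submodule.finrank_lt_finrank_of_lt hlt).trans_le hn))
        ((Submodule.ne_bot_iff K').2 ⟨w, ⟨w.2, Module.End.mem_eigenspace_iff.2 hwc⟩,
          fun e ↦ hw.2 (Subtype.ext e)⟩)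
        (fun j x hx ↦ ⟨hf j x hx.1, Module.End.mem_eigenspace_iff.2 (by
          rw [hc, Module.End.mem_eigenspace_iff.1 hx.2, map_smul])⟩)
      exact ⟨x, hx.1, h⟩

theorem exists_eigenvalue_ne_zero {W : Type*} [AddCommGroup W] [Module ℂ W]
    [FiniteDimensional ℂ W] (f : Module.End ℂ W) (h : LinearMap.trace ℂ W f ≠ 0) :
    ∃ c : ℂ, c ≠ 0 ∧ f.HasEigenvalue c := by
  by_contra! hc
  apply h
  rw [Module.End.trace_eq_sum_roots_charpoly_of_splits (IsAlgClosed.splits _)]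
  refine Multiset.sum_eq_zero fun c hcr ↦ ?_
  by_contra h0
  exact hc c h0 ((Module.End.hasEigenvalue_iff_isRoot_charpoly _ _).2 (Polynomial.isRoot_of_mem_roots hcr))

variable {V : Type*} [NormedAddCommGroup V] [InnerProductSpace ℂ V] [FiniteDimensional ℂ V]
  {a : ℝ} {μ : V →ₗ[ℂ] V →ₗ[ℂ] V}

/-- A nonzero trace gives μ h a nonzero eigenvalue c. The operators μ x ∘ μ h commute because inner
derivations commute on the derived algebra, so their transposes have a common eigenvector φ in the
c-eigenspace of the transpose of μ h. Applying φ to the Jacobi identity for h, x, y and dividing by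
c yields the weight equation. -/
theorem IsReduced.exists_functional (H : IsReduced a μ) {h : V}
    (hh : LinearMap.trace ℂ V (μ h) ≠ 0) : ∃ φ lam : V →ₗ[ℂ] ℂ, lam ≠ 0 ∧
      (∀ x y, lam (μ x y) = 0) ∧ (∀ x y, φ (μ x y) = lam x * φ y - lam y * φ x) ∧
      ∃ x y, φ (μ x y) ≠ 0 := by
  obtain ⟨c, hc0, hc⟩ := exists_eigenvalue_ne_zero (μ h).dualMap
    (by rwa [show (μ h).dualMap = Module.Dual.transpose (R := ℂ) (μ h) from rfl,
      LinearMap.trace_transpose'])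
  obtain ⟨φ, hφK, hφ0, hφ⟩ := exists_common_eigenvector
    (fun x : V ↦ (μ x ∘ₗ μ h).dualMap) (fun x y φ ↦ LinearMap.ext fun w ↦ by
      simp only [LinearMap.dualMap_apply, LinearMap.comp_apply]
      rw [H.mul_comm_pure h x, H.mul_comm_pure y x, H.mul_comm_pure h y])
    _ (Module.End.eigenspace (μ h).dualMap c) le_rfl hc (fun x φ hφ ↦ by
      rw [Module.End.mem_eigenspace_iff] at hφ ⊢
      ext w
      have e := LinearMap.congr_fun hφ (μ x (μ h w))
      simp only [LinearMap.dualMap_apply, LinearMap.comp_apply, LinearMap.smul_apply] at e ⊢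
      rw [← e, H.mul_comm_pure h x])
  rw [Module.End.mem_eigenspace_iff] at hφK
  have hφh : ∀ y, φ (μ h y) = c * φ y := fun y ↦ LinearMap.congr_fun hφK y
  obtain ⟨y₀, hy₀⟩ : ∃ y, φ y ≠ 0 := by
    by_contra! h0
    exact hφ0 (LinearMap.ext h0)
  -- The eigenvalue of the transpose of μ x ∘ μ h on φ is c times `lam x`; reading it off at y₀
  -- makes its linearity in x evident.
  let lam : V →ₗ[ℂ] ℂ := (c * φ y₀)⁻¹ • (φ ∘ₗ μ.flip (μ h y₀))
  have hlam : ∀ x y, φ (μ x (μ h y)) = c * lam x * φ y := fun x y ↦ by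
    obtain ⟨k, hk⟩ := hφ x
    have hk' : ∀ y, φ (μ x (μ h y)) = k * φ y := fun y ↦ LinearMap.congr_fun hk y
    simp only [lam, LinearMap.smul_apply, LinearMap.comp_apply, LinearMap.flip_apply, smul_eq_mul,
      hk']
    field_simp
  refine ⟨φ, lam, fun e ↦ ?_, fun x y ↦ ?_, fun x y ↦ ?_, h, y₀, ?_⟩
  · have e1 := hlam h y₀
    rw [hφh, hφh, e, LinearMap.zero_apply, mul_zero, zero_mul] at e1
    exact mul_ne_zero hc0 (mul_ne_zero hc0 hy₀) e1
  · simp only [lam, LinearMap.smul_apply, LinearMap.comp_apply, LinearMap.flip_apply, H.metabelian,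
      map_zero, smul_zero]
  · have e : μ h (μ x y) = μ x (μ h y) - μ y (μ h x) := by
      have e := H.jacobi h x y
      rw [H.skew (μ x y) h, H.skew (μ h x) y, H.skew (μ y h) x, H.skew y h, map_neg, neg_neg] at e
      linear_combination (norm := module) (-1 : ℂ) • e
    apply mul_left_cancel₀ hc0
    rw [← hφh, e, map_sub, hlam, hlam]
    ring
  · rw [hφh]
    exact mul_ne_zero hc0 hy₀

/-- Riesz representatives of the two functionals. Removing from the second its component along ℓ
preserves the weight equation, since ⟪ℓ, ·⟫ vanishes on brackets and its own contribution to the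
right side cancels. -/
theorem IsReduced.exists_isWeight (H : IsReduced a μ) {h : V}
    (hh : LinearMap.trace ℂ V (μ h) ≠ 0) : ∃ ℓ v : V, ℓ ≠ 0 ∧ v ≠ 0 ∧ IsWeight μ ℓ 1 v := by
  obtain ⟨φ, lam, hlam0, hlam, hφ, x₀, y₀, h0⟩ := H.exists_functional hh
  have hrep : ∀ f : V →ₗ[ℂ] ℂ, ∃ w : V, ∀ y, ⟪w, y⟫_ℂ = f y := fun f ↦
    ⟨(InnerProductSpace.toDual ℂ V).symm (LinearMap.toContinuousLinearMap f), fun y ↦ by simp⟩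
  obtain ⟨ℓ, hℓ⟩ := hrep lam
  obtain ⟨w, hw⟩ := hrep φ
  have hℓ0 : ℓ ≠ 0 := fun e ↦ hlam0 (LinearMap.ext fun y ↦ by
    rw [← hℓ, e, inner_zero_left, LinearMap.zero_apply])
  have hr : ⟪ℓ, ℓ⟫_ℂ ≠ 0 := inner_self_ne_zero.2 hℓ0
  have hv : ∀ y, ⟪w - (⟪ℓ, w⟫_ℂ / ⟪ℓ, ℓ⟫_ℂ) • ℓ, y⟫_ℂ
      = φ y - conj (⟪ℓ, w⟫_ℂ / ⟪ℓ, ℓ⟫_ℂ) * lam y := fun y ↦ by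
    rw [inner_sub_left, inner_smul_left, hw, hℓ y]
  refine ⟨ℓ, w - (⟪ℓ, w⟫_ℂ / ⟪ℓ, ℓ⟫_ℂ) • ℓ, hℓ0, fun e ↦ h0 ?_, fun x y ↦ by rw [hℓ, hlam],
    fun x y ↦ ?_, ?_⟩
  · have := hv (μ x₀ y₀)
    rwa [e, inner_zero_left, hlam, mul_zero, sub_zero, eq_comm] at this
  · rw [hv, hv, hv, hlam, hφ, hℓ x, hℓ y]
    push_cast
    ring
  · rw [inner_sub_right, inner_smul_right]
    field_simp
    ring

/-- On the span of ℓ and v the product and its adjoint are explicit: the affine Lie algebra in an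
orthogonal basis. Two evaluations of the mixed Ricci identity there are combined so that the
curvature drops out, leaving a polynomial equation for a. -/
theorem IsReduced.trace_eq_zero (H : IsReduced a μ) (ha0 : a ≠ 0) (ha1 : a ≠ 1) (ha2 : a ≠ 1 / 2)
    (ha4 : a ≠ 1 / 4) (ha3 : a ≠ 1 / 3) (ha5 : a ≠ 2 / 5) {P Q : V → V →ₗ[ℂ] V →ₗ[ℂ] V}
    (hP : ∀ w x y, P w x y = (1 - a : ℂ) • μ (μ x y) w) (hQ : ∀ w x y, Q w x y = antiDeriv a μ w x y)
    {ρ : V → V → V →ₗ[ℂ] V} (hρ : ∀ w z x, ρ w z x = ρ x z w)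
    (h : ∀ w z x y, mixedDeriv a μ (P w) (Q w) z x y
      - (1 - a : ℂ) • (Q z (μ x y) w + μ (Q z x y) w)
      - (a : ℂ) • (1 - a : ℂ) • μ (μ x y) (ad μ z w) + (a : ℂ) • antiDeriv a μ (ad μ w z) x y
      = ρ w z (μ x y) - μ (ρ w z x) y - μ x (ρ w z y)) (x : V) :
    LinearMap.trace ℂ V (μ x) = 0 := by
  by_contra hx
  obtain ⟨ℓ, v, hℓ, hv, W⟩ := H.exists_isWeight hx
  have hr : ⟪ℓ, ℓ⟫_ℂ ≠ 0 := inner_self_ne_zero.2 hℓ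
  have hvv : ⟪v, v⟫_ℂ ≠ 0 := inner_self_ne_zero.2 hv
  have m1 : μ ℓ v = ⟪ℓ, ℓ⟫_ℂ • v := W.mul_eq_smul H ha0 ha1 ha3 hℓ hv
  have m2 : μ v ℓ = -⟪ℓ, ℓ⟫_ℂ • v := by rw [H.skew, m1, neg_smul]
  have m3 := self_mul_eq_zero H.skew v
  have m4 := self_mul_eq_zero H.skew ℓ
  have a1 : ad μ ℓ v = ⟪ℓ, ℓ⟫_ℂ • v := by
    rw [W.ad_vector, W.orth, mul_zero, zero_smul, sub_zero, Complex.ofReal_one, one_mul]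
  have a2 : ad μ v v = -⟪v, v⟫_ℂ • ℓ := by
    rw [W.ad_vector, W.orth', mul_zero, zero_smul, zero_sub, Complex.ofReal_one, one_mul, neg_smul]
  have hrc : conj ⟪ℓ, ℓ⟫_ℂ = ⟪ℓ, ℓ⟫_ℂ := inner_conj_symm _ _
  have hvc : conj ⟪v, v⟫_ℂ = ⟪v, v⟫_ℂ := inner_conj_symm _ _
  have b1 : ⟪μ (ad (P v) ℓ v) v, v⟫_ℂ = 0 := by
    rw [← inner_conj_symm, W.eigen, ad_inner_right, hP, m4, map_zero, LinearMap.zero_apply, smul_zero,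
      inner_zero_left, W.orth]
    simp
  have b2 : ⟪μ (ad (P ℓ) ℓ v) ℓ, v⟫_ℂ = (1 - a) * ⟪ℓ, ℓ⟫_ℂ ^ 3 * ⟪v, v⟫_ℂ := by
    rw [← inner_conj_symm, W.eigen, ad_inner_right, ad_inner_right, hP, hP, m1, map_smul,
      LinearMap.smul_apply, m2, W.orth']
    simp only [map_mul, map_sub, inner_smul_left, inner_conj_symm, hrc, hvc, Complex.conj_ofReal,
      map_one, map_neg, map_zero, Complex.ofReal_one]
    ring
  -- In this pairing the curvature contributes only -⟪v, v⟫⟪ℓ, ρ(v, v)ℓ⟫, and in the next one ⟪ℓ,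
  -- ℓ⟫⟪ℓ, ρ(ℓ, v)v⟫. These are opposite after rescaling, by the symmetry of ρ in its first and
  -- third arguments.
  have e1 := congrArg (fun u ↦ ⟪v, u⟫_ℂ) (h v v ℓ v)
  have e2 := congrArg (fun u ↦ ⟪ℓ, u⟫_ℂ) (h ℓ v ℓ v)
  simp only [mixedDeriv, antiDeriv, hP, hQ, m1, m2, m3, m4, a1, a2, W.ad_base, W.orth, W.orth',
    inner_add_right, inner_sub_right, inner_smul_right, inner_zero_right, inner_add_left, inner_sub_left, inner_smul_left, inner_zero_left,
    map_add, map_sub, map_neg, map_smul, map_smulₛₗ, map_zero, LinearMap.add_apply,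
    LinearMap.sub_apply, LinearMap.smul_apply, LinearMap.zero_apply,
    W.eigen, W.perp, ad_inner_right, hrc, hvc, Complex.ofReal_one, Complex.conj_ofReal, b1, b2] at e1 e2
  have key : ⟪v, v⟫_ℂ ^ 2 * ⟪ℓ, ℓ⟫_ℂ ^ 3 * (-((coeffA a : ℂ) - coeffC a) ^ 2
      + (1 - 2 * a) * ((coeffA a : ℂ) - coeffC a) - a * (1 - a)
      + a * ((coeffB a : ℂ) + coeffC a)) = 0 := by
    rw [hρ ℓ v v] at e2
    linear_combination ⟪ℓ, ℓ⟫_ℂ * e1 + ⟪v, v⟫_ℂ * e2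
  have hD := (mul_ne_zero (sub_ne_zero.2 (fun e : (1 : ℝ) = 2 * a ↦ ha2 (by linarith)))
    (sub_ne_zero.2 (fun e : (1 : ℝ) = 4 * a ↦ ha4 (by linarith))))
  have hp : (coeffA a - coeffC a) * ((1 - 2 * a) * (1 - 4 * a)) = a * (1 - a) * (1 - 3 * a) := by
    rw [coeffA, coeffC, ← sub_div, div_mul_cancel₀ _ hD]
    ring
  have hβ : (coeffB a + coeffC a) * ((1 - 2 * a) * (1 - 4 * a)) = -a ^ 2 * (1 - a) := by
    rw [coeffB, coeffC, ← add_div, div_mul_cancel₀ _ hD]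
    ring
  have key' := (mul_eq_zero.1 key).resolve_left (mul_ne_zero (pow_ne_zero 2 hvv) (pow_ne_zero 3 hr))
  have key₀ : -(coeffA a - coeffC a) ^ 2 + (1 - 2 * a) * (coeffA a - coeffC a) - a * (1 - a)
      + a * (coeffB a + coeffC a) = 0 := by
    exact_mod_cast key'
  -- `key₀` multiplied by the square of the common denominator is this product up to sign. The
  -- factor 2 - 5a occurs only here.
  have hne : a ^ 3 * (1 - a) * (1 - 3 * a) * (2 - 5 * a) ≠ 0 :=
    mul_ne_zero (mul_ne_zero (mul_ne_zero (pow_ne_zero 3 ha0)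
      (sub_ne_zero.2 fun e ↦ ha1 (by linarith))) (sub_ne_zero.2 fun e ↦ ha3 (by linarith)))
      (sub_ne_zero.2 fun e ↦ ha5 (by linarith))
  apply hne
  linear_combination -((1 - 2 * a) * (1 - 4 * a)) ^ 2 * key₀
    + (-((coeffA a - coeffC a) * ((1 - 2 * a) * (1 - 4 * a)) + a * (1 - a) * (1 - 3 * a))
      + (1 - 2 * a) * ((1 - 2 * a) * (1 - 4 * a))) * hp + a * ((1 - 2 * a) * (1 - 4 * a)) * hβ

end Existence

/-! ### Assembly of the pointwise argument for generic parameters. -/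

section Pointwise

open scoped ComplexConjugate InnerProductSpace

variable {V : Type*} [NormedAddCommGroup V] [InnerProductSpace ℂ V] [FiniteDimensional ℂ V]
  {a : ℝ} {μ : V →ₗ[ℂ] V →ₗ[ℂ] V} {N : V → V →ₗ[ℂ] V →ₗ[ℂ] V}

theorem deriv_eq_torsionDeriv (ha0 : a ≠ 0) (ha2 : a ≠ 1 / 2) (ha4 : a ≠ 1 / 4)
    (hμ : ∀ x y, μ x y = -μ y x) (hN : ∀ z, N (-z) = -N z)
    (hNs : ∀ z x y, N z x y = -N z y x) (h : TorsionBianchi a μ N) (z x y : V) :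
    N z x y = torsionDeriv a μ z x y := by
  rw [torsionDeriv, ← (linPart_eq_and_jacobi ha0 ha2 hμ hN hNs h x y z).1,
    ← antiPart_eq ha2 ha4 hμ hN hNs h, ← LinearMap.add_apply, ← LinearMap.add_apply,
    linPart_add_antiPart N z]

/-- The Kähler symmetry of the (1,1)-curvature in its two linear slots: in the cyclic identity for
w, z, x the curvature R(w, x) drops out of the relevant type because R is of type (1,1). -/
theorem curvature_swap {R : V → V → V →ₗ[ℂ] V} (hRs : ∀ x y, R x y = -R y x)
    (hRn : ∀ x y, R (-x) y = -R x y)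
    (hRI : ∀ x y, R (Complex.I • x) (Complex.I • y) = R x y)
    (hRB : ∀ x y z, R x y z + R y z x + R z x y = 0) (w z x : V) :
    R w z x - Complex.I • R (Complex.I • w) z x = R x z w - Complex.I • R (Complex.I • x) z w := by
  have hI : ∀ v : V, Complex.I • Complex.I • v = -v := fun v ↦ by
    rw [smul_smul, Complex.I_mul_I, neg_one_smul]
  have e1 := hRB (Complex.I • w) z x
  have e2 := hRB (Complex.I • x) z w
  have e3 : R x (Complex.I • w) = R w (Complex.I • x) := by
    have := hRI x (Complex.I • w)
    rw [hI, hRs, hRn, neg_neg] at this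
    exact this.symm
  have s2 : R x z w = -R z x w := by rw [hRs, LinearMap.neg_apply]
  have s3 : R z w x = -R w z x := by rw [hRs, LinearMap.neg_apply]
  rw [e3, map_smul] at e1
  rw [map_smul] at e2
  have e4 := congrArg (fun t ↦ Complex.I • t) e1
  have e5 := congrArg (fun t ↦ Complex.I • t) e2
  simp only [smul_add, hI, smul_zero] at e4 e5
  linear_combination (norm := module) (1 : ℂ) • e5 - (1 : ℂ) • e4 - (1 : ℂ) • s2 + (1 : ℂ) • s3

theorem trace_eq_zero_of_kahlerLike (ha0 : a ≠ 0) (ha1 : a ≠ 1) (ha2 : a ≠ 1 / 2)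
    (ha4 : a ≠ 1 / 4) (ha3 : a ≠ 1 / 3) (ha5 : a ≠ 2 / 5)
    (hμ : ∀ x y, μ x y = -μ y x) (hN : ∀ z, N (-z) = -N z)
    (hNs : ∀ z x y, N z x y = -N z y x) (hB : TorsionBianchi a μ N)
    {R : V → V → V →ₗ[ℂ] V} (hRs : ∀ x y, R x y = -R y x) (hRn : ∀ x y, R (-x) y = -R x y)
    (hRI : ∀ x y, R (Complex.I • x) (Complex.I • y) = R x y)
    (hRB : ∀ x y z, R x y z + R y z x + R z x y = 0)
    (hRic : ∀ w z x y, torsionDerivDeriv a μ (N w) z x y - torsionDerivDeriv a μ (N z) w x y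
      + torsionDeriv a μ (gTorsion a μ w z) x y
      = R w z (μ x y) - μ (R w z x) y - μ x (R w z y))
    (hJd : ∀ z x y t, (torsionDeriv a μ z (μ x y) t + μ (torsionDeriv a μ z x y) t)
      + (torsionDeriv a μ z (μ y t) x + μ (torsionDeriv a μ z y t) x)
      + (torsionDeriv a μ z (μ t x) y + μ (torsionDeriv a μ z t x) y) = 0) (x : V) :
    LinearMap.trace ℂ V (μ x) = 0 := by
  have hP := fun z x y ↦ (linPart_eq_and_jacobi ha0 ha2 hμ hN hNs hB x y z).1
  have hJ := fun x y z ↦ (linPart_eq_and_jacobi ha0 ha2 hμ hN hNs hB x y z).2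
  have hQ := antiPart_eq ha2 ha4 hμ hN hNs hB
  have hc := ricci_components hN hP hRI hRic
  have hne : (1 - a : ℂ) ≠ 0 := sub_ne_zero.2 (by exact_mod_cast ha1.symm)
  have hne' : (1 - 2 * a : ℂ) ≠ 0 := by
    have : (1 - 2 * a : ℝ) ≠ 0 := fun e ↦ ha2 (by linarith)
    exact_mod_cast this
  have H : IsReduced a μ := ⟨hμ, hJ, fun x y z w ↦
    (smul_eq_zero.1 ((smul_eq_zero.1 (hc z w x y).1).resolve_left hne)).resolve_left hne',
    jacobi_deriv ha0 ha2 ha4 hμ hJ hJd⟩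
  refine H.trace_eq_zero ha0 ha1 ha2 ha4 ha3 ha5 (P := linPart N) (Q := antiPart N) hP hQ
    (ρ := fun w z ↦ (1 / 2 : ℂ) • (R w z - Complex.I • R (Complex.I • w) z)) (fun w z x ↦ ?_)
    (fun w z x y ↦ ?_) x
  · simp only [LinearMap.smul_apply, LinearMap.sub_apply]
    rw [curvature_swap hRs hRn hRI hRB]
  · rw [(hc w z x y).2]
    simp only [LinearMap.smul_apply, LinearMap.sub_apply, map_smul, map_sub]
    module

end Pointwise

/-! ### From real Hermitian data to a complex inner product space. -/

section Realification

open scoped ComplexConjugate InnerProductSpace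

theorem trace_real_eq {W : Type*} [AddCommGroup W] [Module ℂ W] [Module ℝ W] [IsScalarTower ℝ ℂ W]
    [FiniteDimensional ℂ W] (f : W →ₗ[ℂ] W) :
    LinearMap.trace ℝ W (f.restrictScalars ℝ) = 2 * (LinearMap.trace ℂ W f).re := by
  classical
  let c := Module.finBasis ℂ W
  rw [LinearMap.trace_eq_matrix_trace ℝ (Complex.basisOneI.smulTower c),
    LinearMap.trace_eq_matrix_trace ℂ c, Matrix.trace, Matrix.trace, Fintype.sum_prod_type_right,
    Complex.re_sum, Finset.mul_sum]
  refine Finset.sum_congr rfl fun k _ ↦ ?_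
  simp [LinearMap.toMatrix_apply, Module.Basis.smulTower_repr, Module.Basis.smulTower_apply,
    Fin.sum_univ_two]
  ring

/-- A complex structure and a compatible inner product on a real vector space. -/
structure HermitianStructure (E : Type*) [AddCommGroup E] [Module ℝ E] where
  /-- The complex structure. -/
  J : E →ₗ[ℝ] E
  /-- The inner product. -/
  g : E →ₗ[ℝ] E →ₗ[ℝ] ℝ
  sq : ∀ x, J (J x) = -x
  symm : ∀ x y, g x y = g y x
  pos : ∀ x, x ≠ 0 → 0 < g x x
  inv : ∀ x y, g (J x) (J y) = g x y

namespace HermitianStructure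

variable {E : Type*} [AddCommGroup E] [Module ℝ E] (h : HermitianStructure E)

theorem skew (x y : E) : h.g (h.J x) y = -h.g x (h.J y) := by
  rw [← h.inv x (h.J y), h.sq, map_neg, neg_neg]

/-- The underlying space, regarded as a complex inner product space. -/
def Space (_ : HermitianStructure E) : Type _ := E

instance : AddCommGroup h.Space := inferInstanceAs (AddCommGroup E)

/-- The identification of the real space with the complex inner product space. -/
def of : E ≃+ h.Space := AddEquiv.refl E

instance : SMul ℂ h.Space where
  smul c x := h.of (c.re • h.of.symm x + c.im • h.J (h.of.symm x))

theorem smul_of (c : ℂ) (x : E) : c • h.of x = h.of (c.re • x + c.im • h.J x) := rfl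

instance : Module ℂ h.Space where
  one_smul x := by
    obtain ⟨x, rfl⟩ := h.of.surjective x
    simp [smul_of]
  zero_smul x := by
    obtain ⟨x, rfl⟩ := h.of.surjective x
    simp [smul_of]
  smul_zero c := by
    rw [← map_zero h.of, smul_of]
    simp
  smul_add c x y := by
    obtain ⟨x, rfl⟩ := h.of.surjective x
    obtain ⟨y, rfl⟩ := h.of.surjective y
    rw [← map_add, smul_of, smul_of, smul_of, ← map_add, map_add h.J]
    congr 1
    module
  add_smul c d x := by
    obtain ⟨x, rfl⟩ := h.of.surjective x
    rw [smul_of, smul_of, smul_of, ← map_add, Complex.add_re, Complex.add_im]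
    congr 1
    module
  mul_smul c d x := by
    obtain ⟨x, rfl⟩ := h.of.surjective x
    rw [smul_of, smul_of, smul_of, Complex.mul_re, Complex.mul_im, map_add h.J, map_smul, map_smul,
      h.sq]
    congr 1
    module

theorem I_smul_of (x : E) : Complex.I • h.of x = h.of (h.J x) := by
  rw [smul_of, Complex.I_re, Complex.I_im, zero_smul, one_smul, zero_add]

theorem real_smul_of (r : ℝ) (x : E) : (r : ℂ) • h.of x = h.of (r • x) := by
  rw [smul_of, Complex.ofReal_re, Complex.ofReal_im, zero_smul, add_zero]

/-- The Hermitian inner product. -/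
abbrev core : InnerProductSpace.Core ℂ h.Space where
  inner x y := ⟨h.g (h.of.symm x) (h.of.symm y), h.g (h.J (h.of.symm x)) (h.of.symm y)⟩
  conj_inner_symm x y := by
    refine Complex.ext ?_ ?_
    · exact h.symm _ _
    · change -h.g (h.J _) _ = h.g (h.J _) _
      rw [h.skew, neg_neg, h.symm]
  re_inner_nonneg x := by
    change 0 ≤ h.g x x
    rcases eq_or_ne (h.of.symm x) 0 with e | e
    · rw [show h.g x x = h.g (h.of.symm x) (h.of.symm x) from rfl, e, map_zero]
    · exact (h.pos _ e).le
  definite x e := by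
    by_contra hx
    exact (h.pos (h.of.symm x) hx).ne' (congrArg Complex.re e)
  add_left x y z := by
    simp only [map_add, LinearMap.add_apply]
    rfl
  smul_left x y c := by
    obtain ⟨x, rfl⟩ := h.of.surjective x
    obtain ⟨y, rfl⟩ := h.of.surjective y
    rw [smul_of]
    simp only [AddEquiv.symm_apply_apply, map_add, map_smul, h.sq, LinearMap.add_apply,
      LinearMap.smul_apply, smul_eq_mul, map_neg, LinearMap.neg_apply]
    refine Complex.ext ?_ ?_
    · rw [Complex.mul_re, Complex.conj_re, Complex.conj_im]
      ring
    · rw [Complex.mul_im, Complex.conj_re, Complex.conj_im]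
      ring

instance : NormedAddCommGroup h.Space := h.core.toNormedAddCommGroup

instance : InnerProductSpace ℂ h.Space := InnerProductSpace.ofCore h.core.toCore

theorem inner_of (x y : E) : ⟪h.of x, h.of y⟫_ℂ = ⟨h.g x y, h.g (h.J x) y⟩ := rfl

/-- The real linear identification with the complex inner product space. -/
def ofReal : E ≃ₗ[ℝ] h.Space :=
  { h.of with map_smul' := fun r x ↦ (h.real_smul_of r x).symm }

instance [FiniteDimensional ℝ E] : FiniteDimensional ℂ h.Space := by
  have : FiniteDimensional ℝ h.Space := LinearEquiv.finiteDimensional h.ofReal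
  exact Module.Finite.of_restrictScalars_finite ℝ ℂ h.Space

/-- A real bilinear map commuting with the complex structure, as a complex bilinear map. -/
def cx (B : E →ₗ[ℝ] E →ₗ[ℝ] E) (h₁ : ∀ x y, B (h.J x) y = h.J (B x y))
    (h₂ : ∀ x y, B x (h.J y) = h.J (B x y)) : h.Space →ₗ[ℂ] h.Space →ₗ[ℂ] h.Space :=
  LinearMap.mk₂ ℂ (fun x y ↦ h.of (B (h.of.symm x) (h.of.symm y)))
    (fun x y z ↦ by simp only [map_add, LinearMap.add_apply])
    (fun c x y ↦ by
      obtain ⟨x, rfl⟩ := h.of.surjective x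
      rw [smul_of, smul_of]
      simp only [AddEquiv.symm_apply_apply, map_add, map_smul, LinearMap.add_apply,
        LinearMap.smul_apply, h₁])
    (fun x y z ↦ by simp only [map_add])
    (fun c x y ↦ by
      obtain ⟨y, rfl⟩ := h.of.surjective y
      rw [smul_of, smul_of]
      simp only [AddEquiv.symm_apply_apply, map_add, map_smul, h₂])

theorem cx_of (B : E →ₗ[ℝ] E →ₗ[ℝ] E) (h₁ h₂) (x y : E) :
    h.cx B h₁ h₂ (h.of x) (h.of y) = h.of (B x y) := rfl

/-- For an operator commuting with J, the adjoint for g is also the adjoint for the Hermitian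
product. -/
theorem ad_cx [FiniteDimensional ℝ E] (B : E →ₗ[ℝ] E →ₗ[ℝ] E) (h₁ h₂) (A : E →ₗ[ℝ] E →ₗ[ℝ] E)
    (hA : ∀ x y z, h.g (A x y) z = h.g y (B x z)) (x y : E) :
    ad (h.cx B h₁ h₂) (h.of x) (h.of y) = h.of (A x y) := by
  refine ext_inner_right ℂ fun z ↦ ?_
  obtain ⟨z, rfl⟩ := h.of.surjective z
  rw [ad_inner_left, cx_of, inner_of, inner_of, hA, h.skew, h.skew, hA, h₂]

/-- A real linear map commuting with the complex structure, as a complex linear map. -/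
def cxEnd (T : E →ₗ[ℝ] E) (h₁ : ∀ x, T (h.J x) = h.J (T x)) : h.Space →ₗ[ℂ] h.Space where
  toFun x := h.of (T (h.of.symm x))
  map_add' x y := by simp only [map_add]
  map_smul' c x := by
    obtain ⟨x, rfl⟩ := h.of.surjective x
    rw [smul_of, RingHom.id_apply, smul_of]
    simp only [AddEquiv.symm_apply_apply, map_add, map_smul, h₁]

theorem trace_cx [FiniteDimensional ℝ E] (B : E →ₗ[ℝ] E →ₗ[ℝ] E) (h₁ h₂) (x : E) :
    LinearMap.trace ℝ E (B x) = 2 * (LinearMap.trace ℂ _ (h.cx B h₁ h₂ (h.of x))).re := by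
  rw [← trace_real_eq, ← LinearMap.trace_conj' (B x) h.ofReal]
  rfl

/-- The real trace sees only the real part of the complex trace; the imaginary part is recovered by
replacing x with Jx. -/
theorem trace_cx_eq_zero [FiniteDimensional ℝ E] (B : E →ₗ[ℝ] E →ₗ[ℝ] E) (h₁ h₂) :
    (∀ x, LinearMap.trace ℝ E (B x) = 0) ↔
      ∀ x, LinearMap.trace ℂ _ (h.cx B h₁ h₂ x) = 0 := by
  refine ⟨fun H x ↦ ?_, fun H x ↦ by rw [h.trace_cx B h₁ h₂, H, Complex.zero_re, mul_zero]⟩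
  obtain ⟨x, rfl⟩ := h.of.surjective x
  refine Complex.ext ?_ ?_
  · have e := h.trace_cx B h₁ h₂ x
    rw [H] at e
    rw [Complex.zero_re]
    linarith
  · have e := h.trace_cx B h₁ h₂ (h.J x)
    rw [H, ← I_smul_of, map_smul, map_smul, smul_eq_mul, Complex.I_mul_re] at e
    rw [Complex.zero_im]
    linarith

end HermitianStructure

end Realification

/-! ### The pointwise results in real notation. -/

section RealPointwise

variable {E : Type*} [AddCommGroup E] [Module ℝ E]

/-- The torsion of the Gauduchon connection, in terms of the Chern torsion `μ` and its adjoint. -/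
def realTorsion (a : ℝ) (μ A : E →ₗ[ℝ] E →ₗ[ℝ] E) (x y : E) : E :=
  (1 - 2 * a) • μ x y + a • (A x y - A y x)

/-- The covariant derivative of the Chern torsion, in terms of the torsion and its adjoint. -/
def realDeriv (a : ℝ) (μ A : E →ₗ[ℝ] E →ₗ[ℝ] E) (z x y : E) : E :=
  (1 - a) • μ (μ x y) z + (-coeffA a • (A (A y z) x - A (A x z) y)
    + coeffB a • (μ y (A z x) - μ x (A z y)) - coeffC a • A z (μ x y))

/-- The derivative of `realDeriv` when the derivatives of `μ` and `A` are `ν` and `B`. -/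
def realDerivDeriv (a : ℝ) (μ A ν B : E →ₗ[ℝ] E →ₗ[ℝ] E) (z x y : E) : E :=
  (1 - a) • (ν (μ x y) z + μ (ν x y) z)
    + (-coeffA a • ((B (A y z) x + A (B y z) x) - (B (A x z) y + A (B x z) y))
      + coeffB a • ((ν y (A z x) + μ y (B z x)) - (ν x (A z y) + μ x (B z y)))
      - coeffC a • (B z (μ x y) + A z (ν x y)))

/-- The Chern torsion `μ` at a point with its adjoint `A`, its covariant derivative `N` and the
adjoint `B` of the latter, subject to the torsion-less Bianchi identity. -/
structure IsTorsionAt (h : HermitianStructure E) (a : ℝ) (μ A : E →ₗ[ℝ] E →ₗ[ℝ] E)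
    (N B : E → E →ₗ[ℝ] E →ₗ[ℝ] E) : Prop where
  skew : ∀ x y, μ x y = -μ y x
  map_J : ∀ x y, μ (h.J x) y = h.J (μ x y)
  adj : ∀ x y z, h.g (A x y) z = h.g y (μ x z)
  deriv_neg : ∀ z x y, N (-z) x y = -N z x y
  deriv_skew : ∀ z x y, N z x y = -N z y x
  deriv_map_J : ∀ z x y, N z (h.J x) y = h.J (N z x y)
  deriv_adj : ∀ z x y w, h.g (B z x y) w = h.g y (N z x w)
  bianchi : ∀ x y z,
    (realTorsion a (N x) (B x) y z + realTorsion a μ A (realTorsion a μ A x y) z)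
      + (realTorsion a (N y) (B y) z x + realTorsion a μ A (realTorsion a μ A y z) x)
      + (realTorsion a (N z) (B z) x y + realTorsion a μ A (realTorsion a μ A z x) y) = 0

namespace IsTorsionAt

variable {h : HermitianStructure E} {a : ℝ} {μ A : E →ₗ[ℝ] E →ₗ[ℝ] E}
  {N B : E → E →ₗ[ℝ] E →ₗ[ℝ] E}

theorem map_J' (H : IsTorsionAt h a μ A N B) (x y : E) : μ x (h.J y) = h.J (μ x y) := by
  rw [H.skew, H.map_J, H.skew y, map_neg, neg_neg]

theorem deriv_map_J' (H : IsTorsionAt h a μ A N B) (z x y : E) :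
    N z x (h.J y) = h.J (N z x y) := by
  rw [H.deriv_skew, H.deriv_map_J, H.deriv_skew z y, map_neg, neg_neg]

/-- The Chern torsion as a complex bilinear map. -/
def cμ (H : IsTorsionAt h a μ A N B) : h.Space →ₗ[ℂ] h.Space →ₗ[ℂ] h.Space :=
  h.cx μ H.map_J H.map_J'

/-- The covariant derivative of the Chern torsion as a complex bilinear map. -/
def cN (H : IsTorsionAt h a μ A N B) (z : h.Space) : h.Space →ₗ[ℂ] h.Space →ₗ[ℂ] h.Space :=
  h.cx (N (h.of.symm z)) (H.deriv_map_J _) (H.deriv_map_J' _)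

variable (H : IsTorsionAt h a μ A N B)

theorem cμ_of (x y : E) : H.cμ (h.of x) (h.of y) = h.of (μ x y) := rfl

theorem cN_of (z x y : E) : H.cN (h.of z) (h.of x) (h.of y) = h.of (N z x y) := rfl

theorem cμ_skew (x y : h.Space) : H.cμ x y = -H.cμ y x := by
  obtain ⟨x, rfl⟩ := h.of.surjective x
  obtain ⟨y, rfl⟩ := h.of.surjective y
  rw [cμ_of, cμ_of, H.skew, map_neg]

theorem cN_skew (z x y : h.Space) : H.cN z x y = -H.cN z y x := by
  obtain ⟨x, rfl⟩ := h.of.surjective x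
  obtain ⟨y, rfl⟩ := h.of.surjective y
  obtain ⟨z, rfl⟩ := h.of.surjective z
  rw [cN_of, cN_of, H.deriv_skew, map_neg]

theorem cN_neg (z : h.Space) : H.cN (-z) = -H.cN z := by
  ext x y
  obtain ⟨x, rfl⟩ := h.of.surjective x
  obtain ⟨y, rfl⟩ := h.of.surjective y
  obtain ⟨z, rfl⟩ := h.of.surjective z
  rw [← map_neg, cN_of, LinearMap.neg_apply, LinearMap.neg_apply, cN_of, H.deriv_neg, map_neg]

variable [FiniteDimensional ℝ E]

theorem ad_cμ (x y : E) : ad H.cμ (h.of x) (h.of y) = h.of (A x y) := h.ad_cx μ _ _ A H.adj x y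

theorem ad_cN (z x y : E) : ad (H.cN (h.of z)) (h.of x) (h.of y) = h.of (B z x y) :=
  h.ad_cx (N z) _ _ (B z) (H.deriv_adj z) x y

theorem gTorsion_of (x y : E) :
    gTorsion a H.cμ (h.of x) (h.of y) = h.of (realTorsion a μ A x y) := by
  have e : (1 - 2 * (a : ℂ)) = ((1 - 2 * a : ℝ) : ℂ) := by push_cast; rfl
  rw [gTorsion, realTorsion, cμ_of, ad_cμ, ad_cμ, ← map_sub, e, h.real_smul_of, h.real_smul_of,
    ← map_add]

theorem gTorsionDeriv_of (z x y : E) :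
    gTorsionDeriv a (H.cN (h.of z)) (h.of x) (h.of y) = h.of (realTorsion a (N z) (B z) x y) := by
  have e : (1 - 2 * (a : ℂ)) = ((1 - 2 * a : ℝ) : ℂ) := by push_cast; rfl
  rw [gTorsionDeriv, realTorsion, cN_of, ad_cN, ad_cN, ← map_sub, e, h.real_smul_of,
    h.real_smul_of, ← map_add]

theorem torsionDeriv_of (z x y : E) :
    torsionDeriv a H.cμ (h.of z) (h.of x) (h.of y) = h.of (realDeriv a μ A z x y) := by
  have e : (1 - (a : ℂ)) = ((1 - a : ℝ) : ℂ) := by push_cast; rfl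
  simp only [torsionDeriv, antiDeriv, realDeriv, cμ_of, ad_cμ, ← map_sub, e, h.real_smul_of,
    ← Complex.ofReal_neg, ← map_add]

theorem torsionDerivDeriv_of (w z x y : E) :
    torsionDerivDeriv a H.cμ (H.cN (h.of w)) (h.of z) (h.of x) (h.of y)
      = h.of (realDerivDeriv a μ A (N w) (B w) z x y) := by
  have e : (1 - (a : ℂ)) = ((1 - a : ℝ) : ℂ) := by push_cast; rfl
  simp only [torsionDerivDeriv, realDerivDeriv, cμ_of, ad_cμ, cN_of, ad_cN, ← map_sub, e,
    h.real_smul_of, ← Complex.ofReal_neg, ← map_add]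

theorem torsionBianchi : TorsionBianchi a H.cμ H.cN := by
  intro x y z
  obtain ⟨x, rfl⟩ := h.of.surjective x
  obtain ⟨y, rfl⟩ := h.of.surjective y
  obtain ⟨z, rfl⟩ := h.of.surjective z
  simp only [gTorsion_of, gTorsionDeriv_of, ← map_add]
  rw [H.bianchi, map_zero]

theorem trace_iff : (∀ x, LinearMap.trace ℝ E (μ x) = 0) ↔ ∀ x, LinearMap.trace ℂ _ (H.cμ x) = 0 :=
  h.trace_cx_eq_zero μ _ _

theorem eq_zero_of_cμ (hc : H.cμ = 0) : μ = 0 := by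
  ext x y
  apply h.of.injective
  rw [← H.cμ_of, hc]
  exact (map_zero h.of).symm

theorem eq_zero_of_trace (H : IsTorsionAt h a μ A N B) (ha : a ≠ 0) (ht : ∀ x, LinearMap.trace ℝ E (μ x) = 0)
    (hNt : ∀ z x, LinearMap.trace ℝ E (N z x) = 0) : μ = 0 :=
  H.eq_zero_of_cμ <| torsion_eq_zero_of_trace_eq_zero ha H.cμ_skew H.cN_neg H.cN_skew
    H.torsionBianchi (H.trace_iff.1 ht) fun z ↦
      (h.trace_cx_eq_zero _ (H.deriv_map_J _) (H.deriv_map_J' _)).1 (hNt (h.of.symm z))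

theorem eq_zero_of_quarter (H : IsTorsionAt h a μ A N B) (ha : a = 1 / 4) : μ = 0 :=
  H.eq_zero_of_cμ <| torsion_eq_zero_of_quarter ha H.cμ_skew H.cN_neg H.cN_skew H.torsionBianchi

theorem trace_eq_zero_of_half (H : IsTorsionAt h a μ A N B) (ha : a = 1 / 2) (x : E) : LinearMap.trace ℝ E (μ x) = 0 :=
  H.trace_iff.2 (HermitianTorsion.trace_eq_zero_of_half ha H.cμ_skew H.cN_neg H.cN_skew
    H.torsionBianchi) x

theorem deriv_eq (H : IsTorsionAt h a μ A N B) (ha0 : a ≠ 0) (ha2 : a ≠ 1 / 2) (ha4 : a ≠ 1 / 4) (z x y : E) :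
    N z x y = realDeriv a μ A z x y := by
  apply h.of.injective
  rw [← H.cN_of, ← H.torsionDeriv_of]
  exact deriv_eq_torsionDeriv ha0 ha2 ha4 H.cμ_skew H.cN_neg H.cN_skew H.torsionBianchi _ _ _

theorem jacobi (H : IsTorsionAt h a μ A N B) (ha0 : a ≠ 0) (ha2 : a ≠ 1 / 2) (x y z : E) :
    μ (μ x y) z + μ (μ y z) x + μ (μ z x) y = 0 := by
  apply h.of.injective
  simp only [map_add, map_zero, ← H.cμ_of]
  exact (linPart_eq_and_jacobi ha0 ha2 H.cμ_skew H.cN_neg H.cN_skew H.torsionBianchi _ _ _).2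

theorem trace_eq_zero (H : IsTorsionAt h a μ A N B) (ha0 : a ≠ 0) (ha1 : a ≠ 1) (ha2 : a ≠ 1 / 2) (ha4 : a ≠ 1 / 4)
    (ha3 : a ≠ 1 / 3) (ha5 : a ≠ 2 / 5) {R : E → E → E →ₗ[ℝ] E}
    (hRJ : ∀ x y z, R x y (h.J z) = h.J (R x y z))
    (hRs : ∀ x y z, R x y z = -R y x z) (hRn : ∀ x y z, R (-x) y z = -R x y z)
    (hRI : ∀ x y z, R (h.J x) (h.J y) z = R x y z)
    (hRB : ∀ x y z, R x y z + R y z x + R z x y = 0)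
    (hRic : ∀ w z x y, realDerivDeriv a μ A (N w) (B w) z x y
      - realDerivDeriv a μ A (N z) (B z) w x y + realDeriv a μ A (realTorsion a μ A w z) x y
      = R w z (μ x y) - μ (R w z x) y - μ x (R w z y))
    (hJd : ∀ z x y t, (realDeriv a μ A z (μ x y) t + μ (realDeriv a μ A z x y) t)
      + (realDeriv a μ A z (μ y t) x + μ (realDeriv a μ A z y t) x)
      + (realDeriv a μ A z (μ t x) y + μ (realDeriv a μ A z t x) y) = 0) (x : E) :
    LinearMap.trace ℝ E (μ x) = 0 := by
  refine H.trace_iff.2 ?_ x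
  let Rc : h.Space → h.Space → h.Space →ₗ[ℂ] h.Space :=
    fun x y ↦ h.cxEnd (R (h.of.symm x) (h.of.symm y)) (hRJ _ _)
  have hRc : ∀ x y z, Rc (h.of x) (h.of y) (h.of z) = h.of (R x y z) := fun _ _ _ ↦ rfl
  refine trace_eq_zero_of_kahlerLike ha0 ha1 ha2 ha4 ha3 ha5 H.cμ_skew H.cN_neg H.cN_skew
    H.torsionBianchi (R := Rc) (fun x y ↦ ?_) (fun x y ↦ ?_) (fun x y ↦ ?_) (fun x y z ↦ ?_)
    (fun w z x y ↦ ?_) (fun z x y t ↦ ?_)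
  · ext z
    obtain ⟨x, rfl⟩ := h.of.surjective x
    obtain ⟨y, rfl⟩ := h.of.surjective y
    obtain ⟨z, rfl⟩ := h.of.surjective z
    rw [LinearMap.neg_apply, hRc, hRc, hRs, map_neg]
  · ext z
    obtain ⟨x, rfl⟩ := h.of.surjective x
    obtain ⟨y, rfl⟩ := h.of.surjective y
    obtain ⟨z, rfl⟩ := h.of.surjective z
    rw [LinearMap.neg_apply, ← map_neg, hRc, hRc, hRn, map_neg]
  · ext z
    obtain ⟨x, rfl⟩ := h.of.surjective x
    obtain ⟨y, rfl⟩ := h.of.surjective y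
    obtain ⟨z, rfl⟩ := h.of.surjective z
    rw [h.I_smul_of, h.I_smul_of, hRc, hRc, hRI]
  · obtain ⟨x, rfl⟩ := h.of.surjective x
    obtain ⟨y, rfl⟩ := h.of.surjective y
    obtain ⟨z, rfl⟩ := h.of.surjective z
    rw [hRc, hRc, hRc, ← map_add, ← map_add, hRB, map_zero]
  · obtain ⟨x, rfl⟩ := h.of.surjective x
    obtain ⟨y, rfl⟩ := h.of.surjective y
    obtain ⟨z, rfl⟩ := h.of.surjective z
    obtain ⟨w, rfl⟩ := h.of.surjective w
    simp only [torsionDerivDeriv_of, gTorsion_of, torsionDeriv_of, cμ_of, hRc, ← map_add, ← map_sub,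
      hRic]
  · obtain ⟨x, rfl⟩ := h.of.surjective x
    obtain ⟨y, rfl⟩ := h.of.surjective y
    obtain ⟨z, rfl⟩ := h.of.surjective z
    obtain ⟨t, rfl⟩ := h.of.surjective t
    simp only [torsionDeriv_of, cμ_of, ← map_add, hJd, map_zero]

end IsTorsionAt

end RealPointwise

/-! ### Kähler-like connections on an open subset of a vector space. -/

section Local

open Filter Topology

variable {E : Type*} [NormedAddCommGroup E] [NormedSpace ℝ E]

instance : NormedAddCommGroup (E →L[ℝ] E →L[ℝ] E) := inferInstance

instance : NormedSpace ℝ (E →L[ℝ] E →L[ℝ] E) := inferInstance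

theorem hasDerivAt_line {F : Type*} [NormedAddCommGroup F] [NormedSpace ℝ F] {f : E → F} {p : E}
    (hf : DifferentiableAt ℝ f p) (z : E) :
    HasDerivAt (fun t : ℝ ↦ f (p + t • z)) (fderiv ℝ f p z) 0 := by
  have h1 : HasDerivAt (fun t : ℝ ↦ p + t • z) z 0 := by
    simpa using ((hasDerivAt_id (0 : ℝ)).smul_const z).const_add p
  have h2 : HasFDerivAt f (fderiv ℝ f p) (p + (0 : ℝ) • z) := by simpa using hf.hasFDerivAt
  exact h2.comp_hasDerivAt 0 h1

theorem eventually_line {U : Set E} (hU : IsOpen U) {p : E} (hp : p ∈ U) (z : E) :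
    ∀ᶠ t : ℝ in 𝓝 0, p + t • z ∈ U := by
  have h : Continuous fun t : ℝ ↦ p + t • z := by fun_prop
  exact h.continuousAt.eventually_mem (hU.mem_nhds (by simpa using hp))

theorem hasDerivAt_eq_of_line {F : Type*} [NormedAddCommGroup F] [NormedSpace ℝ F] {f₁ f₂ : ℝ → F}
    {v₁ v₂ : F} {U : Set E} (hU : IsOpen U) {p : E} (hp : p ∈ U) (z : E)
    (h : ∀ t : ℝ, p + t • z ∈ U → f₁ t = f₂ t) (h₁ : HasDerivAt f₁ v₁ 0) (h₂ : HasDerivAt f₂ v₂ 0) :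
    v₁ = v₂ :=
  h₁.unique (h₂.congr_of_eventuallyEq ((eventually_line hU hp z).mono h))

/-- The curvature of the connection `d + Γ`. -/
def localCurvature (Γ : E → E →L[ℝ] E →L[ℝ] E) (p x y z : E) : E :=
  fderiv ℝ Γ p x y z - fderiv ℝ Γ p y x z + Γ p x (Γ p y z) - Γ p y (Γ p x z)

/-- The Chern torsion `μ` and the Christoffel symbols `Γ` of a Kähler-like Gauduchon connection
of parameter `2 * a` on an open subset of a vector space. -/
structure IsLocalKahlerLike (U : Set E) (a : ℝ) (g : E → E →L[ℝ] E →L[ℝ] ℝ) (J : E → E →L[ℝ] E)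
    (Γ μ A : E → E →L[ℝ] E →L[ℝ] E) : Prop where
  isOpen : IsOpen U
  contDiff_g : ContDiffOn ℝ ∞ g U
  contDiff_J : ContDiffOn ℝ ∞ J U
  contDiff_Γ : ContDiffOn ℝ ∞ Γ U
  contDiff_μ : ContDiffOn ℝ ∞ μ U
  contDiff_A : ContDiffOn ℝ ∞ A U
  J_sq : ∀ p ∈ U, ∀ x, J p (J p x) = -x
  g_symm : ∀ p ∈ U, ∀ x y, g p x y = g p y x
  g_pos : ∀ p ∈ U, ∀ x, x ≠ 0 → 0 < g p x x
  g_inv : ∀ p ∈ U, ∀ x y, g p (J p x) (J p y) = g p x y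
  skew : ∀ p ∈ U, ∀ x y, μ p x y = -μ p y x
  map_J : ∀ p ∈ U, ∀ x y, μ p (J p x) y = J p (μ p x y)
  adj : ∀ p ∈ U, ∀ x y z, g p (A p x y) z = g p y (μ p x z)
  metric : ∀ p ∈ U, ∀ z x y, fderiv ℝ g p z x y = g p (Γ p z x) y + g p x (Γ p z y)
  parallel : ∀ p ∈ U, ∀ z x, fderiv ℝ J p z x = J p (Γ p z x) - Γ p z (J p x)
  torsion : ∀ p ∈ U, ∀ x y,
    Γ p x y - Γ p y x = (1 - 2 * a) • μ p x y + a • (A p x y - A p y x)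
  curv_bianchi : ∀ p ∈ U, ∀ x y z,
    localCurvature Γ p x y z + localCurvature Γ p y z x + localCurvature Γ p z x y = 0
  curv_J : ∀ p ∈ U, ∀ x y z,
    localCurvature Γ p (J p x) (J p y) z = localCurvature Γ p x y z

/-- The covariant derivative of a bilinear map. -/
def covDeriv (Γ τ : E → E →L[ℝ] E →L[ℝ] E) (p z : E) : E →ₗ[ℝ] E →ₗ[ℝ] E :=
  LinearMap.mk₂ ℝ (fun x y ↦ fderiv ℝ τ p z x y + Γ p z (τ p x y) - τ p (Γ p z x) y
      - τ p x (Γ p z y))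
    (fun x y z ↦ by simp only [map_add, add_apply]; abel)
    (fun c x y ↦ by simp only [map_smul, smul_apply]; module)
    (fun x y z ↦ by simp only [map_add]; abel)
    (fun c x y ↦ by simp only [map_smul]; module)

theorem covDeriv_apply (Γ τ : E → E →L[ℝ] E →L[ℝ] E) (p z x y : E) :
    covDeriv Γ τ p z x y = fderiv ℝ τ p z x y + Γ p z (τ p x y) - τ p (Γ p z x) y
      - τ p x (Γ p z y) := rfl

/-- The bilinear map underlying a continuous bilinear map. -/
def bil (τ : E →L[ℝ] E →L[ℝ] E) : E →ₗ[ℝ] E →ₗ[ℝ] E := τ.toLinearMap₁₂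

@[simp] theorem bil_apply (τ : E →L[ℝ] E →L[ℝ] E) (x y : E) : bil τ x y = τ x y := rfl

theorem realDeriv_sub {a : ℝ} {μ A : E →ₗ[ℝ] E →ₗ[ℝ] E} (z w x y : E) :
    realDeriv a μ A (z - w) x y = realDeriv a μ A z x y - realDeriv a μ A w x y := by
  simp only [realDeriv, map_sub, LinearMap.sub_apply]
  module

/-- The Leibniz rule: the quadratic expression is built naturally from μ and A, so the connection
terms acting on the factors add up to those acting on the whole. -/
theorem realDerivDeriv_covDeriv (a : ℝ) (Γ μ A : E → E →L[ℝ] E →L[ℝ] E) (p w z x y : E) :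
    realDerivDeriv a (bil (μ p)) (bil (A p)) (covDeriv Γ μ p w) (covDeriv Γ A p w) z x y
      = realDerivDeriv a (bil (μ p)) (bil (A p)) (bil (fderiv ℝ μ p w)) (bil (fderiv ℝ A p w)) z x y
        + Γ p w (realDeriv a (bil (μ p)) (bil (A p)) z x y)
        - realDeriv a (bil (μ p)) (bil (A p)) (Γ p w z) x y
        - realDeriv a (bil (μ p)) (bil (A p)) z (Γ p w x) y
        - realDeriv a (bil (μ p)) (bil (A p)) z x (Γ p w y) := by
  simp only [realDerivDeriv, realDeriv, covDeriv_apply, bil_apply, map_add, map_sub, map_smul,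
    LinearMap.add_apply, LinearMap.sub_apply]
  module

theorem hasDerivAt_realDeriv {a : ℝ} {μ A : E → E →L[ℝ] E →L[ℝ] E} {p : E}
    (hμ : DifferentiableAt ℝ μ p) (hA : DifferentiableAt ℝ A p) (w z x y : E) :
    HasDerivAt (fun t : ℝ ↦ realDeriv a (bil (μ (p + t • w))) (bil (A (p + t • w))) z x y)
      (realDerivDeriv a (bil (μ p)) (bil (A p)) (bil (fderiv ℝ μ p w)) (bil (fderiv ℝ A p w)) z x y)
      0 := by
  have m := hasDerivAt_line hμ w
  have n := hasDerivAt_line hA w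
  have c : ∀ v : E, HasDerivAt (fun _ : ℝ ↦ v) 0 0 := fun v ↦ hasDerivAt_const 0 v
  have m2 : ∀ u v, HasDerivAt (fun t : ℝ ↦ μ (p + t • w) u v) (fderiv ℝ μ p w u v) 0 :=
    fun u v ↦ by simpa using (m.clm_apply (c u)).clm_apply (c v)
  have n2 : ∀ u v, HasDerivAt (fun t : ℝ ↦ A (p + t • w) u v) (fderiv ℝ A p w u v) 0 :=
    fun u v ↦ by simpa using (n.clm_apply (c u)).clm_apply (c v)
  have d1 := ((m.clm_apply (m2 x y)).clm_apply (c z)).const_smul (1 - a)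
  have d2 := ((((n.clm_apply (n2 y z)).clm_apply (c x)).sub
    ((n.clm_apply (n2 x z)).clm_apply (c y))).const_smul (-coeffA a)).add
    (((((m.clm_apply (c y)).clm_apply (n2 z x))).sub
      ((m.clm_apply (c x)).clm_apply (n2 z y))).const_smul (coeffB a))
  have d3 := ((n.clm_apply (c z)).clm_apply (m2 x y)).const_smul (coeffC a)
  refine (d1.add (d2.sub d3)).congr_deriv ?_
  simp only [realDerivDeriv, bil_apply, add_apply, zero_smul, add_zero, map_zero]

namespace IsLocalKahlerLike

variable {U : Set E} {a : ℝ} {g : E → E →L[ℝ] E →L[ℝ] ℝ} {J : E → E →L[ℝ] E}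
  {Γ μ A : E → E →L[ℝ] E →L[ℝ] E} (H : IsLocalKahlerLike U a g J Γ μ A) {p : E} (hp : p ∈ U)

/-- The Hermitian structure on the tangent space at `p`. -/
def herm : HermitianStructure E where
  J := J p
  g := (g p).toLinearMap₁₂
  sq := H.J_sq p hp
  symm := H.g_symm p hp
  pos := H.g_pos p hp
  inv := H.g_inv p hp

theorem herm_J (x : E) : (H.herm hp).J x = J p x := rfl

theorem herm_g (x y : E) : (H.herm hp).g x y = g p x y := rfl

theorem differentiableAt {F : Type*} [NormedAddCommGroup F] [NormedSpace ℝ F] {f : E → F}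
    (H : IsLocalKahlerLike U a g J Γ μ A) (hp : p ∈ U) (hf : ContDiffOn ℝ ∞ f U) :
    DifferentiableAt ℝ f p :=
  (hf.contDiffAt (H.isOpen.mem_nhds hp)).differentiableAt (by simp)

theorem deriv_torsion (H : IsLocalKahlerLike U a g J Γ μ A) (hp : p ∈ U) (z x y : E) :
    fderiv ℝ Γ p z x y - fderiv ℝ Γ p z y x
      = (1 - 2 * a) • fderiv ℝ μ p z x y + a • (fderiv ℝ A p z x y - fderiv ℝ A p z y x) := by
  have k := hasDerivAt_line (H.differentiableAt hp H.contDiff_Γ) z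
  have m := hasDerivAt_line (H.differentiableAt hp H.contDiff_μ) z
  have n := hasDerivAt_line (H.differentiableAt hp H.contDiff_A) z
  have c : ∀ v : E, HasDerivAt (fun _ : ℝ ↦ v) 0 0 := fun v ↦ hasDerivAt_const 0 v
  have e := hasDerivAt_eq_of_line H.isOpen hp z (fun t ht ↦ H.torsion _ ht x y)
    (((k.clm_apply (c x)).clm_apply (c y)).sub ((k.clm_apply (c y)).clm_apply (c x)))
    ((((m.clm_apply (c x)).clm_apply (c y)).const_smul (1 - 2 * a)).add
      ((((n.clm_apply (c x)).clm_apply (c y)).sub ((n.clm_apply (c y)).clm_apply (c x))).const_smul a))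
  simpa using e

theorem deriv_skew (H : IsLocalKahlerLike U a g J Γ μ A) (hp : p ∈ U) (z x y : E) :
    fderiv ℝ μ p z x y = -fderiv ℝ μ p z y x := by
  have m := hasDerivAt_line (H.differentiableAt hp H.contDiff_μ) z
  have c : ∀ v : E, HasDerivAt (fun _ : ℝ ↦ v) 0 0 := fun v ↦ hasDerivAt_const 0 v
  simpa using hasDerivAt_eq_of_line H.isOpen hp z (fun t ht ↦ H.skew _ ht x y)
    ((m.clm_apply (c x)).clm_apply (c y)) ((m.clm_apply (c y)).clm_apply (c x)).neg

theorem deriv_map_J (H : IsLocalKahlerLike U a g J Γ μ A) (hp : p ∈ U) (z x y : E) :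
    fderiv ℝ μ p z (J p x) y + μ p (fderiv ℝ J p z x) y
      = fderiv ℝ J p z (μ p x y) + J p (fderiv ℝ μ p z x y) := by
  have m := hasDerivAt_line (H.differentiableAt hp H.contDiff_μ) z
  have k := hasDerivAt_line (H.differentiableAt hp H.contDiff_J) z
  have c : ∀ v : E, HasDerivAt (fun _ : ℝ ↦ v) 0 0 := fun v ↦ hasDerivAt_const 0 v
  simpa using hasDerivAt_eq_of_line H.isOpen hp z (fun t ht ↦ H.map_J _ ht x y)
    ((m.clm_apply (k.clm_apply (c x))).clm_apply (c y))
    (k.clm_apply ((m.clm_apply (c x)).clm_apply (c y)))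

theorem deriv_adj (H : IsLocalKahlerLike U a g J Γ μ A) (hp : p ∈ U) (z x y w : E) :
    fderiv ℝ g p z (A p x y) w + g p (fderiv ℝ A p z x y) w
      = fderiv ℝ g p z y (μ p x w) + g p y (fderiv ℝ μ p z x w) := by
  have m := hasDerivAt_line (H.differentiableAt hp H.contDiff_μ) z
  have n := hasDerivAt_line (H.differentiableAt hp H.contDiff_A) z
  have k := hasDerivAt_line (H.differentiableAt hp H.contDiff_g) z
  have c : ∀ v : E, HasDerivAt (fun _ : ℝ ↦ v) 0 0 := fun v ↦ hasDerivAt_const 0 v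
  simpa using hasDerivAt_eq_of_line H.isOpen hp z (fun t ht ↦ H.adj _ ht x y w)
    ((k.clm_apply ((n.clm_apply (c x)).clm_apply (c y))).clm_apply (c w))
    ((k.clm_apply (c y)).clm_apply ((m.clm_apply (c x)).clm_apply (c w)))

/-- Since g and J are parallel, covariant differentiation preserves adjointness and complex
bilinearity. The Bianchi identity is the vanishing cyclic sum of the curvature, with the skew parts
of Γ and of its derivative replaced by the torsion and its derivative. -/
theorem isTorsionAt : IsTorsionAt (H.herm hp) a (bil (μ p)) (bil (A p)) (covDeriv Γ μ p)
    (covDeriv Γ A p) where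
  skew := H.skew p hp
  map_J := H.map_J p hp
  adj := H.adj p hp
  deriv_neg z x y := by
    simp only [covDeriv_apply, map_neg, neg_apply]
    abel
  deriv_skew z x y := by
    rw [covDeriv_apply, covDeriv_apply, H.deriv_skew hp, H.skew p hp x y, H.skew p hp (Γ p z x),
      H.skew p hp x, map_neg]
    abel
  deriv_map_J z x y := by
    have e := H.deriv_map_J hp z x y
    rw [H.parallel p hp, H.parallel p hp, map_sub, sub_apply, H.map_J p hp] at e
    rw [herm_J, herm_J, covDeriv_apply, covDeriv_apply, H.map_J p hp, H.map_J p hp, map_sub, map_sub,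
      map_add]
    linear_combination (norm := module) (1 : ℝ) • e
  deriv_adj z x y w := by
    have e := H.deriv_adj hp z x y w
    rw [H.metric p hp, H.metric p hp, H.adj p hp] at e
    rw [herm_g, herm_g, covDeriv_apply, covDeriv_apply]
    simp only [map_add, map_sub, add_apply, sub_apply,
      H.adj p hp]
    linear_combination e
  bianchi x y z := by
    have hT : ∀ x y, realTorsion a (bil (μ p)) (bil (A p)) x y = Γ p x y - Γ p y x :=
      fun x y ↦ (H.torsion p hp x y).symm
    have hdT : ∀ z x y, realTorsion a (covDeriv Γ μ p z) (covDeriv Γ A p z) x y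
        = fderiv ℝ Γ p z x y - fderiv ℝ Γ p z y x + Γ p z (Γ p x y - Γ p y x)
          - (Γ p (Γ p z x) y - Γ p y (Γ p z x)) - (Γ p x (Γ p z y) - Γ p (Γ p z y) x) := by
      intro z x y
      rw [H.deriv_torsion hp, H.torsion p hp, H.torsion p hp, H.torsion p hp, realTorsion]
      simp only [covDeriv_apply, map_add, map_sub, map_smul]
      module
    have e := H.curv_bianchi p hp x y z
    simp only [localCurvature] at e
    rw [hT x y, hT y z, hT z x, hT, hT, hT, hdT, hdT, hdT]
    simp only [map_sub, sub_apply]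
    linear_combination (norm := module) (1 : ℝ) • e

end IsLocalKahlerLike

end Local

/-! ### Symmetry of second derivatives, and vanishing of the torsion. -/

section LocalVanishing

open Filter Topology

variable {E : Type*} [NormedAddCommGroup E] [NormedSpace ℝ E] [FiniteDimensional ℝ E]

theorem localCurvature_skew (Γ : E → E →L[ℝ] E →L[ℝ] E) (p x y z : E) :
    localCurvature Γ p x y z = -localCurvature Γ p y x z := by
  simp only [localCurvature]
  abel

/-- The curvature as an endomorphism. -/
def localCurvatureEnd (Γ : E → E →L[ℝ] E →L[ℝ] E) (p x y : E) : E →ₗ[ℝ] E where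
  toFun z := localCurvature Γ p x y z
  map_add' z w := by
    simp only [localCurvature, map_add]
    abel
  map_smul' c z := by
    simp only [localCurvature, map_smul, RingHom.id_apply]
    module

theorem fderiv_fderiv_comm {F : Type*} [NormedAddCommGroup F] [NormedSpace ℝ F] {f : E → F}
    {p : E} (hf : ContDiffAt ℝ ∞ f p) (w z : E) :
    fderiv ℝ (fderiv ℝ f) p w z = fderiv ℝ (fderiv ℝ f) p z w :=
  (hf.isSymmSndFDerivAt (by
    rw [minSmoothness_of_isRCLikeNormedField]
    exact WithTop.coe_le_coe.2 le_top)) w z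

theorem differentiableAt_fderiv {F : Type*} [NormedAddCommGroup F] [NormedSpace ℝ F] {f : E → F}
    {p : E} (hf : ContDiffAt ℝ ∞ f p) : DifferentiableAt ℝ (fderiv ℝ f) p :=
  (hf.fderiv_right (m := 1) (WithTop.coe_le_coe.2 le_top)).differentiableAt (by simp)

namespace IsLocalKahlerLike

variable {U : Set E} {a : ℝ} {g : E → E →L[ℝ] E →L[ℝ] ℝ} {J : E → E →L[ℝ] E}
  {Γ μ A : E → E →L[ℝ] E →L[ℝ] E} {p : E}

theorem deriv_parallel (H : IsLocalKahlerLike U a g J Γ μ A) (hp : p ∈ U) (w z x : E) :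
    fderiv ℝ (fderiv ℝ J) p w z x = fderiv ℝ J p w (Γ p z x) + J p (fderiv ℝ Γ p w z x)
      - (fderiv ℝ Γ p w z (J p x) + Γ p z (fderiv ℝ J p w x)) := by
  have k := hasDerivAt_line (H.differentiableAt hp H.contDiff_Γ) w
  have j := hasDerivAt_line (H.differentiableAt hp H.contDiff_J) w
  have d := hasDerivAt_line
    (differentiableAt_fderiv (H.contDiff_J.contDiffAt (H.isOpen.mem_nhds hp))) w
  have c : ∀ v : E, HasDerivAt (fun _ : ℝ ↦ v) 0 0 := fun v ↦ hasDerivAt_const 0 v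
  have e := hasDerivAt_eq_of_line H.isOpen hp w (fun t ht ↦ H.parallel _ ht z x)
    ((d.clm_apply (c z)).clm_apply (c x))
    ((j.clm_apply ((k.clm_apply (c z)).clm_apply (c x))).sub
      ((k.clm_apply (c z)).clm_apply (j.clm_apply (c x))))
  simpa using e

/-- The integrability condition of ∇J = 0, from the symmetry of the second derivative of J. -/
theorem localCurvature_map_J (H : IsLocalKahlerLike U a g J Γ μ A) (hp : p ∈ U) (x y z : E) :
    localCurvature Γ p x y (J p z) = J p (localCurvature Γ p x y z) := by
  have e := congrArg (fun f ↦ f z)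
    (fderiv_fderiv_comm (H.contDiff_J.contDiffAt (H.isOpen.mem_nhds hp)) x y)
  rw [H.deriv_parallel hp, H.deriv_parallel hp] at e
  simp only [H.parallel p hp, map_sub] at e
  simp only [localCurvature, map_sub, map_add]
  linear_combination (norm := module) (-1 : ℝ) • e

theorem fderiv_μ_eq (H : IsLocalKahlerLike U a g J Γ μ A) (ha0 : a ≠ 0) (ha2 : a ≠ 1 / 2)
    (ha4 : a ≠ 1 / 4) (hp : p ∈ U) (z x y : E) :
    fderiv ℝ μ p z x y = realDeriv a (bil (μ p)) (bil (A p)) z x y - Γ p z (μ p x y)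
      + μ p (Γ p z x) y + μ p x (Γ p z y) := by
  rw [← (H.isTorsionAt hp).deriv_eq ha0 ha2 ha4, covDeriv_apply]
  abel

set_option synthInstance.maxHeartbeats 200000 in
theorem fderiv_fderiv_μ (H : IsLocalKahlerLike U a g J Γ μ A) (ha0 : a ≠ 0) (ha2 : a ≠ 1 / 2)
    (ha4 : a ≠ 1 / 4) (hp : p ∈ U) (w z x y : E) :
    fderiv ℝ (fderiv ℝ μ) p w z x y
      = realDerivDeriv a (bil (μ p)) (bil (A p)) (bil (fderiv ℝ μ p w)) (bil (fderiv ℝ A p w)) z x y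
        - (fderiv ℝ Γ p w z (μ p x y) + Γ p z (fderiv ℝ μ p w x y))
        + (fderiv ℝ μ p w (Γ p z x) y + μ p (fderiv ℝ Γ p w z x) y)
        + (fderiv ℝ μ p w x (Γ p z y) + μ p x (fderiv ℝ Γ p w z y)) := by
  have k := hasDerivAt_line (H.differentiableAt hp H.contDiff_Γ) w
  have m := hasDerivAt_line (H.differentiableAt hp H.contDiff_μ) w
  have d := hasDerivAt_line
    (differentiableAt_fderiv (H.contDiff_μ.contDiffAt (H.isOpen.mem_nhds hp))) w
  have r := hasDerivAt_realDeriv (a := a) (H.differentiableAt hp H.contDiff_μ)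
    (H.differentiableAt hp H.contDiff_A) w z x y
  have c : ∀ v : E, HasDerivAt (fun _ : ℝ ↦ v) 0 0 := fun v ↦ hasDerivAt_const 0 v
  have e := hasDerivAt_eq_of_line H.isOpen hp w
    (fun t ht ↦ H.fderiv_μ_eq ha0 ha2 ha4 ht z x y)
    (((d.clm_apply (c z)).clm_apply (c x)).clm_apply (c y))
    (((r.sub ((k.clm_apply (c z)).clm_apply ((m.clm_apply (c x)).clm_apply (c y)))).add
      ((m.clm_apply ((k.clm_apply (c z)).clm_apply (c x))).clm_apply (c y))).add
      ((m.clm_apply (c x)).clm_apply ((k.clm_apply (c z)).clm_apply (c y))))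
  simpa using e

/-- The formula for the covariant derivative of μ holds on all of U and can be differentiated again;
the symmetry of the second derivative of μ then becomes the Ricci identity. -/
theorem ricci (H : IsLocalKahlerLike U a g J Γ μ A) (ha0 : a ≠ 0) (ha2 : a ≠ 1 / 2)
    (ha4 : a ≠ 1 / 4) (hp : p ∈ U) (w z x y : E) :
    realDerivDeriv a (bil (μ p)) (bil (A p)) (covDeriv Γ μ p w) (covDeriv Γ A p w) z x y
      - realDerivDeriv a (bil (μ p)) (bil (A p)) (covDeriv Γ μ p z) (covDeriv Γ A p z) w x y
      + realDeriv a (bil (μ p)) (bil (A p)) (realTorsion a (bil (μ p)) (bil (A p)) w z) x y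
      = localCurvature Γ p w z (μ p x y) - μ p (localCurvature Γ p w z x) y
        - μ p x (localCurvature Γ p w z y) := by
  have hT : realTorsion a (bil (μ p)) (bil (A p)) w z = Γ p w z - Γ p z w :=
    (H.torsion p hp w z).symm
  have e := congrArg (fun f ↦ f x y)
    (fderiv_fderiv_comm (H.contDiff_μ.contDiffAt (H.isOpen.mem_nhds hp)) w z)
  rw [H.fderiv_fderiv_μ ha0 ha2 ha4 hp, H.fderiv_fderiv_μ ha0 ha2 ha4 hp] at e
  rw [hT, realDeriv_sub, realDerivDeriv_covDeriv, realDerivDeriv_covDeriv]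
  generalize realDerivDeriv a (bil (μ p)) (bil (A p)) (bil (fderiv ℝ μ p w))
    (bil (fderiv ℝ A p w)) z x y = D₁ at *
  generalize realDerivDeriv a (bil (μ p)) (bil (A p)) (bil (fderiv ℝ μ p z))
    (bil (fderiv ℝ A p z)) w x y = D₂ at *
  simp only [H.fderiv_μ_eq ha0 ha2 ha4 hp, map_add, map_sub] at e
  simp only [localCurvature, map_add, map_sub, add_apply, sub_apply]
  linear_combination (norm := module) (1 : ℝ) • e

theorem jacobi_deriv (H : IsLocalKahlerLike U a g J Γ μ A) (ha0 : a ≠ 0) (ha2 : a ≠ 1 / 2)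
    (ha4 : a ≠ 1 / 4) (hp : p ∈ U) (z x y t : E) :
    (realDeriv a (bil (μ p)) (bil (A p)) z (μ p x y) t
        + μ p (realDeriv a (bil (μ p)) (bil (A p)) z x y) t)
      + (realDeriv a (bil (μ p)) (bil (A p)) z (μ p y t) x
        + μ p (realDeriv a (bil (μ p)) (bil (A p)) z y t) x)
      + (realDeriv a (bil (μ p)) (bil (A p)) z (μ p t x) y
        + μ p (realDeriv a (bil (μ p)) (bil (A p)) z t x) y) = 0 := by
  have m := hasDerivAt_line (H.differentiableAt hp H.contDiff_μ) z
  have c : ∀ v : E, HasDerivAt (fun _ : ℝ ↦ v) 0 0 := fun v ↦ hasDerivAt_const 0 v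
  have m3 := fun x y t ↦
    (m.clm_apply ((m.clm_apply (c x)).clm_apply (c y))).clm_apply (c t)
  have hJ : ∀ q ∈ U, ∀ x y t, μ q (μ q x y) t + μ q (μ q y t) x + μ q (μ q t x) y = 0 :=
    fun q hq ↦ (H.isTorsionAt hq).jacobi ha0 ha2
  have e := hasDerivAt_eq_of_line H.isOpen hp z (fun s hs ↦ hJ _ hs x y t)
    (((m3 x y t).add (m3 y t x)).add (m3 t x y)) (c 0)
  simp only [zero_smul, add_zero, map_zero, add_apply, H.fderiv_μ_eq ha0 ha2 ha4 hp, map_add,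
    map_sub, sub_apply] at e
  have e0 := congrArg (Γ p z) (hJ p hp x y t)
  have e1 := hJ p hp (Γ p z x) y t
  have e2 := hJ p hp x (Γ p z y) t
  have e3 := hJ p hp x y (Γ p z t)
  simp only [map_add, map_zero] at e0
  linear_combination (norm := module) (1 : ℝ) • e + (1 : ℝ) • e0 - (1 : ℝ) • e1 - (1 : ℝ) • e2
    - (1 : ℝ) • e3

theorem trace_eq_zero (H : IsLocalKahlerLike U a g J Γ μ A) (ha0 : a ≠ 0) (ha1 : a ≠ 1)
    (ha4 : a ≠ 1 / 4) (ha3 : a ≠ 1 / 3) (ha5 : a ≠ 2 / 5) (hp : p ∈ U) (x : E) :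
    LinearMap.trace ℝ E (bil (μ p) x) = 0 := by
  by_cases ha2 : a = 1 / 2
  · exact (H.isTorsionAt hp).trace_eq_zero_of_half ha2 x
  refine (H.isTorsionAt hp).trace_eq_zero ha0 ha1 ha2 ha4 ha3 ha5
    (R := localCurvatureEnd Γ p) (fun x y z ↦ H.localCurvature_map_J hp x y z)
    (fun x y z ↦ localCurvature_skew Γ p x y z) (fun x y z ↦ ?_) (H.curv_J p hp)
    (H.curv_bianchi p hp) (H.ricci ha0 ha2 ha4 hp) (H.jacobi_deriv ha0 ha2 ha4 hp) x
  change localCurvature Γ p (-x) y z = -localCurvature Γ p x y z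
  simp only [localCurvature, map_neg, neg_apply]
  abel

/-- The trace must vanish on the whole open set, not just at p. The connection terms contribute a
commutator, which is traceless, and the trace of μ in another direction. -/
theorem trace_deriv_eq_zero (H : IsLocalKahlerLike U a g J Γ μ A)
    (ht : ∀ q ∈ U, ∀ x, LinearMap.trace ℝ E (bil (μ q) x) = 0) (hp : p ∈ U) (z x : E) :
    LinearMap.trace ℝ E (covDeriv Γ μ p z x) = 0 := by
  let T : (E →L[ℝ] E) →L[ℝ] ℝ :=
    LinearMap.toContinuousLinearMap (LinearMap.trace ℝ E ∘ₗ ContinuousLinearMap.coeLM ℝ)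
  have m := hasDerivAt_line (H.differentiableAt hp H.contDiff_μ) z
  have c : ∀ v : E, HasDerivAt (fun _ : ℝ ↦ v) 0 0 := fun v ↦ hasDerivAt_const 0 v
  have e := hasDerivAt_eq_of_line H.isOpen hp z (f₂ := fun _ ↦ (0 : ℝ)) (fun s hs ↦ ht _ hs x)
    (T.hasFDerivAt.comp_hasDerivAt 0 (m.clm_apply (c x))) (hasDerivAt_const 0 0)
  have e₀ : T (fderiv ℝ μ p z x) = 0 := by simpa using e
  have e' : LinearMap.trace ℝ E (bil (fderiv ℝ μ p z) x) = 0 := e₀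
  have hd : covDeriv Γ μ p z x = bil (fderiv ℝ μ p z) x
      + ((Γ p z : E →ₗ[ℝ] E) * bil (μ p) x - bil (μ p) x * (Γ p z : E →ₗ[ℝ] E))
      - bil (μ p) (Γ p z x) := by
    ext y
    change covDeriv Γ μ p z x y = fderiv ℝ μ p z x y + (Γ p z (μ p x y) - μ p x (Γ p z y))
      - μ p (Γ p z x) y
    rw [covDeriv_apply]
    abel
  rw [hd, map_sub, map_add, map_sub, e', ht p hp, LinearMap.trace_mul_comm]
  simp

/-- The Chern torsion of a Kähler-like Gauduchon connection of generic parameter vanishes. -/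
theorem torsion_eq_zero (H : IsLocalKahlerLike U a g J Γ μ A) (ha0 : a ≠ 0) (ha1 : a ≠ 1)
    (ha3 : a ≠ 1 / 3) (ha5 : a ≠ 2 / 5) (hp : p ∈ U) : μ p = 0 := by
  have key : bil (μ p) = 0 := by
    by_cases ha4 : a = 1 / 4
    · exact (H.isTorsionAt hp).eq_zero_of_quarter ha4
    · exact (H.isTorsionAt hp).eq_zero_of_trace ha0
        (fun x ↦ H.trace_eq_zero ha0 ha1 ha4 ha3 ha5 hp x)
        (H.trace_deriv_eq_zero (fun q hq ↦ H.trace_eq_zero ha0 ha1 ha4 ha3 ha5 hq) hp)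
  ext x y
  exact LinearMap.congr_fun₂ key x y

end IsLocalKahlerLike

end LocalVanishing

/-! ### Smoothness of the Chern and Bismut connections, and their difference. -/

section Christoffel

variable {E : Type*} [NormedAddCommGroup E] [NormedSpace ℝ E]

instance : NormedAddCommGroup (E →L[ℝ] E →L[ℝ] ℝ) := ContinuousLinearMap.toNormedAddCommGroup

instance : NormedSpace ℝ (E →L[ℝ] E →L[ℝ] ℝ) := ContinuousLinearMap.toNormedSpace

instance : NormedAddCommGroup ((E →L[ℝ] ℝ) →L[ℝ] E) := ContinuousLinearMap.toNormedAddCommGroup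

instance : NormedSpace ℝ ((E →L[ℝ] ℝ) →L[ℝ] E) := ContinuousLinearMap.toNormedSpace

/-- A trilinear form skew in its last two arguments and of type `(1,1)` in them vanishes if its
skew-symmetrization in the first two arguments is totally skew. -/
theorem eq_zero_of_skew_torsion {J : E → E} (hJ : ∀ x, J (J x) = -x) {D : E → E → E → ℝ}
    (hneg : ∀ x y z, D x (-y) z = -D x y z) (hskew : ∀ x y z, D x y z = -D x z y)
    (hJJ : ∀ x y z, D x (J y) (J z) = D x y z)
    (ht : ∀ x y z, D x y z - D y x z = -(D x z y - D z x y)) (x y z : E) : D x y z = 0 := by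
  have hsk (x y z : E) : D x y z = -D y x z := by
    linarith [ht x y z, ht y z x, ht z x y, hskew x y z, hskew y z x, hskew z x y]
  have h₁₂ (x y z : E) : D (J x) (J y) z = D x y z := by
    linarith [hskew (J x) (J y) z, hsk (J x) z (J y), hskew x y z, hsk x z y, hJJ z x y]
  have h₁₃ (x y z : E) : D (J x) y (J z) = D x y z := by
    linarith [hsk (J x) y (J z), hsk x y z, hJJ y x z]
  -- A totally skew form invariant under J in every pair of slots: moving J around the three slots
  -- changes the sign of its value.
  have e := h₁₂ x (J y) (J z)
  rw [hJ, hneg, h₁₃, hJJ] at e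
  linarith

/-- A Hermitian structure on an open set of a vector space. -/
structure IsLocalHermitian (U : Set E) (g : E → E →L[ℝ] E →L[ℝ] ℝ) (J : E → E →L[ℝ] E) : Prop where
  isOpen : IsOpen U
  contDiff_g : ContDiffOn ℝ ∞ g U
  contDiff_J : ContDiffOn ℝ ∞ J U
  J_sq : ∀ p ∈ U, ∀ x, J p (J p x) = -x
  g_symm : ∀ p ∈ U, ∀ x y, g p x y = g p y x
  g_pos : ∀ p ∈ U, ∀ x, x ≠ 0 → 0 < g p x x
  g_inv : ∀ p ∈ U, ∀ x y, g p (J p x) (J p y) = g p x y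

/-- The connection with Christoffel symbol `Γ` is Hermitian. -/
structure IsLocalHermitianConnection (U : Set E) (g : E → E →L[ℝ] E →L[ℝ] ℝ) (J : E → E →L[ℝ] E)
    (Γ : E → E →L[ℝ] E →L[ℝ] E) : Prop where
  metric : ∀ p ∈ U, ∀ z x y, fderiv ℝ g p z x y = g p (Γ p z x) y + g p x (Γ p z y)
  parallel : ∀ p ∈ U, ∀ z x, fderiv ℝ J p z x = J p (Γ p z x) - Γ p z (J p x)

/-- The torsion of the connection with Christoffel symbol `Γ`. -/
def localTorsion (Γ : E → E →L[ℝ] E →L[ℝ] E) (p : E) : E →L[ℝ] E →L[ℝ] E := Γ p - (Γ p).flip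

@[simp] theorem localTorsion_apply (Γ : E → E →L[ℝ] E →L[ℝ] E) (p x y : E) :
    localTorsion Γ p x y = Γ p x y - Γ p y x := rfl

variable {U : Set E} {g : E → E →L[ℝ] E →L[ℝ] ℝ} {J : E → E →L[ℝ] E} {Γ Γc Γb : E → E →L[ℝ] E →L[ℝ] E}
  {p : E}

namespace IsLocalHermitian

theorem g_J (H : IsLocalHermitian U g J) (hp : p ∈ U) (x y : E) :
    g p (J p x) y = -g p x (J p y) := by
  rw [← H.g_inv p hp x, H.J_sq p hp, map_neg, neg_neg]

theorem ext_inner (H : IsLocalHermitian U g J) (hp : p ∈ U) {x y : E}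
    (h : ∀ z, g p x z = g p y z) : x = y := by
  by_contra hne
  have := H.g_pos p hp (x - y) (sub_ne_zero.2 hne)
  rw [map_sub (g p), sub_apply, h] at this
  simp at this

/-- The Kähler form. -/
def form (g : E → E →L[ℝ] E →L[ℝ] ℝ) (J : E → E →L[ℝ] E) (p : E) : E →L[ℝ] E →L[ℝ] ℝ :=
  (g p).comp (J p)

theorem contDiff_form (H : IsLocalHermitian U g J) : ContDiffOn ℝ ∞ (form g J) U :=
  H.contDiff_g.clm_comp H.contDiff_J

/-- The exterior derivative of the Kähler form. -/
def dForm (g : E → E →L[ℝ] E →L[ℝ] ℝ) (J : E → E →L[ℝ] E) (p x y z : E) : ℝ :=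
  fderiv ℝ (form g J) p x y z + fderiv ℝ (form g J) p y z x + fderiv ℝ (form g J) p z x y

theorem contDiff_fderiv {F : Type*} [NormedAddCommGroup F] [NormedSpace ℝ F] {f : E → F}
    (hU : IsOpen U) (hf : ContDiffOn ℝ ∞ f U) : ContDiffOn ℝ ∞ (fderiv ℝ f) U :=
  hf.fderiv_of_isOpen hU (by simp)

theorem contDiff_dForm (H : IsLocalHermitian U g J) {X Y Z : E → E} (hX : ContDiffOn ℝ ∞ X U)
    (hY : ContDiffOn ℝ ∞ Y U) (hZ : ContDiffOn ℝ ∞ Z U) :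
    ContDiffOn ℝ ∞ (fun p ↦ dForm g J p (X p) (Y p) (Z p)) U := by
  have h := contDiff_fderiv H.isOpen H.contDiff_form
  exact ((((h.clm_apply hX).clm_apply hY).clm_apply hZ).add
    (((h.clm_apply hY).clm_apply hZ).clm_apply hX)).add
    (((h.clm_apply hZ).clm_apply hX).clm_apply hY)

theorem differentiableAt {F : Type*} [NormedAddCommGroup F] [NormedSpace ℝ F] {f : E → F}
    (hU : IsOpen U) (hf : ContDiffOn ℝ ∞ f U) (hp : p ∈ U) : DifferentiableAt ℝ f p :=
  (hf.contDiffAt (hU.mem_nhds hp)).differentiableAt (by simp)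

theorem fderiv_form (H : IsLocalHermitian U g J) (hΓ : IsLocalHermitianConnection U g J Γ)
    (hp : p ∈ U) (z x y : E) :
    fderiv ℝ (form g J) p z x y = g p (J p (Γ p z x)) y + g p (J p x) (Γ p z y) := by
  have e : fderiv ℝ (form g J) p = _ :=
    ((differentiableAt H.isOpen H.contDiff_g hp).hasFDerivAt.clm_comp
      (differentiableAt H.isOpen H.contDiff_J hp).hasFDerivAt).fderiv
  rw [e]
  simp only [add_apply, ContinuousLinearMap.comp_apply, ContinuousLinearMap.flip_apply,
    ContinuousLinearMap.compL_apply, hΓ.metric p hp, hΓ.parallel p hp, map_sub, sub_apply]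
  ring

/-- For a Hermitian connection dω is a cyclic sum of torsion terms. Complex bilinearity of the
torsion lets two values of dω isolate a single term. Thus the Chern torsion depends only on g and J,
and is smooth. -/
theorem two_mul_inner_torsion (H : IsLocalHermitian U g J)
    (hΓ : IsLocalHermitianConnection U g J Γ)
    (hJ : ∀ p ∈ U, ∀ x y, localTorsion Γ p (J p x) y = J p (localTorsion Γ p x y)) (hp : p ∈ U)
    (x y z : E) :
    2 * g p (localTorsion Γ p x y) z
      = dForm g J p x y (J p z) - dForm g J p (J p x) (J p y) (J p z) := by
  have hd (x y z : E) : dForm g J p x y z = g p (J p (localTorsion Γ p x y)) z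
      + g p (J p (localTorsion Γ p y z)) x + g p (J p (localTorsion Γ p z x)) y := by
    simp only [dForm, H.fderiv_form hΓ hp, localTorsion_apply, map_sub, sub_apply, H.g_J hp]
    rw [H.g_symm p hp x, H.g_symm p hp y, H.g_symm p hp z, H.g_J hp, H.g_J hp, H.g_J hp]
    ring
  have hs (x y : E) : localTorsion Γ p x y = -localTorsion Γ p y x := by simp
  have hJ' (x y : E) : localTorsion Γ p x (J p y) = J p (localTorsion Γ p x y) := by
    rw [hs, hJ p hp, hs x y, map_neg]
  rw [hd, hd]
  simp only [hJ p hp, hJ', H.J_sq p hp, H.g_inv p hp, map_neg, neg_apply]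
  ring

theorem two_mul_inner_christoffel (H : IsLocalHermitian U g J)
    (hΓ : IsLocalHermitianConnection U g J Γ) (hp : p ∈ U) (x y z : E) :
    2 * g p (Γ p x y) z = fderiv ℝ g p x y z + fderiv ℝ g p y x z - fderiv ℝ g p z x y
      + g p (localTorsion Γ p x y) z - g p (localTorsion Γ p x z) y
      - g p (localTorsion Γ p y z) x := by
  simp only [hΓ.metric p hp, localTorsion_apply, map_sub, sub_apply]
  rw [H.g_symm p hp (Γ p x z), H.g_symm p hp (Γ p y z), H.g_symm p hp (Γ p z x),
    H.g_symm p hp (Γ p z y)]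
  ring

variable [FiniteDimensional ℝ E]

/-- The metric is an isomorphism onto the dual at each point, and inversion of operators is smooth.
-/
theorem contDiff_of_inner (H : IsLocalHermitian U g J) {F : E → E →L[ℝ] E →L[ℝ] E}
    (hF : ∀ x y z, ContDiffOn ℝ ∞ (fun p ↦ g p (F p x y) z) U) : ContDiffOn ℝ ∞ F U := by
  have : CompleteSpace E := FiniteDimensional.complete ℝ E
  refine contDiffOn_clm_apply.2 fun x ↦ contDiffOn_clm_apply.2 fun y ↦ fun p hp ↦ ?_
  have hinv (q : E) (hq : q ∈ U) : ∃ e : E ≃L[ℝ] (E →L[ℝ] ℝ), (e : E →L[ℝ] E →L[ℝ] ℝ) = g q := by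
    let l : E →ₗ[ℝ] (E →L[ℝ] ℝ) := g q
    have hl : Function.Injective l := fun x y h ↦ H.ext_inner hq fun z ↦ congrArg (fun f ↦ f z) h
    have hd : Module.finrank ℝ E = Module.finrank ℝ (E →L[ℝ] ℝ) := by
      rw [← (LinearMap.toContinuousLinearMap : (E →ₗ[ℝ] ℝ) ≃ₗ[ℝ] _).finrank_eq]
      exact (Subspace.dual_finrank_eq (K := ℝ) (V := E)).symm
    refine ⟨(LinearEquiv.ofInjectiveOfFinrankEq l hl hd).toContinuousLinearEquiv, ?_⟩
    ext u v
    rfl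
  obtain ⟨e, he⟩ := hinv p hp
  have hg := (H.contDiff_g p hp)
  have h₁ : ContDiffWithinAt ℝ ∞ (fun q ↦ g q (F q x y)) U p :=
    contDiffOn_clm_apply.2 (fun z ↦ hF x y z) p hp
  have h₂ : ContDiffWithinAt ℝ ∞ (fun q ↦ ContinuousLinearMap.inverse (g q)) U p := by
    have h₃ : ContDiffAt ℝ ∞ (ContinuousLinearMap.inverse (R := ℝ) (M := E) (M₂ := E →L[ℝ] ℝ))
        (g p) := by
      rw [← he]
      exact contDiffAt_map_inverse e
    exact h₃.comp_contDiffWithinAt p hg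
  refine (h₂.clm_apply h₁).congr_of_mem (fun q hq ↦ ?_) hp
  obtain ⟨e', he'⟩ := hinv q hq
  rw [← he', ContinuousLinearMap.inverse_equiv]
  simp

theorem contDiff_torsion (H : IsLocalHermitian U g J) (hΓ : IsLocalHermitianConnection U g J Γ)
    (hJ : ∀ p ∈ U, ∀ x y, localTorsion Γ p (J p x) y = J p (localTorsion Γ p x y)) :
    ContDiffOn ℝ ∞ (localTorsion Γ) U := by
  refine H.contDiff_of_inner fun x y z ↦ ?_
  have c : ∀ v : E, ContDiffOn ℝ ∞ (fun p ↦ J p v) U := fun v ↦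
    H.contDiff_J.clm_apply contDiffOn_const
  have h := ((H.contDiff_dForm (contDiffOn_const (c := x)) (contDiffOn_const (c := y)) (c z)).sub
    (H.contDiff_dForm (c x) (c y) (c z))).const_smul (1 / 2 : ℝ)
  refine h.congr fun p hp ↦ ?_
  have := H.two_mul_inner_torsion hΓ hJ hp x y z
  simp only [smul_eq_mul]
  linarith

theorem contDiff_christoffel (H : IsLocalHermitian U g J)
    (hΓ : IsLocalHermitianConnection U g J Γ) (hT : ContDiffOn ℝ ∞ (localTorsion Γ) U) :
    ContDiffOn ℝ ∞ Γ U := by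
  refine H.contDiff_of_inner fun x y z ↦ ?_
  have hd := contDiff_fderiv H.isOpen H.contDiff_g
  have c : ∀ v : E, ContDiffOn ℝ ∞ (fun _ : E ↦ v) U := fun v ↦ contDiffOn_const
  have d (u v w : E) := ((hd.clm_apply (c u)).clm_apply (c v)).clm_apply (c w)
  have t (u v w : E) :=
    (H.contDiff_g.clm_apply ((hT.clm_apply (c u)).clm_apply (c v))).clm_apply (c w)
  refine (((((((d x y z).add (d y x z)).sub (d z x y)).add (t x y z)).sub (t x z y)).sub
    (t y z x)).const_smul (1 / 2 : ℝ)).congr fun p hp ↦ ?_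
  have := H.two_mul_inner_christoffel hΓ hp x y z
  simp only [smul_eq_mul]
  linarith

/-- The Bismut connection differs from the Chern connection by `A - μ`, where `μ` is the Chern
torsion and `A` its metric adjoint. -/
theorem inner_bismut_sub_chern (H : IsLocalHermitian U g J)
    (hc : IsLocalHermitianConnection U g J Γc) (hb : IsLocalHermitianConnection U g J Γb)
    (hJ : ∀ p ∈ U, ∀ x y, localTorsion Γc p (J p x) y = J p (localTorsion Γc p x y))
    (hB : ∀ p ∈ U, ∀ x y z, g p (localTorsion Γb p x y) z = -g p (localTorsion Γb p x z) y)
    (hp : p ∈ U) (x y z : E) :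
    g p (Γb p x y - Γc p x y + localTorsion Γc p x y) z = g p y (localTorsion Γc p x z) := by
  let D : E → E → E → ℝ := fun x y z ↦ g p (Γb p x y) z - g p (Γc p x y) z
    + g p (localTorsion Γc p x y) z - g p (localTorsion Γc p x z) y
  have hs (x y : E) : localTorsion Γc p x y = -localTorsion Γc p y x := by simp
  have hJ' (x y : E) : localTorsion Γc p x (J p y) = J p (localTorsion Γc p x y) := by
    rw [hs, hJ p hp, hs x y, map_neg]
  have hpar (x y : E) : Γb p x (J p y) - Γc p x (J p y) = J p (Γb p x y) - J p (Γc p x y) := by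
    linear_combination (norm := module)
      (1 : ℝ) • (hc.parallel p hp x y).symm.trans (hb.parallel p hp x y)
  have hmet (x y z : E) : g p (Γb p x y) z - g p (Γc p x y) z
      = -(g p (Γb p x z) y - g p (Γc p x z) y) := by
    have e := (hb.metric p hp x y z).symm.trans (hc.metric p hp x y z)
    rw [H.g_symm p hp y, H.g_symm p hp y] at e
    linarith
  have h0 : D x y z = 0 := by
    refine eq_zero_of_skew_torsion (J := J p) (H.J_sq p hp) (D := D) ?_ ?_ ?_ ?_ x y z
    · intro x y z
      simp only [D, map_neg, neg_apply]
      ring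
    · intro x y z
      simp only [D]
      linarith [hmet x y z]
    · intro x y z
      have e : g p (Γb p x (J p y)) (J p z) - g p (Γc p x (J p y)) (J p z)
          = g p (Γb p x y) z - g p (Γc p x y) z := by
        rw [← sub_apply, ← map_sub, hpar, map_sub, sub_apply, H.g_inv p hp, H.g_inv p hp]
      simp only [D, hJ', H.g_inv p hp]
      linarith
    · intro x y z
      have e := hB p hp x y z
      simp only [D, localTorsion_apply, map_sub, sub_apply] at e ⊢
      linarith [hmet x y z, hmet y x z, hmet z x y]
  rw [H.g_symm p hp y, map_add, map_sub, add_apply, sub_apply]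
  simp only [D] at h0
  linarith

theorem contDiff_bismut_sub_chern_add_torsion (H : IsLocalHermitian U g J)
    (hc : IsLocalHermitianConnection U g J Γc) (hb : IsLocalHermitianConnection U g J Γb)
    (hJ : ∀ p ∈ U, ∀ x y, localTorsion Γc p (J p x) y = J p (localTorsion Γc p x y))
    (hB : ∀ p ∈ U, ∀ x y z, g p (localTorsion Γb p x y) z = -g p (localTorsion Γb p x z) y) :
    ContDiffOn ℝ ∞ (fun p ↦ Γb p - Γc p + localTorsion Γc p) U := by
  refine H.contDiff_of_inner fun x y z ↦ ?_
  refine ((H.contDiff_g.clm_apply (contDiffOn_const (c := y))).clm_apply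
    (((H.contDiff_torsion hc hJ).clm_apply (contDiffOn_const (c := x))).clm_apply
      (contDiffOn_const (c := z)))).congr fun p hp ↦ ?_
  exact H.inner_bismut_sub_chern hc hb hJ hB hp x y z

/-- The connections are given with no smoothness; it comes from the Koszul formula with smooth
torsion for Γc and from the explicit difference for Γb. -/
theorem contDiff_gauduchon (H : IsLocalHermitian U g J)
    (hc : IsLocalHermitianConnection U g J Γc) (hb : IsLocalHermitianConnection U g J Γb)
    (hJ : ∀ p ∈ U, ∀ x y, localTorsion Γc p (J p x) y = J p (localTorsion Γc p x y))
    (hB : ∀ p ∈ U, ∀ x y z, g p (localTorsion Γb p x y) z = -g p (localTorsion Γb p x z) y)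
    {a : ℝ} (hΓ : ∀ p ∈ U, Γ p = (1 - a) • Γc p + a • Γb p) : ContDiffOn ℝ ∞ Γ U := by
  have hT := H.contDiff_torsion hc hJ
  refine ((H.contDiff_christoffel hc hT).add
    (((H.contDiff_bismut_sub_chern_add_torsion hc hb hJ hB).sub hT).const_smul a)).congr
    fun p hp ↦ ?_
  rw [hΓ p hp]
  module

theorem isLocalKahlerLike (H : IsLocalHermitian U g J)
    (hc : IsLocalHermitianConnection U g J Γc) (hb : IsLocalHermitianConnection U g J Γb)
    (hJ : ∀ p ∈ U, ∀ x y, localTorsion Γc p (J p x) y = J p (localTorsion Γc p x y))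
    (hB : ∀ p ∈ U, ∀ x y z, g p (localTorsion Γb p x y) z = -g p (localTorsion Γb p x z) y)
    {a : ℝ} (hΓ : ∀ p ∈ U, Γ p = (1 - a) • Γc p + a • Γb p)
    (hcyc : ∀ p ∈ U, ∀ x y z,
      localCurvature Γ p x y z + localCurvature Γ p y z x + localCurvature Γ p z x y = 0)
    (hcJ : ∀ p ∈ U, ∀ x y z,
      localCurvature Γ p (J p x) (J p y) z = localCurvature Γ p x y z) :
    IsLocalKahlerLike U a g J Γ (localTorsion Γc) (fun p ↦ Γb p - Γc p + localTorsion Γc p) where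
  isOpen := H.isOpen
  contDiff_g := H.contDiff_g
  contDiff_J := H.contDiff_J
  contDiff_Γ := H.contDiff_gauduchon hc hb hJ hB hΓ
  contDiff_μ := H.contDiff_torsion hc hJ
  contDiff_A := H.contDiff_bismut_sub_chern_add_torsion hc hb hJ hB
  J_sq := H.J_sq
  g_symm := H.g_symm
  g_pos := H.g_pos
  g_inv := H.g_inv
  skew p _ x y := by simp
  map_J := hJ
  adj p hp x y z := H.inner_bismut_sub_chern hc hb hJ hB hp x y z
  metric p hp z x y := by
    have e₁ := hc.metric p hp z x y
    have e₂ := hb.metric p hp z x y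
    simp only [hΓ p hp, add_apply, smul_apply, map_add, map_smul, smul_eq_mul]
    linear_combination (1 - a) * e₁ + a * e₂
  parallel p hp z x := by
    have e₁ := hc.parallel p hp z x
    have e₂ := hb.parallel p hp z x
    simp only [hΓ p hp, add_apply, smul_apply, map_add, map_smul]
    linear_combination (norm := module) (1 - a) • e₁ + a • e₂
  torsion p hp x y := by
    simp only [hΓ p hp, add_apply, smul_apply, sub_apply, localTorsion_apply]
    module
  curv_bianchi := hcyc
  curv_J := hcJ

end IsLocalHermitian

end Christoffel

/-! ### Vector fields and brackets in a chart. -/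

section Chart

open Filter Topology

variable {E : Type*} [NormedAddCommGroup E] [NormedSpace ℝ E] [FiniteDimensional ℝ E]
  [CompleteSpace E]
  {M : Type*} [TopologicalSpace M] [ChartedSpace E M] [IsManifold 𝓘(ℝ, E) ∞ M]
  {c x : M}

/-- The derivative at `x` of the chart at `c`. -/
def chartD (c x : M) : TangentSpace 𝓘(ℝ, E) x →L[ℝ] E :=
  mfderiv 𝓘(ℝ, E) 𝓘(ℝ, E) (extChartAt 𝓘(ℝ, E) c) x

/-- The inverse of the derivative at `x` of the chart at `c`. -/
def chartI (c x : M) : E →L[ℝ] TangentSpace 𝓘(ℝ, E) x :=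
  (mfderiv 𝓘(ℝ, E) 𝓘(ℝ, E) (extChartAt 𝓘(ℝ, E) c) x).inverse

/-- The vector field on the manifold with given expression in the chart at `c`. -/
def chartField (c : M) (Y : E → E) : Π x : M, TangentSpace 𝓘(ℝ, E) x :=
  fun x ↦ chartI c x (Y (extChartAt 𝓘(ℝ, E) c x))

theorem chartI_chartD (hx : x ∈ (extChartAt 𝓘(ℝ, E) c).source) (v : TangentSpace 𝓘(ℝ, E) x) :
    chartI c x (chartD c x v) = v :=
  (isInvertible_mfderiv_extChartAt hx).inverse_apply_self v

theorem chartD_chartI (hx : x ∈ (extChartAt 𝓘(ℝ, E) c).source) (v : E) :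
    chartD c x (chartI c x v) = v :=
  (isInvertible_mfderiv_extChartAt hx).self_apply_inverse v

theorem contMDiffAt_chart (hx : x ∈ (extChartAt 𝓘(ℝ, E) c).source) :
    ContMDiffAt 𝓘(ℝ, E) 𝓘(ℝ, E) ∞ (extChartAt 𝓘(ℝ, E) c) x :=
  contMDiffAt_extChartAt' (by rwa [extChartAt_source] at hx)

theorem contMDiffAt_chart_symm {p : E} (hp : p ∈ (extChartAt 𝓘(ℝ, E) c).target) :
    ContMDiffAt 𝓘(ℝ, E) 𝓘(ℝ, E) ∞ (extChartAt 𝓘(ℝ, E) c).symm p :=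
  (contMDiffOn_extChartAt_symm c).contMDiffAt
    ((isOpen_extChartAt_target (I := 𝓘(ℝ, E)) c).mem_nhds hp)

theorem smoothFieldAt_chartField {Y : E → E} (hx : x ∈ (extChartAt 𝓘(ℝ, E) c).source)
    (hY : ContDiffAt ℝ ∞ Y (extChartAt 𝓘(ℝ, E) c x)) : SmoothFieldAt (chartField c Y) x :=
  ContMDiffAt.mpullback_vectorField_preimage (n := ∞)
    (contMDiffAt_vectorSpace_iff_contDiffAt.2 hY) (contMDiffAt_chart hx)
    (isInvertible_mfderiv_extChartAt hx) (by simp)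

theorem mdifferentiableAt_of_smoothFieldAt {X : Π x : M, TangentSpace 𝓘(ℝ, E) x}
    (hX : SmoothFieldAt X x) : MDiffAt (T% X) x :=
  ContMDiffAt.mdifferentiableAt hX (by simp)

theorem smoothFieldAt_contMDiffAt_chartD {X : Π x : M, TangentSpace 𝓘(ℝ, E) x}
    (hx : x ∈ (extChartAt 𝓘(ℝ, E) c).source) (hX : SmoothFieldAt X x) :
    ContMDiffAt 𝓘(ℝ, E) 𝓘(ℝ, E) ∞ (fun y ↦ chartD c y (X y)) x := by
  rw [extChartAt_source] at hx
  have h := ((trivializationAt E (TangentSpace 𝓘(ℝ, E)) c).contMDiffAt_section_iff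
    (by simpa using hx)).1 hX
  refine h.congr_of_eventuallyEq ?_
  filter_upwards [(chartAt E c).open_source.mem_nhds hx] with y hy
  rw [chartD, ← TangentBundle.continuousLinearMapAt_trivializationAt hy]
  exact ((trivializationAt E (TangentSpace 𝓘(ℝ, E)) c).continuousLinearMapAt_apply_of_mem ℝ
    (by simpa using hy) _)

theorem contDiffAt_comp_symm {F : Type*} [NormedAddCommGroup F] [NormedSpace ℝ F] {f : M → F}
    {p : E} (hp : p ∈ (extChartAt 𝓘(ℝ, E) c).target)
    (hf : ContMDiffAt 𝓘(ℝ, E) 𝓘(ℝ, F) ∞ f ((extChartAt 𝓘(ℝ, E) c).symm p)) :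
    ContDiffAt ℝ ∞ (fun q ↦ f ((extChartAt 𝓘(ℝ, E) c).symm q)) p :=
  (hf.comp p (contMDiffAt_chart_symm hp)).contDiffAt

/-- The derivative of a function given by its chart expression. -/
theorem mvfderiv_comp_chart {f : M → ℝ} {F : E → ℝ} (hx : x ∈ (extChartAt 𝓘(ℝ, E) c).source)
    (hf : ∀ y ∈ (extChartAt 𝓘(ℝ, E) c).source, f y = F (extChartAt 𝓘(ℝ, E) c y))
    (hF : DifferentiableAt ℝ F (extChartAt 𝓘(ℝ, E) c x)) (v : TangentSpace 𝓘(ℝ, E) x) :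
    d% f x v = fderiv ℝ F (extChartAt 𝓘(ℝ, E) c x) (chartD c x v) := by
  have h : f =ᶠ[𝓝 x] F ∘ extChartAt 𝓘(ℝ, E) c := by
    filter_upwards [(isOpen_extChartAt_source (I := 𝓘(ℝ, E)) c).mem_nhds hx] with y hy
    exact hf y hy
  have e : mfderiv 𝓘(ℝ, E) 𝓘(ℝ, ℝ) f x = (fderiv ℝ F (extChartAt 𝓘(ℝ, E) c x)).comp (chartD c x) := by
    rw [h.mfderiv_eq, mfderiv_comp x hF.mdifferentiableAt
      ((contMDiffAt_chart hx).mdifferentiableAt (by simp)), mfderiv_eq_fderiv]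
    rfl
  change mfderiv 𝓘(ℝ, E) 𝓘(ℝ, ℝ) f x v = _
  rw [e]
  rfl

theorem mlieBracket_eq_lieBracket (X Y : Π x : E, TangentSpace 𝓘(ℝ, E) x) :
    mlieBracket 𝓘(ℝ, E) X Y = lieBracket ℝ X Y := by
  rw [← mlieBracketWithin_univ, mlieBracketWithin_eq_lieBracketWithin]
  exact lieBracketWithin_univ

theorem mlieBracket_chartField {X Y : E → E} (hx : x ∈ (extChartAt 𝓘(ℝ, E) c).source)
    (hX : ContDiffAt ℝ ∞ X (extChartAt 𝓘(ℝ, E) c x))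
    (hY : ContDiffAt ℝ ∞ Y (extChartAt 𝓘(ℝ, E) c x)) :
    mlieBracket 𝓘(ℝ, E) (chartField c X) (chartField c Y) x
      = chartI c x (fderiv ℝ Y (extChartAt 𝓘(ℝ, E) c x) (X (extChartAt 𝓘(ℝ, E) c x))
        - fderiv ℝ X (extChartAt 𝓘(ℝ, E) c x) (Y (extChartAt 𝓘(ℝ, E) c x))) := by
  have : IsManifold 𝓘(ℝ, E) (minSmoothness ℝ 2) M :=
    IsManifold.of_le (n := ∞) (by
      rw [minSmoothness_of_isRCLikeNormedField]
      exact WithTop.coe_le_coe.2 le_top)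
  have h := mpullback_mlieBracket (I := 𝓘(ℝ, E)) (I' := 𝓘(ℝ, E)) (n := ∞)
    ((contMDiffAt_vectorSpace_iff_contDiffAt.2 hX).mdifferentiableAt (by simp))
    ((contMDiffAt_vectorSpace_iff_contDiffAt.2 hY).mdifferentiableAt (by simp))
    (contMDiffAt_chart hx) (by
      rw [minSmoothness_of_isRCLikeNormedField]
      exact WithTop.coe_le_coe.2 le_top)
  have e : mlieBracket 𝓘(ℝ, E) X Y = lieBracket ℝ X Y := mlieBracket_eq_lieBracket X Y
  rw [e] at h
  exact h.symm

end Chart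

/-! ### The metric, the complex structure and connections in a chart. -/

section ChartTensor

open Filter Topology

variable {E : Type*} [NormedAddCommGroup E] [NormedSpace ℝ E] [FiniteDimensional ℝ E]
  [CompleteSpace E]
  {M : Type*} [TopologicalSpace M] [ChartedSpace E M] [IsManifold 𝓘(ℝ, E) ∞ M]
  {c x : M}

/-- The Christoffel symbol of a connection in the chart at `c`. -/
def christoffel (D : CovariantDerivative 𝓘(ℝ, E) E (fun x : M ↦ TangentSpace 𝓘(ℝ, E) x)) (c : M)
    (p : E) : E →L[ℝ] E →L[ℝ] E :=
  (∑ i, ((Module.finBasis ℝ E).coord i).toContinuousLinearMap.smulRight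
    ((chartD c ((extChartAt 𝓘(ℝ, E) c).symm p)).comp
      ((D (chartField c fun _ ↦ Module.finBasis ℝ E i) ((extChartAt 𝓘(ℝ, E) c).symm p)).comp
        (chartI c ((extChartAt 𝓘(ℝ, E) c).symm p))))).flip

/-- The complex structure in the chart at `c`. -/
def chartJ (J : ComplexStructure E M) (c : M) (p : E) : E →L[ℝ] E :=
  (chartD c ((extChartAt 𝓘(ℝ, E) c).symm p)).comp
    ((J.toFun ((extChartAt 𝓘(ℝ, E) c).symm p)).comp (chartI c ((extChartAt 𝓘(ℝ, E) c).symm p)))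

/-- The metric in the chart at `c`. -/
def chartMetric (g : ContMDiffRiemannianMetric 𝓘(ℝ, E) ∞ E (fun x : M ↦ TangentSpace 𝓘(ℝ, E) x))
    (c : M) (p : E) : E →L[ℝ] E →L[ℝ] ℝ :=
  ContinuousLinearMap.bilinearComp (E := E) (F := E) (E' := E) (F' := E)
    (g.inner ((extChartAt 𝓘(ℝ, E) c).symm p)) (chartI c ((extChartAt 𝓘(ℝ, E) c).symm p))
    (chartI c ((extChartAt 𝓘(ℝ, E) c).symm p))

variable {D : CovariantDerivative 𝓘(ℝ, E) E (fun x : M ↦ TangentSpace 𝓘(ℝ, E) x)}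
  {J : ComplexStructure E M}
  {g : ContMDiffRiemannianMetric 𝓘(ℝ, E) ∞ E (fun x : M ↦ TangentSpace 𝓘(ℝ, E) x)}

theorem christoffel_chart (hx : x ∈ (extChartAt 𝓘(ℝ, E) c).source) (v w : E) :
    christoffel D c (extChartAt 𝓘(ℝ, E) c x) v w
      = ∑ i, (Module.finBasis ℝ E).repr w i •
        chartD c x (D (chartField c fun _ ↦ Module.finBasis ℝ E i) x (chartI c x v)) := by
  have e : christoffel D c (extChartAt 𝓘(ℝ, E) c x) v w
      = (fun y ↦ ∑ i, (Module.finBasis ℝ E).repr w i •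
        chartD c y (D (chartField c fun _ ↦ Module.finBasis ℝ E i) y (chartI c y v)))
        ((extChartAt 𝓘(ℝ, E) c).symm (extChartAt 𝓘(ℝ, E) c x)) := by
    simp only [christoffel, ContinuousLinearMap.flip_apply, sum_apply]
    rfl
  rw [e, (extChartAt 𝓘(ℝ, E) c).left_inv hx]

theorem chartMetric_chart (hx : x ∈ (extChartAt 𝓘(ℝ, E) c).source) (v w : E) :
    chartMetric g c (extChartAt 𝓘(ℝ, E) c x) v w = g.inner x (chartI c x v) (chartI c x w) := by
  have e : chartMetric g c (extChartAt 𝓘(ℝ, E) c x) v w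
      = (fun y ↦ g.inner y (chartI c y v) (chartI c y w))
        ((extChartAt 𝓘(ℝ, E) c).symm (extChartAt 𝓘(ℝ, E) c x)) := rfl
  rw [e, (extChartAt 𝓘(ℝ, E) c).left_inv hx]

theorem chartJ_chart (hx : x ∈ (extChartAt 𝓘(ℝ, E) c).source) (v : E) :
    chartJ J c (extChartAt 𝓘(ℝ, E) c x) v = chartD c x (J.toFun x (chartI c x v)) := by
  have e : chartJ J c (extChartAt 𝓘(ℝ, E) c x) v
      = (fun y ↦ chartD c y (J.toFun y (chartI c y v)))
        ((extChartAt 𝓘(ℝ, E) c).symm (extChartAt 𝓘(ℝ, E) c x)) := rfl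
  rw [e, (extChartAt 𝓘(ℝ, E) c).left_inv hx]

theorem chartI_chartJ (hx : x ∈ (extChartAt 𝓘(ℝ, E) c).source) (v : E) :
    chartI c x (chartJ J c (extChartAt 𝓘(ℝ, E) c x) v) = J.toFun x (chartI c x v) := by
  rw [chartJ_chart hx, chartI_chartD hx]

theorem chartI_injective (hx : x ∈ (extChartAt 𝓘(ℝ, E) c).source) :
    Function.Injective (chartI (E := E) c x) := fun v w h ↦ by
  rw [← chartD_chartI hx v, h, chartD_chartI hx]

theorem smoothFieldAt_const (hx : x ∈ (extChartAt 𝓘(ℝ, E) c).source) (v : E) :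
    SmoothFieldAt (chartField c fun _ ↦ v) x :=
  smoothFieldAt_chartField hx contDiffAt_const

theorem smoothFieldAt_congr {X Y : Π x : M, TangentSpace 𝓘(ℝ, E) x} (hX : SmoothFieldAt X x)
    (h : ∀ᶠ y in 𝓝 x, Y y = X y) : SmoothFieldAt Y x :=
  ContMDiffAt.congr_of_eventuallyEq hX (h.mono fun y hy ↦ by simp only [hy])

theorem smoothFieldAt_onField {X : Π x : M, TangentSpace 𝓘(ℝ, E) x} (hX : SmoothFieldAt X x) :
    SmoothFieldAt (J.onField X) x :=
  ContMDiffAt.clm_bundle_apply J.smooth.contMDiffAt hX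

theorem contMDiffAt_inner {X Y : Π x : M, TangentSpace 𝓘(ℝ, E) x} (hX : SmoothFieldAt X x)
    (hY : SmoothFieldAt Y x) :
    ContMDiffAt 𝓘(ℝ, E) 𝓘(ℝ, ℝ) ∞ (fun y ↦ g.inner y (X y) (Y y)) x := by
  have : ContMDiffAt 𝓘(ℝ, E) (𝓘(ℝ, E).prod 𝓘(ℝ)) ∞
      (fun m ↦ TotalSpace.mk' ℝ (E := Bundle.Trivial M ℝ) m (g.inner m (X m) (Y m))) x :=
    ContMDiffAt.clm_bundle_apply₂ (F₁ := E) (F₂ := E) g.contMDiff.contMDiffAt hX hY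
  simp only [contMDiffAt_totalSpace] at this
  exact this.2

theorem contDiffOn_chartMetric :
    ContDiffOn ℝ ∞ (chartMetric g c) (extChartAt 𝓘(ℝ, E) c).target := by
  refine contDiffOn_clm_apply.2 fun v ↦ contDiffOn_clm_apply.2 fun w ↦ fun p hp ↦ ?_
  have hx := (extChartAt 𝓘(ℝ, E) c).map_target hp
  have h := contDiffAt_comp_symm hp
    (contMDiffAt_inner (g := g) (smoothFieldAt_const hx v) (smoothFieldAt_const hx w))
  exact h.contDiffWithinAt

theorem contDiffOn_chartJ : ContDiffOn ℝ ∞ (chartJ J c) (extChartAt 𝓘(ℝ, E) c).target := by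
  refine contDiffOn_clm_apply.2 fun v ↦ fun p hp ↦ ?_
  have hx := (extChartAt 𝓘(ℝ, E) c).map_target hp
  exact (contDiffAt_comp_symm hp (smoothFieldAt_contMDiffAt_chartD hx
    (smoothFieldAt_onField (J := J) (smoothFieldAt_const hx v)))).contDiffWithinAt

/-- The covariant derivative in a chart. -/
theorem covariantDerivative_chartField {Y : E → E} (hx : x ∈ (extChartAt 𝓘(ℝ, E) c).source)
    (hY : ContDiffAt ℝ ∞ Y (extChartAt 𝓘(ℝ, E) c x)) (v : E) :
    D (chartField c Y) x (chartI c x v)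
      = chartI c x (fderiv ℝ Y (extChartAt 𝓘(ℝ, E) c x) v
        + christoffel D c (extChartAt 𝓘(ℝ, E) c x) v (Y (extChartAt 𝓘(ℝ, E) c x))) := by
  set b := Module.finBasis ℝ E with hb
  set p := extChartAt 𝓘(ℝ, E) c x with hp
  let f : Fin (Module.finrank ℝ E) → E → ℝ := fun i q ↦ b.repr (Y q) i
  have hf (i) : ContDiffAt ℝ ∞ (f i) p :=
    (b.coord i).toContinuousLinearMap.contDiff.contDiffAt.comp p hY
  have hdf (i) : fderiv ℝ (f i) p v = b.repr (fderiv ℝ Y p v) i := by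
    have e := ((b.coord i).toContinuousLinearMap.hasFDerivAt.comp p
      (hY.differentiableAt (by simp)).hasFDerivAt).fderiv
    exact congrArg (fun l : E →L[ℝ] ℝ ↦ l v) e
  have hterm (i) : ContDiffAt ℝ ∞ (fun q ↦ f i q • b i) p := (hf i).smul contDiffAt_const
  -- Y is expanded in the basis defining `christoffel`; additivity and the Leibniz rule are applied
  -- one basis vector at a time.
  have key (s : Finset (Fin (Module.finrank ℝ E))) :
      D (chartField c fun q ↦ ∑ i ∈ s, f i q • b i) x (chartI c x v)
        = ∑ i ∈ s, (f i p • D (chartField c fun _ ↦ b i) x (chartI c x v)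
          + fderiv ℝ (f i) p v • chartI c x (b i)) := by
    classical
    induction s using Finset.induction_on with
    | empty =>
      have e : (chartField c fun q ↦ ∑ i ∈ (∅ : Finset (Fin (Module.finrank ℝ E))), f i q • b i)
          = (0 : Π x : M, TangentSpace 𝓘(ℝ, E) x) := by
        funext y
        simp [chartField]
      rw [e, D.isCovariantDerivativeOn.zero (s := Set.univ)]
      simp
    | insert i s hi ih =>
      have e : (chartField c fun q ↦ ∑ i ∈ insert i s, f i q • b i)
          = ((fun y ↦ f i (extChartAt 𝓘(ℝ, E) c y)) • chartField c fun _ ↦ b i)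
            + chartField c fun q ↦ ∑ i ∈ s, f i q • b i := by
        funext y
        simp [chartField, Finset.sum_insert hi]
      have hi' : MDiffAt (T% (chartField c fun q ↦ f i q • b i)) x :=
        mdifferentiableAt_of_smoothFieldAt (smoothFieldAt_chartField hx (hterm i))
      have e' : (chartField c fun q ↦ f i q • b i)
          = (fun y ↦ f i (extChartAt 𝓘(ℝ, E) c y)) • chartField c fun _ ↦ b i := by
        funext y
        simp [chartField]
      rw [e'] at hi'
      have hs : MDiffAt (T% (chartField c fun q ↦ ∑ i ∈ s, f i q • b i)) x :=
        mdifferentiableAt_of_smoothFieldAt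
          (smoothFieldAt_chartField hx (ContDiffAt.sum fun i _ ↦ hterm i))
      have hm : MDiffAt (fun y ↦ f i (extChartAt 𝓘(ℝ, E) c y)) x :=
        (((hf i).contMDiffAt.comp x (contMDiffAt_chart hx)).mdifferentiableAt (by simp))
      rw [e, D.isCovariantDerivativeOnUniv.add hi' hs,
        D.isCovariantDerivativeOnUniv.leibniz
          (mdifferentiableAt_of_smoothFieldAt (smoothFieldAt_const hx (b i))) hm,
        Finset.sum_insert hi, add_apply, ih]
      congr 1
      rw [add_apply, smul_apply, ContinuousLinearMap.smulRight_apply,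
        mvfderiv_comp_chart (F := f i) hx (fun _ _ ↦ rfl) ((hf i).differentiableAt (by simp)),
        chartD_chartI hx]
      rfl
  have hsum : (fun q ↦ ∑ i, f i q • b i) = Y := funext fun q ↦ b.sum_repr (Y q)
  have h := key Finset.univ
  rw [hsum] at h
  rw [h, map_add, christoffel_chart hx, map_sum, Finset.sum_add_distrib, add_comm]
  congr 1
  · conv_rhs => rw [← b.sum_repr (fderiv ℝ Y p v), map_sum]
    exact Finset.sum_congr rfl fun i _ ↦ by rw [hdf, map_smul]
  · exact Finset.sum_congr rfl fun i _ ↦ by rw [map_smul, chartI_chartD hx]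

end ChartTensor

/-! ### Transfer of the local result to the manifold. -/

section Transfer

open Filter Topology

variable {E : Type*} [NormedAddCommGroup E] [NormedSpace ℝ E] [FiniteDimensional ℝ E]
  [CompleteSpace E]
  {M : Type*} [TopologicalSpace M] [ChartedSpace E M] [IsManifold 𝓘(ℝ, E) ∞ M]
  {c x : M}
  {D Dc Db : CovariantDerivative 𝓘(ℝ, E) E (fun x : M ↦ TangentSpace 𝓘(ℝ, E) x)}
  {J : ComplexStructure E M}
  {g : ContMDiffRiemannianMetric 𝓘(ℝ, E) ∞ E (fun x : M ↦ TangentSpace 𝓘(ℝ, E) x)}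

/-- Every point of the target of a chart is the image of a point of its source. -/
theorem forall_mem_target {P : E → Prop}
    (h : ∀ x ∈ (extChartAt 𝓘(ℝ, E) c).source, P (extChartAt 𝓘(ℝ, E) c x)) :
    ∀ p ∈ (extChartAt 𝓘(ℝ, E) c).target, P p := fun p hp ↦ by
  rw [← (extChartAt 𝓘(ℝ, E) c).right_inv hp]
  exact h _ ((extChartAt 𝓘(ℝ, E) c).map_target hp)

theorem target_mem_nhds (hx : x ∈ (extChartAt 𝓘(ℝ, E) c).source) :
    (extChartAt 𝓘(ℝ, E) c).target ∈ 𝓝 (extChartAt 𝓘(ℝ, E) c x) :=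
  (isOpen_extChartAt_target (I := 𝓘(ℝ, E)) c).mem_nhds ((extChartAt 𝓘(ℝ, E) c).map_source hx)

theorem covariantDerivative_eq_chartField {X : Π x : M, TangentSpace 𝓘(ℝ, E) x} {Y : E → E}
    (hx : x ∈ (extChartAt 𝓘(ℝ, E) c).source)
    (hY : ContDiffAt ℝ ∞ Y (extChartAt 𝓘(ℝ, E) c x))
    (h : ∀ y ∈ (extChartAt 𝓘(ℝ, E) c).source, X y = chartField c Y y) :
    D X x = D (chartField c Y) x := by
  have h' : ∀ᶠ y in 𝓝 x, X y = chartField c Y y := by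
    filter_upwards [(isOpen_extChartAt_source (I := 𝓘(ℝ, E)) c).mem_nhds hx] with y hy
    exact h y hy
  have hs := smoothFieldAt_chartField hx hY
  exact D.isCovariantDerivativeOnUniv.congr_of_eventuallyEq
    (mdifferentiableAt_of_smoothFieldAt (smoothFieldAt_congr hs h'))
    (mdifferentiableAt_of_smoothFieldAt hs) univ_mem h'

theorem covariantDerivative_const (hx : x ∈ (extChartAt 𝓘(ℝ, E) c).source) (v w : E) :
    D (chartField c fun _ ↦ w) x (chartI c x v)
      = chartI c x (christoffel D c (extChartAt 𝓘(ℝ, E) c x) v w) := by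
  rw [covariantDerivative_chartField hx contDiffAt_const]
  simp

theorem isLocalHermitian (hg : IsHermitianMetric J g) (c : M) :
    IsLocalHermitian (extChartAt 𝓘(ℝ, E) c).target (chartMetric g c) (chartJ J c) where
  isOpen := isOpen_extChartAt_target c
  contDiff_g := contDiffOn_chartMetric
  contDiff_J := contDiffOn_chartJ
  J_sq := forall_mem_target fun x hx v ↦ chartI_injective hx (by
    rw [chartI_chartJ hx, chartI_chartJ hx, J.sq_eq_neg, map_neg])
  g_symm := forall_mem_target fun x hx v w ↦ by
    rw [chartMetric_chart hx, chartMetric_chart hx, g.symm]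
  g_pos := forall_mem_target fun x hx v hv ↦ by
    rw [chartMetric_chart hx]
    exact g.pos x _ fun h ↦ hv (chartI_injective hx (by rw [h, map_zero]))
  g_inv := forall_mem_target fun x hx v w ↦ by
    rw [chartMetric_chart hx, chartMetric_chart hx, chartI_chartJ hx, chartI_chartJ hx, hg]

theorem onField_chartField {Y : E → E} (hx : x ∈ (extChartAt 𝓘(ℝ, E) c).source) :
    J.onField (chartField c Y) x = chartField c (fun p ↦ chartJ J c p (Y p)) x :=
  (chartI_chartJ hx _).symm

theorem isLocalHermitianConnection (hD : IsHermitianConnection J g D) (c : M) :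
    IsLocalHermitianConnection (extChartAt 𝓘(ℝ, E) c).target (chartMetric g c) (chartJ J c)
      (christoffel D c) where
  metric := forall_mem_target fun x hx z v w ↦ by
    have hd := (contDiffOn_chartMetric (g := g) (c := c)).contDiffAt (target_mem_nhds hx)
    have h := hD.metric x _ _ (chartI c x z)
      (mdifferentiableAt_of_smoothFieldAt (smoothFieldAt_const hx v))
      (mdifferentiableAt_of_smoothFieldAt (smoothFieldAt_const hx w))
    have hF : HasFDerivAt (fun p ↦ chartMetric g c p v w)
        (((ContinuousLinearMap.apply ℝ ℝ w).comp (ContinuousLinearMap.apply ℝ (E →L[ℝ] ℝ) v)).comp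
          (fderiv ℝ (chartMetric g c) (extChartAt 𝓘(ℝ, E) c x))) (extChartAt 𝓘(ℝ, E) c x) :=
      ((ContinuousLinearMap.apply ℝ ℝ w).comp
        (ContinuousLinearMap.apply ℝ (E →L[ℝ] ℝ) v)).hasFDerivAt.comp _
        (hd.differentiableAt (by simp)).hasFDerivAt
    rw [mvfderiv_comp_chart (f := fun y ↦ g.inner y (chartField c (fun _ ↦ v) y)
      (chartField c (fun _ ↦ w) y)) hx (fun y hy ↦ (chartMetric_chart hy v w).symm) hF.differentiableAt,
      hF.fderiv, chartD_chartI hx, covariantDerivative_const hx, covariantDerivative_const hx] at h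
    rw [chartMetric_chart hx, chartMetric_chart hx]
    exact h
  parallel := forall_mem_target fun x hx z v ↦ by
    have hd := (contDiffOn_chartJ (J := J) (c := c)).contDiffAt (target_mem_nhds hx)
    have hY : ContDiffAt ℝ ∞ (fun p ↦ chartJ J c p v) (extChartAt 𝓘(ℝ, E) c x) :=
      hd.clm_apply contDiffAt_const
    have h := hD.parallel x _ (chartI c x z)
      (mdifferentiableAt_of_smoothFieldAt (smoothFieldAt_const hx v))
    rw [covariantDerivative_eq_chartField hx hY fun y hy ↦ onField_chartField hy,
      covariantDerivative_chartField hx hY, covariantDerivative_const hx, ← chartI_chartJ hx] at h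
    have h' := chartI_injective hx h
    have e : fderiv ℝ (fun p ↦ chartJ J c p v) (extChartAt 𝓘(ℝ, E) c x) z
        = fderiv ℝ (chartJ J c) (extChartAt 𝓘(ℝ, E) c x) z v := by
      rw [fderiv_clm_apply (hd.differentiableAt (by simp)) (differentiableAt_const v)]
      simp
    rw [e] at h'
    exact eq_sub_of_add_eq h'

theorem torsion_chartI (hx : x ∈ (extChartAt 𝓘(ℝ, E) c).source) (v w : E) :
    D.torsion x (chartI c x v) (chartI c x w)
      = chartI c x (localTorsion (christoffel D c) (extChartAt 𝓘(ℝ, E) c x) v w) := by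
  have h := D.torsion_apply (mdifferentiableAt_of_smoothFieldAt (smoothFieldAt_const hx v))
    (mdifferentiableAt_of_smoothFieldAt (smoothFieldAt_const hx w))
  rw [mlieBracket_chartField hx contDiffAt_const contDiffAt_const] at h
  change D.torsion x (chartI c x v) (chartI c x w) = D _ x (chartI c x v) - D _ x (chartI c x w)
    - _ at h
  rw [h, covariantDerivative_const hx, covariantDerivative_const hx]
  simp

/-- The curvature in a chart. -/
theorem connCurvature_of_eq_chartField {X' Y' : Π x : M, TangentSpace 𝓘(ℝ, E) x} {X Y : E → E}
    (hx : x ∈ (extChartAt 𝓘(ℝ, E) c).source)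
    (hD : ContDiffOn ℝ ∞ (christoffel D c) (extChartAt 𝓘(ℝ, E) c).target)
    (hX : ContDiffAt ℝ ∞ X (extChartAt 𝓘(ℝ, E) c x))
    (hY : ContDiffAt ℝ ∞ Y (extChartAt 𝓘(ℝ, E) c x))
    (hX' : ∀ y ∈ (extChartAt 𝓘(ℝ, E) c).source, X' y = chartField c X y)
    (hY' : ∀ y ∈ (extChartAt 𝓘(ℝ, E) c).source, Y' y = chartField c Y y) (z : E) :
    connCurvature D X' Y' (chartField c fun _ ↦ z) x
      = chartI c x (localCurvature (christoffel D c) (extChartAt 𝓘(ℝ, E) c x)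
        (X (extChartAt 𝓘(ℝ, E) c x)) (Y (extChartAt 𝓘(ℝ, E) c x)) z) := by
  have hs := (isOpen_extChartAt_source (I := 𝓘(ℝ, E)) c).mem_nhds hx
  have hΓ := hD.contDiffAt (target_mem_nhds hx)
  have key {X' Y' : Π x : M, TangentSpace 𝓘(ℝ, E) x} {X Y : E → E}
      (hY : ContDiffAt ℝ ∞ Y (extChartAt 𝓘(ℝ, E) c x))
      (hX' : ∀ y ∈ (extChartAt 𝓘(ℝ, E) c).source, X' y = chartField c X y)
      (hY' : ∀ y ∈ (extChartAt 𝓘(ℝ, E) c).source, Y' y = chartField c Y y) :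
      D (fun y ↦ D (chartField c fun _ ↦ z) y (Y' y)) x (X' x)
        = chartI c x (fderiv ℝ (christoffel D c) (extChartAt 𝓘(ℝ, E) c x)
            (X (extChartAt 𝓘(ℝ, E) c x)) (Y (extChartAt 𝓘(ℝ, E) c x)) z
          + christoffel D c (extChartAt 𝓘(ℝ, E) c x) (fderiv ℝ Y (extChartAt 𝓘(ℝ, E) c x)
            (X (extChartAt 𝓘(ℝ, E) c x))) z
          + christoffel D c (extChartAt 𝓘(ℝ, E) c x) (X (extChartAt 𝓘(ℝ, E) c x))
            (christoffel D c (extChartAt 𝓘(ℝ, E) c x) (Y (extChartAt 𝓘(ℝ, E) c x)) z)) := by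
    have hZ : ContDiffAt ℝ ∞ (fun p ↦ christoffel D c p (Y p) z) (extChartAt 𝓘(ℝ, E) c x) :=
      (hΓ.clm_apply hY).clm_apply contDiffAt_const
    have e : fderiv ℝ (fun p ↦ christoffel D c p (Y p) z) (extChartAt 𝓘(ℝ, E) c x)
        (X (extChartAt 𝓘(ℝ, E) c x)) = fderiv ℝ (christoffel D c) (extChartAt 𝓘(ℝ, E) c x)
            (X (extChartAt 𝓘(ℝ, E) c x)) (Y (extChartAt 𝓘(ℝ, E) c x)) z
          + christoffel D c (extChartAt 𝓘(ℝ, E) c x) (fderiv ℝ Y (extChartAt 𝓘(ℝ, E) c x)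
            (X (extChartAt 𝓘(ℝ, E) c x))) z := by
      rw [fderiv_clm_apply ((hΓ.clm_apply hY).differentiableAt (by simp))
        (differentiableAt_const z), fderiv_clm_apply (hΓ.differentiableAt (by simp))
        (hY.differentiableAt (by simp))]
      simp only [fderiv_fun_const, Pi.zero_apply, ContinuousLinearMap.comp_zero, zero_add,
        ContinuousLinearMap.flip_apply, add_apply, ContinuousLinearMap.comp_apply]
      exact add_comm _ _
    have h₁ : D (fun y ↦ D (chartField c fun _ ↦ z) y (Y' y)) x
        = D (chartField c fun p ↦ christoffel D c p (Y p) z) x :=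
      covariantDerivative_eq_chartField hx hZ fun y hy ↦ by
        rw [hY' y hy]
        exact covariantDerivative_const hy _ z
    rw [h₁, hX' x hx]
    exact (covariantDerivative_chartField hx hZ _).trans (by rw [e])
  have hb : mlieBracket 𝓘(ℝ, E) X' Y' x
      = mlieBracket 𝓘(ℝ, E) (chartField c X) (chartField c Y) x :=
    Filter.EventuallyEq.mlieBracket_vectorField_eq (mem_of_superset hs hX')
      (mem_of_superset hs hY')
  -- The derivatives of the coefficients of X and Y cancel against the bracket term, which is the
  -- tensoriality of the curvature.
  rw [connCurvature, key hY hX' hY', key hX hY' hX', hb, mlieBracket_chartField hx hX hY,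
    covariantDerivative_const hx, ← map_sub, ← map_sub]
  congr 1
  simp only [localCurvature, map_sub, sub_apply]
  abel

/-- The Chern torsion is complex bilinear. -/
theorem chern_torsion_map_J (hc : IsChernConnection J g Dc) (x : M)
    (v w : TangentSpace 𝓘(ℝ, E) x) :
    Dc.torsion x (J.toFun x v) w = J.toFun x (Dc.torsion x v w) := by
  have hx := mem_extChartAt_source (I := 𝓘(ℝ, E)) x
  have o (v w : TangentSpace 𝓘(ℝ, E) x) : Dc.torsion x v (J.toFun x w) = Dc.torsion x (J.toFun x v) w := by
    have h := hc.torsion_one_one x v (J.toFun x w)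
    rw [J.sq_eq_neg, map_neg] at h
    exact add_neg_eq_zero.1 h
  -- The Nijenhuis tensor written through the torsion of a connection with J parallel. Its vanishing
  -- removes the (0,2)-part, while `o` expresses the absence of the (1,1)-part; what is left is
  -- complex bilinear.
  have N : Dc.torsion x v w - Dc.torsion x (J.toFun x v) (J.toFun x w)
      + J.toFun x (Dc.torsion x (J.toFun x v) w) + J.toFun x (Dc.torsion x v (J.toFun x w)) = 0 := by
    obtain ⟨v, rfl⟩ : ∃ v', chartI x x v' = v := ⟨_, chartI_chartD hx v⟩
    obtain ⟨w, rfl⟩ : ∃ v', chartI x x v' = w := ⟨_, chartI_chartD hx w⟩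
    let X := chartField x fun _ ↦ v
    let Y := chartField x fun _ ↦ w
    have sX : SmoothFieldAt X x := smoothFieldAt_const hx v
    have sY : SmoothFieldAt Y x := smoothFieldAt_const hx w
    have sJX := mdifferentiableAt_of_smoothFieldAt (smoothFieldAt_onField (J := J) sX)
    have sJY := mdifferentiableAt_of_smoothFieldAt (smoothFieldAt_onField (J := J) sY)
    have dX := mdifferentiableAt_of_smoothFieldAt sX
    have dY := mdifferentiableAt_of_smoothFieldAt sY
    have h : mlieBracket 𝓘(ℝ, E) (J.onField X) (J.onField Y) x
        - J.toFun x (mlieBracket 𝓘(ℝ, E) (J.onField X) Y x)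
        - J.toFun x (mlieBracket 𝓘(ℝ, E) X (J.onField Y) x)
        - mlieBracket 𝓘(ℝ, E) X Y x = 0 := J.integrable x _ _ sX sY
    have t₁ := Dc.torsion_apply sJX sJY
    have t₂ := Dc.torsion_apply sJX dY
    have t₃ := Dc.torsion_apply dX sJY
    have t₄ := Dc.torsion_apply dX dY
    simp only [fun u ↦ hc.hermitian.parallel x _ u dX, fun u ↦ hc.hermitian.parallel x _ u dY]
      at t₁ t₂ t₃
    replace t₂ := congrArg (J.toFun x) t₂
    replace t₃ := congrArg (J.toFun x) t₃
    simp only [map_sub, J.sq_eq_neg] at t₂ t₃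
    change Dc.torsion x (X x) (Y x) - Dc.torsion x (J.onField X x) (J.onField Y x)
      + J.toFun x (Dc.torsion x (J.onField X x) (Y x))
      + J.toFun x (Dc.torsion x (X x) (J.onField Y x)) = 0
    rw [t₁, t₂, t₃, t₄]
    linear_combination (norm := abel) h
  have h := hc.torsion_one_one x v w
  rw [o v w] at N
  have h2 : (2 : ℝ) • (Dc.torsion x v w + J.toFun x (Dc.torsion x (J.toFun x v) w)) = 0 := by
    linear_combination (norm := module) (1 : ℝ) • N + (1 : ℝ) • h
  have h3 := congrArg (J.toFun x) ((smul_eq_zero.1 h2).resolve_left two_ne_zero)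
  rw [map_add, J.sq_eq_neg, map_zero] at h3
  exact (add_neg_eq_zero.1 h3).symm

/-- The Chern torsion of a Hermitian manifold with Kähler-like Gauduchon connection vanishes. -/
theorem chern_torsion_eq_zero (hg : IsHermitianMetric J g) (hc : IsChernConnection J g Dc)
    (hb : IsBismutConnection J g Db) {a : ℝ}
    (hD : ∀ (x : M) (X : Π x : M, TangentSpace 𝓘(ℝ, E) x), MDiffAt (T% X) x →
      D X x = (1 - a) • Dc X x + a • Db X x)
    (hK : IsKahlerLike J D) (ha0 : a ≠ 0) (ha1 : a ≠ 1) (ha3 : a ≠ 1 / 3) (ha5 : a ≠ 2 / 5) (x : M)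
    (v w : TangentSpace 𝓘(ℝ, E) x) : Dc.torsion x v w = 0 := by
  have H := isLocalHermitian hg x
  have Hc := isLocalHermitianConnection hc.hermitian x
  have Hb := isLocalHermitianConnection hb.hermitian x
  have hJ : ∀ p ∈ (extChartAt 𝓘(ℝ, E) x).target, ∀ u v,
      localTorsion (christoffel Dc x) p (chartJ J x p u) v
        = chartJ J x p (localTorsion (christoffel Dc x) p u v) :=
    forall_mem_target fun y hy u v ↦ chartI_injective hy (by
      rw [← torsion_chartI hy, chartI_chartJ hy, chartI_chartJ hy, chern_torsion_map_J hc,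
        ← torsion_chartI hy])
  have hB : ∀ p ∈ (extChartAt 𝓘(ℝ, E) x).target, ∀ u v w,
      chartMetric g x p (localTorsion (christoffel Db x) p u v) w
        = -chartMetric g x p (localTorsion (christoffel Db x) p u w) v :=
    forall_mem_target fun y hy u v w ↦ by
      rw [chartMetric_chart hy, chartMetric_chart hy, ← torsion_chartI hy, ← torsion_chartI hy,
        hb.torsion_skew]
  have hΓ : ∀ p ∈ (extChartAt 𝓘(ℝ, E) x).target,
      christoffel D x p = (1 - a) • christoffel Dc x p + a • christoffel Db x p :=
    forall_mem_target fun y hy ↦ by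
      ext u v
      refine chartI_injective hy ?_
      rw [← covariantDerivative_const hy,
        hD y _ (mdifferentiableAt_of_smoothFieldAt (smoothFieldAt_const hy v)), add_apply,
        smul_apply, smul_apply, covariantDerivative_const hy, covariantDerivative_const hy,
        add_apply, smul_apply, add_apply, smul_apply, smul_apply, smul_apply, map_add, map_smul, map_smul]
  have hs := H.contDiff_gauduchon Hc Hb hJ hB hΓ
  have hR {y : M} (hy : y ∈ (extChartAt 𝓘(ℝ, E) x).source) (u v w : E) :=
    connCurvature_of_eq_chartField (X := fun _ ↦ u) (Y := fun _ ↦ v) hy hs contDiffAt_const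
      contDiffAt_const (fun _ _ ↦ rfl) (fun _ _ ↦ rfl) w
  have hcyc : ∀ p ∈ (extChartAt 𝓘(ℝ, E) x).target, ∀ u v w,
      localCurvature (christoffel D x) p u v w + localCurvature (christoffel D x) p v w u
        + localCurvature (christoffel D x) p w u v = 0 :=
    forall_mem_target fun y hy u v w ↦ chartI_injective hy (by
      rw [map_add, map_add, map_zero, ← hR hy, ← hR hy, ← hR hy]
      exact (hK y _ _ _ (smoothFieldAt_const hy u) (smoothFieldAt_const hy v)
        (smoothFieldAt_const hy w)).1)
  have hcJ : ∀ p ∈ (extChartAt 𝓘(ℝ, E) x).target, ∀ u v w,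
      localCurvature (christoffel D x) p (chartJ J x p u) (chartJ J x p v) w
        = localCurvature (christoffel D x) p u v w :=
    forall_mem_target fun y hy u v w ↦ chartI_injective hy (by
      have hd := (contDiffOn_chartJ (J := J) (c := x)).contDiffAt (target_mem_nhds hy)
      rw [← hR hy u v w, ← (hK y _ _ _ (smoothFieldAt_const hy u) (smoothFieldAt_const hy v)
        (smoothFieldAt_const hy w)).2]
      -- J applied to a constant chart field is neither constant nor, outside the chart source,
      -- known to be a chart field; hence the curvature formula for variable coefficients and
      -- equality on the source only.
      exact (connCurvature_of_eq_chartField hy hs (hd.clm_apply contDiffAt_const)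
        (hd.clm_apply contDiffAt_const) (fun _ h ↦ onField_chartField h)
        (fun _ h ↦ onField_chartField h) w).symm)
  have hx := mem_extChartAt_source (I := 𝓘(ℝ, E)) x
  have h0 := (H.isLocalKahlerLike Hc Hb hJ hB hΓ hcyc hcJ).torsion_eq_zero ha0 ha1 ha3 ha5
    ((extChartAt 𝓘(ℝ, E) x).map_source hx)
  rw [← chartI_chartD hx v, ← chartI_chartD hx w, torsion_chartI hx, h0]
  simp

/-- A Hermitian manifold with torsion-free Chern connection is Kähler. -/
theorem isKahler_of_torsion_eq_zero (hg : IsHermitianMetric J g) (hc : IsHermitianConnection J g Dc)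
    (hT : ∀ (x : M) (v w : TangentSpace 𝓘(ℝ, E) x), Dc.torsion x v w = 0) : IsKahler J g := by
  have hgJ (x : M) (v w : TangentSpace 𝓘(ℝ, E) x) :
      g.inner x (J.toFun x v) w = -g.inner x (J.toFun x w) v := by
    rw [← hg, J.sq_eq_neg, map_neg, neg_apply, g.symm]
  intro x X Y Z sX sY sZ
  have dX := mdifferentiableAt_of_smoothFieldAt sX
  have dY := mdifferentiableAt_of_smoothFieldAt sY
  have dZ := mdifferentiableAt_of_smoothFieldAt sZ
  have hd {X Y : Π x : M, TangentSpace 𝓘(ℝ, E) x} (sX : SmoothFieldAt X x) (dY : MDiffAt (T% Y) x)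
      (v : TangentSpace 𝓘(ℝ, E) x) : d% (fundamentalForm J g X Y) x v
        = g.inner x (J.toFun x (Dc X x v)) (Y x) - g.inner x (J.toFun x (Dc Y x v)) (X x) := by
    have h := hc.metric x (J.onField X) Y v
      (mdifferentiableAt_of_smoothFieldAt (smoothFieldAt_onField sX)) dY
    rw [hc.parallel x X v (mdifferentiableAt_of_smoothFieldAt sX)] at h
    rw [sub_eq_add_neg, ← hgJ]
    exact h
  have hbr {X Y : Π x : M, TangentSpace 𝓘(ℝ, E) x} (dX : MDiffAt (T% X) x)
      (dY : MDiffAt (T% Y) x) : mlieBracket 𝓘(ℝ, E) X Y x = Dc Y x (X x) - Dc X x (Y x) := by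
    have h := Dc.torsion_apply dX dY
    rw [hT] at h
    exact (sub_eq_zero.1 h.symm).symm
  rw [dFundamentalForm, hd sY dZ, hd sZ dX, hd sX dY]
  simp only [fundamentalForm, hbr dX dY, hbr dY dZ, hbr dZ dX, map_sub, sub_apply]
  ring

theorem IsFlatConnection.isKahlerLike (h : IsFlatConnection D) (J : ComplexStructure E M) :
    IsKahlerLike J D := fun x X Y Z hX hY hZ ↦ by
  refine ⟨?_, ?_⟩
  · rw [h x X Y Z hX hY hZ, h x Y Z X hY hZ hX, h x Z X Y hZ hX hY, add_zero, add_zero]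
  · rw [h x _ _ Z (smoothFieldAt_onField hX) (smoothFieldAt_onField hY) hZ, h x X Y Z hX hY hZ]

theorem isKahler_of_isKahlerLike (hg : IsHermitianMetric J g) {s : ℝ} (hs0 : s ≠ 0)
    (hs1 : s ≠ 2 / 3) (hs2 : s ≠ 4 / 5) (hs3 : s ≠ 2) (hD : IsGauduchonConnection J g s D)
    (hK : IsKahlerLike J D) : IsKahler J g := by
  obtain ⟨Dc, Db, hc, hb, h⟩ := hD
  -- With a = s/2 the excluded values 0, 2, 2/3, 4/5 of s become 0, 1, 1/3, 2/5.
  exact isKahler_of_torsion_eq_zero hg hc.hermitian (chern_torsion_eq_zero hg hc hb h hK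
    (fun e ↦ hs0 (by linarith)) (fun e ↦ hs3 (by linarith)) (fun e ↦ hs1 (by linarith))
    (fun e ↦ hs2 (by linarith)))

end Transfer

end HermitianTorsion

end

theorem theoremB (n : ℕ) {M : Type*} [TopologicalSpace M]
    [ChartedSpace (EuclideanSpace ℝ (Fin (2 * n))) M]
    [IsManifold 𝓘(ℝ, EuclideanSpace ℝ (Fin (2 * n))) ∞ M]
    (J : ComplexStructure (EuclideanSpace ℝ (Fin (2 * n))) M)
    (g : ContMDiffRiemannianMetric 𝓘(ℝ, EuclideanSpace ℝ (Fin (2 * n))) ∞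
      (EuclideanSpace ℝ (Fin (2 * n)))
      (fun x : M ↦ TangentSpace 𝓘(ℝ, EuclideanSpace ℝ (Fin (2 * n))) x))
    (hg : IsHermitianMetric J g)
    (s : ℝ) (hs0 : s ≠ 0) (hs1 : s ≠ 2 / 3) (hs2 : s ≠ 4 / 5) (hs3 : s ≠ 2)
    (D : CovariantDerivative 𝓘(ℝ, EuclideanSpace ℝ (Fin (2 * n)))
      (EuclideanSpace ℝ (Fin (2 * n)))
      (fun x : M ↦ TangentSpace 𝓘(ℝ, EuclideanSpace ℝ (Fin (2 * n))) x))
    (hD : IsGauduchonConnection J g s D) :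
    (IsFlatConnection D → IsKahler J g) ∧ (IsKahlerLike J D → IsKahler J g) := by
  have key (h : IsKahlerLike J D) : IsKahler J g :=
    HermitianTorsion.isKahler_of_isKahlerLike hg hs0 hs1 hs2 hs3 hD h
  exact ⟨fun h ↦ key (HermitianTorsion.IsFlatConnection.isKahlerLike h J), key⟩
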